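/- **Setting.** Let $d\ge 1$, $L\ge 2$, $\sigma_w>0$, $\sigma_b,\sigma_i\ge 0$. Let $\varphi:\mathbb R\to\mathbb R$ be a nonzero function that is $C^\infty$ on $(-\infty,0)$ and on $(0,\infty)$, such that every derivative $\varphi^{(m)}$, $m \ge 0$, is bounded on each half-line by $a_m|x|^{q_m}+b_m$ for some $a_m,b_m,q_m>0$, and with $\varphi(0)=\frac12(\varphi(0+)+\varphi(0-))$. Write $\varphi_{\cdot c}(x)=\varphi(cx)$, and let $\widehat f(t)=\mathbb E[f(u)f(v)]$ for $|t|\le 1$ and $(u,v)$ centred Gaussian with covariance $\begin{pmatrix}1&t\\t&1\end{pmatrix}$. For $x,y\in\mathbb R^{d+1}$ put $$k_1(x,y)=\sigma_b^2\sigma_i^2+\sigma_w^2\langle x,y\rangle,\qquad k_{l+1}(x,y)=\sigma_b^2\sigma_i^2+\sigma_w^2\,\mathbb E[\varphi(u)\varphi(v)],$$ $$k^{\mathrm{NTK}}_1=\sigma_b^2(1-\sigma_i^2)+k_1,\qquad k^{\mathrm{NTK}}_{l+1}=\sigma_b^2(1-\sigma_i^2)+k_{l+1}+\sigma_w^2\,\mathbb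 E[\varphi'(u)\varphi'(v)]\,k^{\mathrm{NTK}}_l,$$ where $(u,v)$ is centred Gaussian with covariance $\begin{pmatrix}k_l(x,x)&k_l(x,y)\\k_l(y,x)&k_l(y,y)\end{pmatrix}$; $k^{\mathrm{NNGP}}_L=k_L$ and $k^{\mathrm{NTK}}_L$ are restricted to the sphere $\mathbb S^d$. Let $\alpha_1=\sigma_b^2\sigma_i^2+\sigma_w^2$, $\alpha_{l+1}=\sigma_b^2\sigma_i^2+\sigma_w^2\,\widehat{\varphi_{\cdot\sqrt{\alpha_l}}}(1)$, $G_1(t)=(\sigma_b^2\sigma_i^2+\sigma_w^2t)/\alpha_1$, $G_{l+1}=\big(\sigma_b^2\sigma_i^2+\sigma_w^2\,\widehat{\varphi_{\cdot\sqrt{\alpha_l}}}\circ G_l\big)/\alpha_{l+1}$, $H_1(t)=\sigma_b^2+\sigma_w^2t$ and $H_{l+1}=\sigma_b^2(1-\sigma_i^2)+\alpha_{l+1}G_{l+1}+\sigma_w^2\,\big(\widehat{(\varphi')_{\cdot\sqrt{\alpha_l}}}\circ G_l\big)\,H_l$ on $[-1,1]$. For a power series, $\deg_{\rm even}$ and $\deg_{\rm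 odd}$ denote the supremum in $\mathbb N_0\cup\{\pm\infty\}$ of the even, respectively odd, indices of its nonzero coefficients (with $\sup\emptyset=-\infty$). Let $E$ and $O$ denote the even and odd Hermite degrees of $\varphi$, defined in the same way from the coefficients $\langle\varphi,h_n\rangle_{L_2(\mathcal N(0,1))}$, where $h_n$ is the $n$-th normalized probabilists' Hermite polynomial. For a kernel $k$ on $\mathbb S^d$, $\mu_l(k)$ is the eigenvalue on the spherical harmonics of degree $l$ of the integral operator with kernel $k$ with respect to the surface measure of $\mathbb S^d$. Conventions: $\infty^0=1$, $0\cdot\infty=0$, $\infty-\infty=-\infty$. **Claim.** (1) *NNGP.* $G_L$ is the sum on $[-1,1]$ of a power series, the eigenvalues $\mu_l(k^{\mathrm{NNGP}}_L)$ are well defined, and for all $k\in\mathbb N_0$ and $r\in\{0,1\}$, $\mu_{2k+r}(k^{\mathrm{NNGP}}_L)>0$ if and only if $2k+r\le\deg_{\rm even}(G_L)$ (for $r=0$), respectively $2k+r\le\deg_{\rm odd}(G_L)$ (for $r=1$). (2) *NTK.* If $\varphi$ is continuous, the same holds for $k^{\mathrm{NTK}}_L$ with $H_L$ in place of $G_L$.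 (3) *Degrees.* Put $\sigma^2=\sigma_i^2\sigma_b^2$ for $F=G_L$, and $\sigma^2=\sigma_b^2$ for $F=H_L$ (with $\varphi$ continuous in the latter case). Then | case | $\deg_{\rm even}F$ | $\deg_{\rm odd}F$ | |---|---|---| | $\sigma^2>0,\ E>O$ | $E^{L-1}$ | $E^{L-1}-1$ if $E\neq 0$; $-\infty$ if $E=0$ (constant $\varphi$) | | $\sigma^2>0,\ E<O$ | $O^{L-1}-1$ | $O^{L-1}$ | | $\sigma^2=0,\ E>O$ | $E^{L-1}$ | $E(E^{L-2}-1)+O$ | | $\sigma^2=0,\ E<O$ | $O(O^{L-2}-1)+E$ | $O^{L-1}$ | | $E=O$ (then both are $\infty$) | $\infty$ | $\infty$ | (4) *Polynomial activations.* If $\varphi$ is a polynomial of degree $m$, then for $k=k^{\mathrm{NNGP}}_L$ and for $k=k^{\mathrm{NTK}}_L$ the functions in the reproducing kernel Hilbert space of $k$ on $\mathbb S^d$ are exactly the finite sums of spherical harmonics of degrees $l$ with $\mu_l(k)>0$, and the largest such degree is $m^{L-1}$. -/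

import Mathlib

open MeasureTheory ProbabilityTheory Filter Topology Polynomial
open scoped ContDiff

noncomputable section

/-! ### Activation functions -/

/-- `f` is smooth on the (open) set `I` and each of its derivatives is polynomially bounded on `I`. -/
def PolyBoundedSmooth (I : Set ℝ) (f : ℝ → ℝ) : Prop :=
  ContDiffOn ℝ ∞ f I ∧
    ∀ m : ℕ, ∃ a b q : ℝ, 0 < a ∧ 0 < b ∧ 0 < q ∧
      ∀ x ∈ I, |iteratedDerivWithin m f I x| ≤ a * |x| ^ q + b

/-- Admissible activation functions: smooth with polynomially bounded derivatives on each of the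
two open half-lines, with the mean of the two one-sided limits as value at `0`, and not the zero
function. -/
structure IsActivation (φ : ℝ → ℝ) : Prop where
  right : PolyBoundedSmooth (Set.Ioi 0) φ
  left : PolyBoundedSmooth (Set.Iio 0) φ
  at_zero : ∃ lp lm : ℝ, Tendsto φ (𝓝[>] 0) (𝓝 lp) ∧ Tendsto φ (𝓝[<] 0) (𝓝 lm) ∧
    φ 0 = (lp + lm) / 2
  ne_zero : φ ≠ 0

/-! ### Even and odd degrees -/

/-- The degree of a coefficient sequence: the supremum of the indices of its nonzero entries, in
`ℕ ∪ {-∞, ∞}` (the supremum of the empty set is `⊥ = -∞`). -/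
def seqDegree (a : ℕ → ℝ) : EReal := ⨆ (n : ℕ) (_ : a n ≠ 0), ((n : ℕ) : EReal)

/-- The even degree: the degree of `t ↦ p t + p (-t)`, where `p` has the coefficients `a` with
respect to a basis whose `n`-th member has the parity of `n`. -/
def seqDegEven (a : ℕ → ℝ) : EReal := seqDegree fun n => a n + (-1) ^ n * a n

/-- The odd degree: the degree of `t ↦ p t - p (-t)`. -/
def seqDegOdd (a : ℕ → ℝ) : EReal := seqDegree fun n => a n - (-1) ^ n * a n

/-- On `[-1, 1]`, `F` is the sum of the power series with coefficients `a`. -/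
def HasPowerSeriesOnUnit (F : ℝ → ℝ) (a : ℕ → ℝ) : Prop :=
  ∀ t ∈ Set.Icc (-1 : ℝ) 1, HasSum (fun n : ℕ => a n * t ^ n) (F t)

/-- The `n`-th Hermite coefficient `⟨f, hₙ⟩` in `L²(N(0,1))`, where `hₙ` is the `n`-th normalized
probabilists' Hermite polynomial. -/
def hermiteCoeff (f : ℝ → ℝ) (n : ℕ) : ℝ :=
  ∫ x, f x * (aeval x (Polynomial.hermite n) / √(n.factorial : ℝ)) ∂(gaussianReal 0 1)

/-- The even Hermite degree of a function. -/
def hermiteDegEven (f : ℝ → ℝ) : EReal := seqDegEven (hermiteCoeff f)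

/-- The odd Hermite degree of a function. -/
def hermiteDegOdd (f : ℝ → ℝ) : EReal := seqDegOdd (hermiteCoeff f)

/-! ### Gaussian expectations and the neural kernels -/

/-- `E[f u * f v]` for a centred Gaussian vector `(u, v)` with covariance matrix `S`. -/
def gaussExp (f : ℝ → ℝ) (S : Matrix (Fin 2) (Fin 2) ℝ) : ℝ :=
  ∫ z, f (z 0) * f (z 1) ∂(multivariateGaussian (0 : EuclideanSpace ℝ (Fin 2)) S)

/-- The dual activation (on `[-1, 1]`). -/
def dualAct (f : ℝ → ℝ) (t : ℝ) : ℝ := gaussExp f !![1, t; t, 1]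

/-- The NNGP kernel of the network with `l ≥ 1` layers (the value at `l = 0` is a dummy). -/
def nngpKernel {E : Type*} [NormedAddCommGroup E] [InnerProductSpace ℝ E]
    (φ : ℝ → ℝ) (σw σb σi : ℝ) : ℕ → E → E → ℝ
  | 0 => fun _ _ => 0
  | 1 => fun x y => σb ^ 2 * σi ^ 2 + σw ^ 2 * inner ℝ x y
  | l + 2 => fun x y => σb ^ 2 * σi ^ 2 + σw ^ 2 * gaussExp φ
      !![nngpKernel φ σw σb σi (l + 1) x x, nngpKernel φ σw σb σi (l + 1) x y;
         nngpKernel φ σw σb σi (l + 1) y x, nngpKernel φ σw σb σi (l + 1) y y]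

/-- The NTK of the network with `l ≥ 1` layers (the value at `l = 0` is a dummy). For a continuous
admissible `φ` the classical derivative `deriv φ` is defined away from `0`, a null set. -/
def ntkKernel {E : Type*} [NormedAddCommGroup E] [InnerProductSpace ℝ E]
    (φ : ℝ → ℝ) (σw σb σi : ℝ) : ℕ → E → E → ℝ
  | 0 => fun _ _ => 0
  | 1 => fun x y => σb ^ 2 * (1 - σi ^ 2) + nngpKernel φ σw σb σi 1 x y
  | l + 2 => fun x y => σb ^ 2 * (1 - σi ^ 2) + nngpKernel φ σw σb σi (l + 2) x y +
      σw ^ 2 * gaussExp (deriv φ)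
        !![nngpKernel φ σw σb σi (l + 1) x x, nngpKernel φ σw σb σi (l + 1) x y;
           nngpKernel φ σw σb σi (l + 1) y x, nngpKernel φ σw σb σi (l + 1) y y] *
        ntkKernel φ σw σb σi (l + 1) x y

/-- The layer variances `α_l`, `l ≥ 1` (the value at `l = 0` is a dummy). -/
def layerVar (φ : ℝ → ℝ) (σw σb σi : ℝ) : ℕ → ℝ
  | 0 => 0
  | 1 => σb ^ 2 * σi ^ 2 + σw ^ 2
  | l + 2 => σb ^ 2 * σi ^ 2 +
      σw ^ 2 * dualAct (fun x => φ (√(layerVar φ σw σb σi (l + 1)) * x)) 1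

/-- The normalized single-layer function `g_l`, `l ≥ 1`. -/
def layerFun (φ : ℝ → ℝ) (σw σb σi : ℝ) : ℕ → ℝ → ℝ
  | 0 => id
  | 1 => fun t => (σb ^ 2 * σi ^ 2 + σw ^ 2 * t) / layerVar φ σw σb σi 1
  | l + 2 => fun t => (σb ^ 2 * σi ^ 2 +
      σw ^ 2 * dualAct (fun x => φ (√(layerVar φ σw σb σi (l + 1)) * x)) t) /
        layerVar φ σw σb σi (l + 2)

/-- `G_l = g_l ∘ ⋯ ∘ g_1`. -/
def nngpG (φ : ℝ → ℝ) (σw σb σi : ℝ) : ℕ → ℝ → ℝ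
  | 0 => id
  | l + 1 => layerFun φ σw σb σi (l + 1) ∘ nngpG φ σw σb σi l

/-- The function `H_l`, `l ≥ 1`. -/
def ntkH (φ : ℝ → ℝ) (σw σb σi : ℝ) : ℕ → ℝ → ℝ
  | 0 => fun _ => 0
  | 1 => fun t => σb ^ 2 + σw ^ 2 * t
  | l + 2 => fun t => σb ^ 2 * (1 - σi ^ 2) +
      layerVar φ σw σb σi (l + 2) * nngpG φ σw σb σi (l + 2) t +
      σw ^ 2 * dualAct (fun x => deriv φ (√(layerVar φ σw σb σi (l + 1)) * x))
        (nngpG φ σw σb σi (l + 1) t) * ntkH φ σw σb σi (l + 1) t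

/-! ### Spherical harmonics, eigenvalues and RKHSs on the sphere `𝕊ᵈ ⊆ ℝᵈ⁺¹` -/

/-- The unit sphere `𝕊ᵈ` of `ℝᵈ⁺¹`. -/
abbrev UnitSphere (d : ℕ) : Type := Metric.sphere (0 : EuclideanSpace ℝ (Fin (d + 1))) 1

/-- The surface measure of `𝕊ᵈ`. -/
def surfaceMeasure (d : ℕ) : Measure (UnitSphere d) :=
  (volume : Measure (EuclideanSpace ℝ (Fin (d + 1)))).toSphere

/-- Restriction of polynomials in `d + 1` variables to `𝕊ᵈ`. -/
def restrictToSphere (d : ℕ) : MvPolynomial (Fin (d + 1)) ℝ →ₗ[ℝ] (UnitSphere d → ℝ) where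
  toFun p x := MvPolynomial.eval (fun i => (x : EuclideanSpace ℝ (Fin (d + 1))) i) p
  map_add' p q := by ext x; simp
  map_smul' c p := by ext x; simp [MvPolynomial.smul_eval]

/-- The Laplacian of polynomials. -/
def polyLaplacian (d : ℕ) :
    MvPolynomial (Fin (d + 1)) ℝ →ₗ[ℝ] MvPolynomial (Fin (d + 1)) ℝ :=
  ∑ i, (MvPolynomial.pderiv i).toLinearMap ∘ₗ (MvPolynomial.pderiv i).toLinearMap

/-- The spherical harmonics of degree `l` on `𝕊ᵈ`: the restrictions to `𝕊ᵈ` of the harmonic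
homogeneous polynomials of degree `l` in `d + 1` variables. -/
def sphericalHarmonics (d l : ℕ) : Submodule ℝ (UnitSphere d → ℝ) :=
  (MvPolynomial.homogeneousSubmodule (Fin (d + 1)) ℝ l ⊓ LinearMap.ker (polyLaplacian d)).map
    (restrictToSphere d)

/-- `μ l` is the eigenvalue of the integral operator of the kernel `k` on the spherical harmonics of
degree `l`, for all `l`. -/
def IsEigenvalueSeq (d : ℕ) (k : UnitSphere d → UnitSphere d → ℝ) (μ : ℕ → ℝ) : Prop :=
  ∀ l : ℕ, ∀ Y ∈ sphericalHarmonics d l, ∀ x : UnitSphere d,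
    ∫ y, k x y * Y y ∂(surfaceMeasure d) = μ l * Y x

/-- The set of functions of the reproducing kernel Hilbert space with kernel `k` (which is unique as
a Hilbert space of functions; the set is empty if there is none). -/
def rkhsFunctions {X : Type} (k : X → X → ℝ) : Set (X → ℝ) :=
  {f | ∃ (H : Type) (_ : NormedAddCommGroup H) (_ : InnerProductSpace ℝ H) (_ : CompleteSpace H)
    (_ : RKHS ℝ H X ℝ), (∀ x y : X, RKHS.kernel H x y 1 = k x y) ∧ ∃ h : H, ⇑h = f}

/-- The NNGP kernel restricted to `𝕊ᵈ`. -/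
def nngpSphere (d : ℕ) (φ : ℝ → ℝ) (σw σb σi : ℝ) (L : ℕ) (x y : UnitSphere d) : ℝ :=
  nngpKernel φ σw σb σi L (x : EuclideanSpace ℝ (Fin (d + 1))) (y : EuclideanSpace ℝ (Fin (d + 1)))

/-- The NTK restricted to `𝕊ᵈ`. -/
def ntkSphere (d : ℕ) (φ : ℝ → ℝ) (σw σb σi : ℝ) (L : ℕ) (x y : UnitSphere d) : ℝ :=
  ntkKernel φ σw σb σi L (x : EuclideanSpace ℝ (Fin (d + 1))) (y : EuclideanSpace ℝ (Fin (d + 1)))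

/-! ### The conclusions -/

/-- The eigenvalues of `k` exist and are unique, and the one of degree `2j` (resp. `2j + 1`) is
positive if and only if the degree is at most `dE` (resp. `dO`). -/
def PositiveUpTo (d : ℕ) (k : UnitSphere d → UnitSphere d → ℝ) (dE dO : EReal) : Prop :=
  (∃! μ : ℕ → ℝ, IsEigenvalueSeq d k μ) ∧
    ∀ μ : ℕ → ℝ, IsEigenvalueSeq d k μ → ∀ j : ℕ,
      (0 < μ (2 * j) ↔ ((2 * j : ℕ) : EReal) ≤ dE) ∧
      (0 < μ (2 * j + 1) ↔ ((2 * j + 1 : ℕ) : EReal) ≤ dO)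

/-- The table of even and odd degrees `dE`, `dO` at depth `L`, in terms of the bias parameter `s` and
the even and odd Hermite degrees `E`, `O` of the activation function. In `EReal`, `⊤ ^ 0 = 1`,
`⊤ * 0 = 0` and `⊤ + ⊥ = ⊥`. In the first row, a constant activation function (`E = 0`)
has odd degree `-∞`. -/
def DegreeTable (s : ℝ) (E O : EReal) (L : ℕ) (dE dO : EReal) : Prop :=
  (0 < s → O < E → dE = E ^ (L - 1) ∧ (E ≠ 0 → dO = E ^ (L - 1) - 1) ∧ (E = 0 → dO = ⊥)) ∧
  (0 < s → E < O → dE = O ^ (L - 1) - 1 ∧ dO = O ^ (L - 1)) ∧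
  (s = 0 → O < E → dE = E ^ (L - 1) ∧ dO = E * (E ^ (L - 2) - 1) + O) ∧
  (s = 0 → E < O → dE = O * (O ^ (L - 2) - 1) + E ∧ dO = O ^ (L - 1)) ∧
  (E = O → dE = ⊤ ∧ dO = ⊤)

/-- The RKHS of `k` consists precisely of the sums of spherical harmonics whose degrees have positive
eigenvalues, and the largest of these degrees is `N`. -/
def PolynomialRKHS (d : ℕ) (k : UnitSphere d → UnitSphere d → ℝ) (N : ℕ) : Prop :=
  ∀ μ : ℕ → ℝ, IsEigenvalueSeq d k μ →
    rkhsFunctions k = ((⨆ l ∈ {l : ℕ | 0 < μ l}, sphericalHarmonics d l :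
      Submodule ℝ (UnitSphere d → ℝ)) : Set (UnitSphere d → ℝ)) ∧
    IsGreatest {l : ℕ | 0 < μ l} N

end

noncomputable section

/-! On the sphere both kernels are zonal: they are `layerVar * nngpG` and `ntkH`, evaluated at the
inner product (`nngpKernel_eq`, `ntkKernel_eq`). By Mehler's formula
(`hasPowerSeriesOnUnit_dualAct`) a dual activation has the squared Hermite coefficients as its
Taylor coefficients. All series involved therefore have nonnegative coefficients, nothing cancels
under sums, products and compositions, and the supports of the series of `nngpG` and `ntkH` follow
from those of the Hermite expansions by operations on sets of naturals (`HasNonnegSeries.comp`,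
`LayerSupports`). Gaussian integration by parts turns the derivative into a shift of the Hermite
support by one; this needs a continuous activation, since a jump at 0 would add a boundary term.

The layers rescale the activation. Single Hermite coefficients are not scale invariant in their
vanishing, but the even and odd degrees are: the coefficients of one parity vanish from `N` on
exactly when the corresponding symmetric part is almost everywhere a polynomial of degree below `N`
(`hermiteCoeff_vanish_iff`), which dilations preserve.

The degree table is then combinatorics of iterated sumsets (`LayerSupports.degreeTable`). If the
dominating degree is a finite `m`, the maximum `m ^ l` arises by using the largest summand
everywhere. For the other parity one summand is lowered once and carried through all layers: with
bias and `m ≥ 1` the drop is 1, because 0 replaces 1 at the input; without bias it is the odd gap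
`δ` between the two degrees, and a parity count shows that no smaller drop is possible. Infinite
degrees are treated by finding unbounded elements of each parity.

For the eigenvalues, a Funk–Hecke formula for powers suffices: `⟨x, y⟩ ^ n` acts on the harmonics of
degree `l` by a nonnegative scalar which is positive exactly when `l ≤ n` and `n`, `l` have the same
parity (`powEigenvalue_pos_iff`). It is obtained by integrating against a Gaussian weight,
integrating by parts, and dividing by the radial integral. Summation over the series shows that `μ l
> 0` exactly when the support contains some `n ≥ l` of the parity of `l`.

For a polynomial activation the series is finite and the kernel has finitely many monomial features.
Its RKHS is their span (`rkhsFunctions_eq_span`), and homogeneous polynomials of degree `n` on the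
sphere decompose into harmonics of the degrees `l ≤ n` of the same parity
(`sphereHomogeneous_eq_iSup`), which matches the eigenvalue criterion. -/

/-! ### Polynomially bounded functions and the Gaussian measure -/

/-- The function `f` is bounded by a polynomial. -/
def PolyBdd (f : ℝ → ℝ) : Prop := ∃ (C : ℝ) (N : ℕ), ∀ x, |f x| ≤ C * (1 + |x|) ^ N

lemma PolyBdd.exists_nonneg {f : ℝ → ℝ} (hf : PolyBdd f) :
    ∃ (C : ℝ) (N : ℕ), 0 ≤ C ∧ ∀ x, |f x| ≤ C * (1 + |x|) ^ N := by
  obtain ⟨C, N, h⟩ := hf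
  refine ⟨C, N, ?_, h⟩
  simpa using (abs_nonneg _).trans (h 0)

lemma PolyBdd.mul {f g : ℝ → ℝ} (hf : PolyBdd f) (hg : PolyBdd g) :
    PolyBdd fun x => f x * g x := by
  obtain ⟨C, N, hC, h⟩ := hf.exists_nonneg
  obtain ⟨D, M, hD, h'⟩ := hg.exists_nonneg
  refine ⟨C * D, N + M, fun x => ?_⟩
  rw [abs_mul, pow_add]
  calc |f x| * |g x| ≤ (C * (1 + |x|) ^ N) * (D * (1 + |x|) ^ M) := by
        gcongr
        · exact h x
        · exact h' x
    _ = _ := by ring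

lemma PolyBdd.add {f g : ℝ → ℝ} (hf : PolyBdd f) (hg : PolyBdd g) :
    PolyBdd fun x => f x + g x := by
  obtain ⟨C, N, hC, h⟩ := hf.exists_nonneg
  obtain ⟨D, M, hD, h'⟩ := hg.exists_nonneg
  refine ⟨C + D, N + M, fun x => (abs_add_le _ _).trans ?_⟩
  have h1 : (1 : ℝ) ≤ 1 + |x| := by simp
  calc |f x| + |g x| ≤ C * (1 + |x|) ^ N + D * (1 + |x|) ^ M := add_le_add (h x) (h' x)
    _ ≤ C * (1 + |x|) ^ (N + M) + D * (1 + |x|) ^ (N + M) := by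
        gcongr <;> first | exact h1 | omega
    _ = _ := by ring

lemma PolyBdd.const (c : ℝ) : PolyBdd fun _ => c := ⟨|c|, 0, fun x => by simp⟩

lemma PolyBdd.id : PolyBdd fun x => x := ⟨1, 1, fun x => by simp⟩

lemma PolyBdd.sub {f g : ℝ → ℝ} (hf : PolyBdd f) (hg : PolyBdd g) :
    PolyBdd fun x => f x - g x := by
  simpa [sub_eq_add_neg] using hf.add ((PolyBdd.const (-1)).mul hg)

lemma PolyBdd.pow {f : ℝ → ℝ} (hf : PolyBdd f) (n : ℕ) : PolyBdd fun x => f x ^ n := by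
  induction n with
  | zero => simpa using PolyBdd.const 1
  | succ n ih => simpa [pow_succ] using ih.mul hf

lemma PolyBdd.polynomial (p : ℝ[X]) : PolyBdd fun x => p.eval x := by
  induction p using Polynomial.induction_on' with
  | add p q hp hq => simpa using hp.add hq
  | monomial n a => simpa using (PolyBdd.const a).mul (PolyBdd.id.pow n)

lemma PolyBdd.comp_mul {f : ℝ → ℝ} (hf : PolyBdd f) (c : ℝ) : PolyBdd fun x => f (c * x) := by
  obtain ⟨C, N, hC, h⟩ := hf.exists_nonneg
  refine ⟨C * (1 + |c|) ^ N, N, fun x => (h _).trans ?_⟩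
  rw [mul_assoc, ← mul_pow, abs_mul]
  have := abs_nonneg c
  have := abs_nonneg x
  gcongr
  nlinarith

/-- The power is dominated by `N! * exp (1 + |x|)`, and `exp |x|` by `exp x + exp (-x)`, whose
Gaussian integrals are finite. -/
lemma integrable_one_add_abs_pow (N : ℕ) :
    Integrable (fun x : ℝ => (1 + |x|) ^ N) (gaussianReal 0 1) := by
  have h1 := (integrable_exp_mul_gaussianReal (μ := 0) (v := 1) 1).add
    (integrable_exp_mul_gaussianReal (μ := 0) (v := 1) (-1))
  refine (h1.const_mul (N.factorial * Real.exp 1)).mono (by fun_prop) (ae_of_all _ fun x => ?_)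
  have hx : (0 : ℝ) ≤ 1 + |x| := by positivity
  have h2 : (1 + |x|) ^ N ≤ N.factorial * Real.exp (1 + |x|) := by
    have := Real.pow_div_factorial_le_exp (1 + |x|) hx N
    rwa [div_le_iff₀' (by positivity)] at this
  have h3 : Real.exp |x| ≤ Real.exp (1 * x) + Real.exp (-1 * x) := by
    rcases abs_cases x with ⟨h, _⟩ | ⟨h, _⟩ <;> rw [h] <;> simp <;> positivity
  rw [Real.norm_of_nonneg (by positivity)]
  refine le_trans ?_ (le_abs_self _)
  refine h2.trans ?_
  rw [Real.exp_add, mul_assoc, ← mul_assoc]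
  simp only [Pi.add_apply]
  rw [← mul_assoc]
  gcongr

lemma PolyBdd.integrable {f : ℝ → ℝ} (hf : PolyBdd f) (hm : Measurable f) :
    Integrable f (gaussianReal 0 1) := by
  obtain ⟨C, N, hC, h⟩ := hf.exists_nonneg
  refine ((integrable_one_add_abs_pow N).const_mul C).mono hm.aestronglyMeasurable
    (ae_of_all _ fun x => ?_)
  simpa using (h x).trans (le_abs_self _)

lemma PolyBdd.memLp {f : ℝ → ℝ} (hf : PolyBdd f) (hm : Measurable f) :
    MemLp f 2 (gaussianReal 0 1) := by
  rw [memLp_two_iff_integrable_sq hm.aestronglyMeasurable]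
  exact (hf.pow 2).integrable (hm.pow_const 2)

lemma gaussianPDFReal_std (x : ℝ) :
    gaussianPDFReal 0 1 x = (√(2 * Real.pi))⁻¹ * Real.exp (-x ^ 2 / 2) := by
  simp [gaussianPDFReal]

lemma hasDerivAt_gaussianPDFReal_std (x : ℝ) :
    HasDerivAt (gaussianPDFReal 0 1) (-x * gaussianPDFReal 0 1 x) x := by
  have h : gaussianPDFReal 0 1 = fun x => (√(2 * Real.pi))⁻¹ * Real.exp (-x ^ 2 / 2) :=
    funext gaussianPDFReal_std
  rw [h]
  have h1 : HasDerivAt (fun x : ℝ => -x ^ 2 / 2) (-x) x := by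
    have := ((hasDerivAt_pow 2 x).neg.div_const 2)
    refine this.congr_deriv ?_
    simp
    ring
  refine (h1.exp.const_mul (√(2 * Real.pi))⁻¹).congr_deriv ?_
  ring

lemma PolyBdd.integrable_mul_gaussianPDFReal {f : ℝ → ℝ} (hf : PolyBdd f) (hm : Measurable f) :
    Integrable (fun x => gaussianPDFReal 0 1 x * f x) := by
  have h := hf.integrable hm
  rw [gaussianReal_of_var_ne_zero 0 one_ne_zero,
    integrable_withDensity_iff_integrable_smul' (measurable_gaussianPDF _ _)
      (ae_of_all _ fun _ => gaussianPDF_lt_top)] at h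
  simpa using h

/-- Gaussian integration by parts for functions that may fail to be differentiable at `0`. -/
lemma integral_deriv_gaussianReal {f f' : ℝ → ℝ} (hc : Continuous f)
    (hd : ∀ x, x ≠ 0 → HasDerivAt f (f' x) x) (hf : PolyBdd f) (hf' : PolyBdd f')
    (hm' : Measurable f') :
    ∫ x, f' x ∂(gaussianReal 0 1) = ∫ x, x * f x ∂(gaussianReal 0 1) := by
  set w := gaussianPDFReal 0 1
  have hxf : PolyBdd fun x => x * f x := PolyBdd.id.mul hf
  have hcw : Continuous w := continuous_iff_continuousAt.2 fun x =>
    (hasDerivAt_gaussianPDFReal_std x).continuousAt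
  have i0 : Integrable (fun x => w x * f x) := hf.integrable_mul_gaussianPDFReal hc.measurable
  have i1 : Integrable (fun x => w x * (f' x - x * f x)) :=
    (hf'.sub hxf).integrable_mul_gaussianPDFReal (hm'.sub (measurable_id.mul hc.measurable))
  have hder : ∀ x, x ≠ 0 → HasDerivAt (fun x => w x * f x) (w x * (f' x - x * f x)) x := by
    intro x hx
    refine ((hasDerivAt_gaussianPDFReal_std x).mul (hd x hx)).congr_deriv ?_
    ring
  have hcont : Continuous fun x => w x * f x := hcw.mul hc
  -- The half-lines are treated separately because `f` need not be differentiable at 0; continuity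
  -- of `f` makes the two boundary terms at 0 cancel.
  have e1 : ∫ x in Set.Ioi 0, w x * (f' x - x * f x) = 0 - w 0 * f 0 :=
    integral_Ioi_of_hasDerivAt_of_tendsto hcont.continuousWithinAt
      (fun x hx => hder x (ne_of_gt hx)) i1.integrableOn
      (tendsto_zero_of_hasDerivAt_of_integrableOn_Ioi (a := 0)
        (fun x hx => hder x (ne_of_gt hx)) i1.integrableOn i0.integrableOn)
  have e2 : ∫ x in Set.Iic 0, w x * (f' x - x * f x) = w 0 * f 0 - 0 :=
    integral_Iic_of_hasDerivAt_of_tendsto hcont.continuousWithinAt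
      (fun x hx => hder x (ne_of_lt hx)) i1.integrableOn
      (tendsto_zero_of_hasDerivAt_of_integrableOn_Iic (a := -1)
        (fun x hx => hder x (by have : x ≤ -1 := hx; linarith)) i1.integrableOn i0.integrableOn)
  have e3 : ∫ x, w x * (f' x - x * f x) = 0 := by
    rw [← intervalIntegral.integral_Iic_add_Ioi i1.integrableOn i1.integrableOn, e1, e2]
    ring
  have e4 : ∫ x, (f' x - x * f x) ∂(gaussianReal 0 1) = 0 := by
    rw [integral_gaussianReal_eq_integral_smul one_ne_zero]
    simpa using e3
  rw [integral_sub (hf'.integrable hm') (hxf.integrable (measurable_id.mul hc.measurable))] at e4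
  linarith

/-! ### Hermite polynomials -/

/-- The probabilists' Hermite polynomials as functions on `ℝ`. -/
def hermiteFun (n : ℕ) (x : ℝ) : ℝ := aeval x (Polynomial.hermite n)

lemma hermiteFun_eq_eval (n : ℕ) (x : ℝ) :
    hermiteFun n x = ((Polynomial.hermite n).map (Int.castRingHom ℝ)).eval x := by
  simp [hermiteFun, aeval_def, eval_map]

lemma continuous_hermiteFun (n : ℕ) : Continuous (hermiteFun n) := by
  simp only [funext (hermiteFun_eq_eval n)]
  exact Polynomial.continuous _

lemma measurable_hermiteFun (n : ℕ) : Measurable (hermiteFun n) :=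
  (continuous_hermiteFun n).measurable

lemma polyBdd_hermiteFun (n : ℕ) : PolyBdd (hermiteFun n) := by
  simp only [funext (hermiteFun_eq_eval n)]
  exact PolyBdd.polynomial _

lemma derivative_hermite_succ (n : ℕ) :
    derivative (Polynomial.hermite (n + 1)) = (n + 1 : ℤ[X]) * Polynomial.hermite n := by
  induction n with
  | zero => simp
  | succ n ih =>
    have h2 : derivative (derivative (Polynomial.hermite (n + 1))) =
        (n + 1 : ℤ[X]) * derivative (Polynomial.hermite n) := by
      rw [ih]; simp
    rw [hermite_succ (n + 1), derivative_sub, derivative_mul, derivative_X, h2, ih,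
      hermite_succ n]
    push_cast
    ring

lemma hermiteFun_zero (x : ℝ) : hermiteFun 0 x = 1 := by simp [hermiteFun]

lemma hermiteFun_one (x : ℝ) : hermiteFun 1 x = x := by simp [hermiteFun]

lemma hasDerivAt_hermiteFun_zero (x : ℝ) : HasDerivAt (hermiteFun 0) 0 x := by
  rw [funext hermiteFun_zero]; exact hasDerivAt_const _ _

lemma hasDerivAt_hermiteFun_succ (n : ℕ) (x : ℝ) :
    HasDerivAt (hermiteFun (n + 1)) ((n + 1) * hermiteFun n x) x := by
  have h := ((Polynomial.hermite (n + 1)).map (Int.castRingHom ℝ)).hasDerivAt x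
  rw [derivative_map, derivative_hermite_succ] at h
  simp only [funext (hermiteFun_eq_eval (n + 1)), hermiteFun_eq_eval n]
  simpa using h

lemma hermiteFun_succ (n : ℕ) (x : ℝ) :
    hermiteFun (n + 1) x = x * hermiteFun n x - deriv (hermiteFun n) x := by
  have h := ((Polynomial.hermite n).map (Int.castRingHom ℝ)).hasDerivAt x
  rw [← funext (hermiteFun_eq_eval n)] at h
  rw [h.deriv, derivative_map, hermiteFun_eq_eval, hermiteFun_eq_eval, hermite_succ]
  simp

lemma hermiteFun_succ_succ (n : ℕ) (x : ℝ) :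
    hermiteFun (n + 2) x = x * hermiteFun (n + 1) x - (n + 1) * hermiteFun n x := by
  rw [hermiteFun_succ, (hasDerivAt_hermiteFun_succ n x).deriv]

lemma hermiteFun_neg (n : ℕ) (x : ℝ) : hermiteFun n (-x) = (-1) ^ n * hermiteFun n x := by
  induction n using Nat.twoStepInduction with
  | zero => simp [hermiteFun_zero]
  | one => simp [hermiteFun_one]
  | more n h0 h1 =>
    rw [hermiteFun_succ_succ, hermiteFun_succ_succ, h0, h1]
    ring

/-- Differentiation shifts the Hermite coefficients. -/
lemma integral_deriv_mul_hermiteFun {f f' : ℝ → ℝ} (hc : Continuous f)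
    (hd : ∀ x, x ≠ 0 → HasDerivAt f (f' x) x) (hf : PolyBdd f) (hf' : PolyBdd f')
    (hm' : Measurable f') (n : ℕ) :
    ∫ x, f' x * hermiteFun n x ∂(gaussianReal 0 1) =
      ∫ x, f x * hermiteFun (n + 1) x ∂(gaussianReal 0 1) := by
  have hH : ∃ g : ℝ → ℝ, (∀ x, HasDerivAt (hermiteFun n) (g x) x) ∧ PolyBdd g ∧ Measurable g := by
    cases n with
    | zero => exact ⟨_, hasDerivAt_hermiteFun_zero, PolyBdd.const 0, measurable_const⟩
    | succ n => exact ⟨_, hasDerivAt_hermiteFun_succ n,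
        (PolyBdd.const _).mul (polyBdd_hermiteFun n), (measurable_hermiteFun n).const_mul _⟩
  obtain ⟨g, hg, hgb, hgm⟩ := hH
  have hb := polyBdd_hermiteFun n
  have hbm := measurable_hermiteFun n
  have i1 := (hf'.mul hb).integrable (hm'.mul hbm)
  have i2 := (hf.mul hgb).integrable (hc.measurable.mul hgm)
  have key := integral_deriv_gaussianReal (f := fun x => f x * hermiteFun n x)
    (f' := fun x => f' x * hermiteFun n x + f x * g x) (hc.mul (continuous_hermiteFun n))
    (fun x hx => (hd x hx).mul (hg x)) (hf.mul hb) ((hf'.mul hb).add (hf.mul hgb))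
    ((hm'.mul hbm).add (hc.measurable.mul hgm))
  rw [integral_add i1 i2] at key
  have e : ∀ x, f x * hermiteFun (n + 1) x = x * (f x * hermiteFun n x) - f x * g x := by
    intro x
    rw [hermiteFun_succ, (hg x).deriv]
    ring
  simp_rw [e]
  rw [integral_sub ((PolyBdd.id.mul (hf.mul hb)).integrable
    (measurable_id.mul (hc.measurable.mul hbm))) i2]
  linarith

/-- Iterating this shows that pairing with the `n`-th Hermite polynomial amounts to integrating the
`n`-th derivative; the two evaluations that follow and the orthogonality relations come from it. -/
lemma integral_polynomial_mul_hermiteFun (n : ℕ) (p : ℝ[X]) :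
    ∫ x, p.eval x * hermiteFun (n + 1) x ∂(gaussianReal 0 1) =
      ∫ x, (derivative p).eval x * hermiteFun n x ∂(gaussianReal 0 1) :=
  (integral_deriv_mul_hermiteFun p.continuous (fun x _ => p.hasDerivAt x)
    (PolyBdd.polynomial p) (PolyBdd.polynomial _) (Polynomial.continuous _).measurable n).symm

lemma integral_polynomial_mul_hermiteFun_of_degree_lt (n : ℕ) (p : ℝ[X]) (hp : p.degree < n) :
    ∫ x, p.eval x * hermiteFun n x ∂(gaussianReal 0 1) = 0 := by
  induction n generalizing p with
  | zero =>
    have : p = 0 := by simpa using hp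
    simp [this]
  | succ n ih =>
    rw [integral_polynomial_mul_hermiteFun]
    apply ih
    by_cases h0 : p = 0
    · simp [h0]
    · have := degree_derivative_lt h0
      have h3 : p.degree ≤ n := by
        rw [degree_eq_natDegree h0] at hp ⊢
        norm_cast at hp ⊢
        omega
      exact this.trans_le h3

lemma integral_polynomial_mul_hermiteFun_natDegree (n : ℕ) (p : ℝ[X]) (hp : p.natDegree = n) :
    ∫ x, p.eval x * hermiteFun n x ∂(gaussianReal 0 1) = n.factorial * p.leadingCoeff := by
  induction n generalizing p with
  | zero =>
    rw [eq_C_of_natDegree_eq_zero hp]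
    simp [hermiteFun_zero]
  | succ n ih =>
    have h1 : (derivative p).natDegree = n := by
      rw [natDegree_derivative, hp]; rfl
    rw [integral_polynomial_mul_hermiteFun, ih _ h1, leadingCoeff, h1, coeff_derivative,
      leadingCoeff, hp, Nat.factorial_succ]
    push_cast
    ring

lemma integral_hermiteFun_mul_hermiteFun (n m : ℕ) :
    ∫ x, hermiteFun n x * hermiteFun m x ∂(gaussianReal 0 1) =
      if n = m then (n.factorial : ℝ) else 0 := by
  have hdeg : ∀ n, ((Polynomial.hermite n).map (Int.castRingHom ℝ)).degree = n := fun n => by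
    rw [(hermite_monic n).degree_map, degree_hermite]
  have hlt : ∀ n m, n < m → ∫ x, hermiteFun n x * hermiteFun m x ∂(gaussianReal 0 1) = 0 := by
    intro n m h
    simp_rw [hermiteFun_eq_eval n]
    apply integral_polynomial_mul_hermiteFun_of_degree_lt
    rw [hdeg]
    exact_mod_cast h
  rcases lt_trichotomy n m with h | h | h
  · rw [hlt n m h, if_neg h.ne]
  · subst h
    simp_rw [hermiteFun_eq_eval n]
    simp_rw [← hermiteFun_eq_eval n]
    have := integral_polynomial_mul_hermiteFun_natDegree n
      ((Polynomial.hermite n).map (Int.castRingHom ℝ)) (natDegree_eq_of_degree_eq_some (hdeg n))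
    rw [((hermite_monic n).map _).leadingCoeff] at this
    simpa [← hermiteFun_eq_eval] using this
  · simp_rw [mul_comm (hermiteFun n _)]
    rw [hlt m n h, if_neg h.ne']

/-- Hermite polynomials are eigenfunctions of the Ornstein-Uhlenbeck semigroup. -/
lemma integral_hermiteFun_ornsteinUhlenbeck (n : ℕ) {t s : ℝ} (h : t ^ 2 + s ^ 2 = 1) (x : ℝ) :
    ∫ y, hermiteFun n (t * x + s * y) ∂(gaussianReal 0 1) = t ^ n * hermiteFun n x := by
  have hpoly : ∀ n, ∃ p : ℝ[X], ∀ y, hermiteFun n (t * x + s * y) = p.eval y := fun n =>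
    ⟨((Polynomial.hermite n).map (Int.castRingHom ℝ)).comp (C (t * x) + C s * X), fun y => by
      simp [hermiteFun_eq_eval]⟩
  have hb : ∀ n, PolyBdd fun y => hermiteFun n (t * x + s * y) := fun n => by
    obtain ⟨p, hp⟩ := hpoly n
    simp_rw [hp]; exact PolyBdd.polynomial p
  have hm : ∀ n, Measurable fun y => hermiteFun n (t * x + s * y) := fun n =>
    (measurable_hermiteFun n).comp (by fun_prop)
  have hi : ∀ n, Integrable (fun y => hermiteFun n (t * x + s * y)) (gaussianReal 0 1) := fun n =>
    (hb n).integrable (hm n)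
  induction n using Nat.twoStepInduction with
  | zero => simp [hermiteFun_zero]
  | one =>
    simp only [hermiteFun_one, pow_one]
    rw [integral_add (integrable_const _) ((PolyBdd.id.integrable measurable_id).const_mul s),
      integral_const_mul s, integral_id_gaussianReal]
    simp
  | more n h0 h1 =>
    -- Integration by parts in `y` removes the factor `y` produced by the three-term recursion, at
    -- the cost of a factor `s`; then `s ^ 2 - 1 = -t ^ 2` closes the recursion in `n`.
    have hst : ∫ y, y * hermiteFun (n + 1) (t * x + s * y) ∂(gaussianReal 0 1) =
        ∫ y, s * ((n + 1) * hermiteFun n (t * x + s * y)) ∂(gaussianReal 0 1) := by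
      symm
      apply integral_deriv_gaussianReal
      · exact (continuous_hermiteFun _).comp (by fun_prop)
      · intro y _
        have h2 : HasDerivAt (fun y : ℝ => t * x + s * y) s y := by
          simpa using ((hasDerivAt_id y).const_mul s).const_add (t * x)
        exact ((hasDerivAt_hermiteFun_succ n (t * x + s * y)).comp y h2).congr_deriv (mul_comm _ _)
      · exact hb _
      · exact (PolyBdd.const s).mul ((PolyBdd.const _).mul (hb n))
      · exact ((hm n).const_mul _).const_mul _
    have e : ∀ y, hermiteFun (n + 2) (t * x + s * y) = t * x * hermiteFun (n + 1) (t * x + s * y) +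
        s * (y * hermiteFun (n + 1) (t * x + s * y)) -
          (n + 1) * hermiteFun n (t * x + s * y) := by
      intro y; rw [hermiteFun_succ_succ]; ring
    simp_rw [e]
    have i2 : Integrable (fun y => s * (y * hermiteFun (n + 1) (t * x + s * y)))
        (gaussianReal 0 1) :=
      ((PolyBdd.const s).mul (PolyBdd.id.mul (hb (n + 1)))).integrable
        ((measurable_id.mul (hm (n + 1))).const_mul s)
    have i1 := (hi (n + 1)).const_mul (t * x)
    rw [integral_sub (i1.fun_add i2) ((hi n).const_mul _), integral_add i1 i2, integral_const_mul, integral_const_mul,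
      integral_const_mul, hst, integral_const_mul, integral_const_mul, h0, h1,
      hermiteFun_succ_succ]
    linear_combination ((n + 1) * t ^ n * hermiteFun n x) * h

/-! ### Completeness of the Hermite polynomials -/

lemma memLp_exp_abs_mul (t : ℝ) :
    MemLp (fun x : ℝ => Real.exp |t * x|) 2 (gaussianReal 0 1) := by
  rw [memLp_two_iff_integrable_sq (by fun_prop)]
  have h1 := (integrable_exp_mul_gaussianReal (μ := 0) (v := 1) (2 * t)).add
    (integrable_exp_mul_gaussianReal (μ := 0) (v := 1) (-(2 * t)))
  refine h1.mono (by fun_prop) (ae_of_all _ fun x => ?_)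
  rw [Real.norm_of_nonneg (by positivity)]
  refine le_trans ?_ (le_abs_self _)
  rw [← Real.exp_nat_mul]
  simp only [Pi.add_apply]
  rcases abs_cases (t * x) with ⟨h, _⟩ | ⟨h, _⟩ <;> rw [h]
  · have : ((2 : ℕ) : ℝ) * (t * x) = 2 * t * x := by push_cast; ring
    rw [this]
    linarith [Real.exp_pos (-(2 * t) * x)]
  · have : ((2 : ℕ) : ℝ) * -(t * x) = -(2 * t) * x := by push_cast; ring
    rw [this]
    linarith [Real.exp_pos (2 * t * x)]

/-- A function in `L²(N(0,1))` orthogonal to all monomials has vanishing Fourier transform. -/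
lemma integral_mul_cexp_eq_zero {F : ℝ → ℝ} (hF : MemLp F 2 (gaussianReal 0 1))
    (h : ∀ k : ℕ, ∫ x, F x * x ^ k ∂(gaussianReal 0 1) = 0) (t : ℝ) :
    ∫ x, (F x : ℂ) * Complex.exp (t * x * Complex.I) ∂(gaussianReal 0 1) = 0 := by
  have hs : ∀ x : ℝ, HasSum (fun n : ℕ => |F x| * (|t * x| ^ n / n.factorial))
      (|F x| * Real.exp |t * x|) := fun x => by
    have := NormedSpace.expSeries_div_hasSum_exp (𝔸 := ℝ) |t * x|
    rw [← Real.exp_eq_exp_ℝ] at this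
    exact this.mul_left _
  -- The exponential series is integrated termwise. The dominating function `|F| * exp |t * x|` is
  -- integrable because both factors are in `L²`.
  have key := hasSum_integral_of_dominated_convergence (μ := gaussianReal 0 1)
    (F := fun (n : ℕ) (x : ℝ) => (F x : ℂ) * ((t * x * Complex.I) ^ n / n.factorial))
    (f := fun x : ℝ => (F x : ℂ) * Complex.exp (t * x * Complex.I))
    (fun n x => |F x| * (|t * x| ^ n / n.factorial)) ?_ ?_ ?_ ?_ ?_
  · refine key.unique ?_
    have : ∀ n : ℕ, ∫ x : ℝ, (F x : ℂ) * ((t * x * Complex.I) ^ n / n.factorial)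
        ∂(gaussianReal 0 1) = 0 := by
      intro n
      have e : ∀ x : ℝ, (F x : ℂ) * ((t * x * Complex.I) ^ n / n.factorial) =
          ((t * Complex.I) ^ n / n.factorial) * ((F x * x ^ n : ℝ) : ℂ) := by
        intro x; push_cast; ring
      simp_rw [e]
      rw [integral_const_mul, integral_complex_ofReal, h n]
      simp
    simp_rw [this]
    exact hasSum_zero
  · intro n
    exact (Complex.continuous_ofReal.comp_aestronglyMeasurable hF.1).mul
      (by fun_prop)
  · intro n
    refine ae_of_all _ fun x => le_of_eq ?_
    simp [abs_mul]
  · exact ae_of_all _ fun x => (hs x).summable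
  · simp_rw [fun x => (hs x).tsum_eq]
    exact hF.norm.integrable_mul (memLp_exp_abs_mul t)
  · refine ae_of_all _ fun x => ?_
    have := NormedSpace.expSeries_div_hasSum_exp (𝔸 := ℂ) (t * x * Complex.I)
    rw [← Complex.exp_eq_exp_ℂ] at this
    exact this.mul_left _

/-- An integrable function with vanishing Fourier transform vanishes almost everywhere. -/
lemma ae_eq_zero_of_integral_mul_cexp {F : ℝ → ℝ} {μ : Measure ℝ} [IsFiniteMeasure μ]
    (hF : Integrable F μ)
    (h : ∀ t : ℝ, ∫ x, (F x : ℂ) * Complex.exp (t * x * Complex.I) ∂μ = 0) :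
    F =ᵐ[μ] 0 := by
  have f1 : IsFiniteMeasure (μ.withDensity fun x => ENNReal.ofReal (F x)) :=
    isFiniteMeasure_withDensity_ofReal hF.2
  have f2 : IsFiniteMeasure (μ.withDensity fun x => ENNReal.ofReal (-F x)) :=
    isFiniteMeasure_withDensity_ofReal hF.neg.2
  have m1 : AEMeasurable (fun x => ENNReal.ofReal (F x)) μ := hF.1.aemeasurable.ennreal_ofReal
  have m2 : AEMeasurable (fun x => ENNReal.ofReal (-F x)) μ := hF.neg.1.aemeasurable.ennreal_ofReal
  -- The positive and the negative part of `F` are densities of two finite measures; the hypothesis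
  -- says that their characteristic functions agree.
  have key : (μ.withDensity fun x => ENNReal.ofReal (F x)) =
      μ.withDensity fun x => ENNReal.ofReal (-F x) := by
    apply Measure.ext_of_charFun
    ext t
    rw [charFun_apply_real, charFun_apply_real,
      integral_withDensity_eq_integral_toReal_smul₀ m1 (ae_of_all _ fun _ => ENNReal.ofReal_lt_top),
      integral_withDensity_eq_integral_toReal_smul₀ m2 (ae_of_all _ fun _ => ENNReal.ofReal_lt_top),
      ← sub_eq_zero]
    have hi : ∀ G : ℝ → ℝ, Integrable G μ →
        Integrable (fun x => (ENNReal.ofReal (G x)).toReal • Complex.exp (t * x * Complex.I)) μ := by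
      intro G hG
      refine (hG.norm).mono ((hG.1.aemeasurable.ennreal_ofReal.ennreal_toReal
        |>.aestronglyMeasurable).smul (by fun_prop)) (ae_of_all _ fun x => ?_)
      have : Complex.exp (t * x * Complex.I) = Complex.exp ((t * x : ℝ) * Complex.I) := by simp
      rw [norm_smul, this, Complex.norm_exp_ofReal_mul_I, mul_one, ENNReal.toReal_ofReal', norm_norm,
        Real.norm_of_nonneg (le_max_right _ _), Real.norm_eq_abs]
      exact max_le (le_abs_self _) (abs_nonneg _)
    rw [← integral_sub (hi F hF) (hi (fun x => -F x) hF.neg), ← h t]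
    congr 1
    ext x
    rw [← sub_smul, ENNReal.toReal_ofReal', ENNReal.toReal_ofReal', Complex.real_smul]
    congr 2
    rcases le_total 0 (F x) with hx | hx
    · rw [max_eq_left hx, max_eq_right (by linarith)]; ring
    · rw [max_eq_right hx, max_eq_left (by linarith)]; ring
  rw [withDensity_eq_iff_of_sigmaFinite m1 m2] at key
  filter_upwards [key] with x hx
  rcases le_total 0 (F x) with h0 | h0
  · rw [ENNReal.ofReal_of_nonpos (by linarith : -F x ≤ 0), ENNReal.ofReal_eq_zero] at hx
    exact le_antisymm hx h0
  · rw [ENNReal.ofReal_of_nonpos h0, eq_comm, ENNReal.ofReal_eq_zero] at hx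
    simp only [Pi.zero_apply]
    linarith

lemma MemLp.integrable_mul_hermiteFun {F : ℝ → ℝ} (hF : MemLp F 2 (gaussianReal 0 1)) {g : ℝ → ℝ}
    (hg : PolyBdd g) (hm : Measurable g) : Integrable (fun x => F x * g x) (gaussianReal 0 1) :=
  hF.integrable_mul (hg.memLp hm)

/-- The Hermite polynomials are complete in `L²(N(0,1))`. -/
lemma ae_eq_zero_of_integral_mul_hermiteFun {F : ℝ → ℝ} (hF : MemLp F 2 (gaussianReal 0 1))
    (h : ∀ n : ℕ, ∫ x, F x * hermiteFun n x ∂(gaussianReal 0 1) = 0) :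
    F =ᵐ[gaussianReal 0 1] 0 := by
  -- Monomials are reached by multiplying with `x` through the three-term recursion; the induction
  -- on `k` needs all `n` at once, and only `n = 0` is used afterwards.
  have hmon : ∀ k n : ℕ, ∫ x, F x * (x ^ k * hermiteFun n x) ∂(gaussianReal 0 1) = 0 := by
    intro k
    induction k with
    | zero => simpa using h
    | succ k ih =>
      intro n
      cases n with
      | zero =>
        have := ih 1
        simp only [hermiteFun_one, hermiteFun_zero, mul_one, pow_succ] at this ⊢
        exact this
      | succ n =>
        have e : ∀ x, F x * (x ^ (k + 1) * hermiteFun (n + 1) x) =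
            F x * (x ^ k * hermiteFun (n + 2) x) +
              (n + 1) * (F x * (x ^ k * hermiteFun n x)) := by
          intro x; rw [hermiteFun_succ_succ]; ring
        have hi : ∀ n, Integrable (fun x => F x * (x ^ k * hermiteFun n x)) (gaussianReal 0 1) :=
          fun n => MemLp.integrable_mul_hermiteFun hF ((PolyBdd.id.pow k).mul (polyBdd_hermiteFun n))
            ((measurable_id.pow_const k).mul (measurable_hermiteFun n))
        simp_rw [e]
        rw [integral_add (hi _) ((hi n).const_mul _), integral_const_mul, ih, ih]
        simp
  exact ae_eq_zero_of_integral_mul_cexp (hF.integrable one_le_two) (integral_mul_cexp_eq_zero hF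
    fun k => by simpa [hermiteFun_zero] using hmon k 0)

/-! ### Parseval's identity -/

/-- The normalized Hermite polynomials. -/
def normHermite (n : ℕ) (x : ℝ) : ℝ := hermiteFun n x / √(n.factorial : ℝ)

lemma polyBdd_normHermite (n : ℕ) : PolyBdd (normHermite n) := by
  exact (polyBdd_hermiteFun n).mul (PolyBdd.const (√(n.factorial : ℝ))⁻¹)

lemma measurable_normHermite (n : ℕ) : Measurable (normHermite n) :=
  (measurable_hermiteFun n).div_const _

lemma hermiteCoeff_eq (f : ℝ → ℝ) (n : ℕ) :
    hermiteCoeff f n = ∫ x, f x * normHermite n x ∂(gaussianReal 0 1) := rfl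

lemma hermiteCoeff_eq_div (f : ℝ → ℝ) (n : ℕ) :
    hermiteCoeff f n = (∫ x, f x * hermiteFun n x ∂(gaussianReal 0 1)) / √(n.factorial : ℝ) := by
  rw [hermiteCoeff_eq, ← integral_div]
  simp only [normHermite, mul_div_assoc]

lemma inner_toLp_gaussian {f g : ℝ → ℝ} (hf : MemLp f 2 (gaussianReal 0 1))
    (hg : MemLp g 2 (gaussianReal 0 1)) :
    inner ℝ (hf.toLp f) (hg.toLp g) = ∫ x, f x * g x ∂(gaussianReal 0 1) := by
  rw [L2.inner_def]
  refine integral_congr_ae ?_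
  filter_upwards [hf.coeFn_toLp, hg.coeFn_toLp] with x h1 h2
  rw [h1, h2]
  simp [mul_comm]

lemma orthonormal_normHermite : Orthonormal ℝ fun n : ℕ =>
    ((polyBdd_normHermite n).memLp (measurable_normHermite n)).toLp (normHermite n) := by
  rw [orthonormal_iff_ite]
  intro n m
  rw [inner_toLp_gaussian]
  have e : ∀ x, normHermite n x * normHermite m x =
      (hermiteFun n x * hermiteFun m x) / (√(n.factorial : ℝ) * √(m.factorial : ℝ)) := by
    intro x; rw [normHermite, normHermite, div_mul_div_comm]
  simp_rw [e]
  rw [integral_div, integral_hermiteFun_mul_hermiteFun]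
  split_ifs with h
  · subst h
    rw [Real.mul_self_sqrt (by positivity)]
    exact div_self (by positivity)
  · simp

lemma span_normHermite_orthogonal : (Submodule.span ℝ (Set.range fun n : ℕ =>
    ((polyBdd_normHermite n).memLp (measurable_normHermite n)).toLp (normHermite n)))ᗮ = ⊥ := by
  rw [Submodule.eq_bot_iff]
  intro F hF
  rw [Submodule.mem_orthogonal] at hF
  have hL := Lp.memLp F
  have h0 : (F : ℝ → ℝ) =ᵐ[gaussianReal 0 1] 0 := by
    apply ae_eq_zero_of_integral_mul_hermiteFun hL
    intro n
    have h1 := hF _ (Submodule.subset_span ⟨n, rfl⟩)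
    rw [← Lp.toLp_coeFn F hL, inner_toLp_gaussian] at h1
    have e : ∀ x, normHermite n x * F x = (F x * hermiteFun n x) / √(n.factorial : ℝ) := by
      intro x; rw [normHermite]; ring
    simp_rw [e] at h1
    rw [integral_div, div_eq_zero_iff] at h1
    refine h1.resolve_right (by positivity)
  exact (Lp.eq_zero_iff_ae_eq_zero).2 h0

/-- Parseval's identity for Hermite expansions. -/
lemma hasSum_hermiteCoeff_mul {f g : ℝ → ℝ} (hf : MemLp f 2 (gaussianReal 0 1))
    (hg : MemLp g 2 (gaussianReal 0 1)) :
    HasSum (fun n => hermiteCoeff f n * hermiteCoeff g n) (∫ x, f x * g x ∂(gaussianReal 0 1)) := by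
  have h := (HilbertBasis.mkOfOrthogonalEqBot orthonormal_normHermite
    span_normHermite_orthogonal).hasSum_inner_mul_inner (hf.toLp f) (hg.toLp g)
  simp only [HilbertBasis.coe_mkOfOrthogonalEqBot, inner_toLp_gaussian] at h
  simp only [hermiteCoeff_eq]
  have e : ∀ n x, normHermite n x * g x = g x * normHermite n x := fun n x => mul_comm _ _
  simpa only [e] using h

/-! ### Bivariate Gaussian expectations -/

/-- The covariance is `M * Mᵀ` for `M = !![a, b; c, e]`, and characteristic functions agree. No
invertibility is required, so the degenerate correlations `±1` are covered. -/
lemma multivariateGaussian_two_eq_map (a b c e : ℝ) :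
    multivariateGaussian (0 : EuclideanSpace ℝ (Fin 2))
      !![a ^ 2 + b ^ 2, a * c + b * e; a * c + b * e, c ^ 2 + e ^ 2] =
    ((gaussianReal 0 1).prod (gaussianReal 0 1)).map
      (fun p : ℝ × ℝ => !₂[a * p.1 + b * p.2, c * p.1 + e * p.2]) := by
  have hS : (!![a ^ 2 + b ^ 2, a * c + b * e; a * c + b * e, c ^ 2 + e ^ 2] :
      Matrix (Fin 2) (Fin 2) ℝ).PosSemidef := by
    have : (!![a ^ 2 + b ^ 2, a * c + b * e; a * c + b * e, c ^ 2 + e ^ 2] :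
      Matrix (Fin 2) (Fin 2) ℝ) = !![a, b; c, e] * (!![a, b; c, e]).conjTranspose := by
      ext i j
      fin_cases i <;> fin_cases j <;> simp [Matrix.mul_apply, Fin.sum_univ_two] <;> ring
    rw [this]
    exact Matrix.posSemidef_self_mul_conjTranspose _
  have hm : Measurable (fun p : ℝ × ℝ =>
      (!₂[a * p.1 + b * p.2, c * p.1 + e * p.2] : EuclideanSpace ℝ (Fin 2))) := by
    refine (WithLp.measurable_toLp 2 _).comp ?_
    refine measurable_pi_iff.2 fun i => ?_
    fin_cases i <;> simp <;> fun_prop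
  have : IsProbabilityMeasure (((gaussianReal 0 1).prod (gaussianReal 0 1)).map
      (fun p : ℝ × ℝ => (!₂[a * p.1 + b * p.2, c * p.1 + e * p.2] : EuclideanSpace ℝ (Fin 2)))) :=
    Measure.isProbabilityMeasure_map hm.aemeasurable
  apply Measure.ext_of_charFun
  ext ξ
  rw [charFun_multivariateGaussian hS, charFun_apply, integral_map hm.aemeasurable (by fun_prop)]
  have e1 : ∀ p : ℝ × ℝ, Complex.exp
      ((inner ℝ (!₂[a * p.1 + b * p.2, c * p.1 + e * p.2] : EuclideanSpace ℝ (Fin 2)) ξ : ℝ) *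
        Complex.I) =
      Complex.exp (((a * ξ 0 + c * ξ 1 : ℝ) : ℂ) * p.1 * Complex.I) *
        Complex.exp (((b * ξ 0 + e * ξ 1 : ℝ) : ℂ) * p.2 * Complex.I) := by
    intro p
    rw [← Complex.exp_add]
    congr 1
    simp [PiLp.inner_apply, Fin.sum_univ_two]
    ring
  simp_rw [e1]
  rw [integral_prod_mul (fun x : ℝ => Complex.exp (((a * ξ 0 + c * ξ 1 : ℝ) : ℂ) * x * Complex.I))
    (fun x : ℝ => Complex.exp (((b * ξ 0 + e * ξ 1 : ℝ) : ℂ) * x * Complex.I)),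
    ← charFun_apply_real, ← charFun_apply_real, charFun_gaussianReal, charFun_gaussianReal,
    ← Complex.exp_add]
  congr 1
  simp [Matrix.mulVec, dotProduct, Fin.sum_univ_two]
  ring

lemma integral_bivariateGaussian {f g : ℝ → ℝ} (hf : Measurable f) (hg : Measurable g)
    (a b c e : ℝ) :
    ∫ z, f (z 0) * g (z 1) ∂(multivariateGaussian (0 : EuclideanSpace ℝ (Fin 2))
      !![a ^ 2 + b ^ 2, a * c + b * e; a * c + b * e, c ^ 2 + e ^ 2]) =
    ∫ p : ℝ × ℝ, f (a * p.1 + b * p.2) * g (c * p.1 + e * p.2)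
      ∂((gaussianReal 0 1).prod (gaussianReal 0 1)) := by
  rw [multivariateGaussian_two_eq_map, integral_map]
  · simp
  · refine ((WithLp.measurable_toLp 2 _).comp ?_).aemeasurable
    refine measurable_pi_iff.2 fun i => ?_
    fin_cases i <;> simp <;> fun_prop
  · exact ((hf.comp (by fun_prop)).mul (hg.comp (by fun_prop))).aestronglyMeasurable

/-- Both sides are written over the same pair of independent standard Gaussians, with second
coordinate `t * p.1 + √(1 - t ^ 2) * p.2`; the scale `√α` moves from the vector into the function.
-/
lemma gaussExp_scale {f : ℝ → ℝ} (hf : Measurable f) {α t : ℝ} (hα : 0 ≤ α)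
    (ht : t ∈ Set.Icc (-1 : ℝ) 1) :
    gaussExp f !![α, α * t; α * t, α] = dualAct (fun x => f (√α * x)) t := by
  have h0 : 0 ≤ 1 - t ^ 2 := by nlinarith [ht.1, ht.2]
  have h1 := integral_bivariateGaussian hf hf (√α) 0 (√α * t) (√α * √(1 - t ^ 2))
  have h2 := integral_bivariateGaussian (f := fun x => f (√α * x)) (g := fun x => f (√α * x))
    (hf.comp (by fun_prop)) (hf.comp (by fun_prop)) 1 0 t (√(1 - t ^ 2))
  have e1 : (√α) ^ 2 = α := Real.sq_sqrt hα
  have e2 : (√(1 - t ^ 2)) ^ 2 = 1 - t ^ 2 := Real.sq_sqrt h0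
  have e3 : √α * (√α * t) = α * t := by rw [← mul_assoc, ← sq, e1]
  have e4 : (√α * t) ^ 2 + (√α * √(1 - t ^ 2)) ^ 2 = α := by
    rw [mul_pow, mul_pow, e1, e2]; ring
  have e5 : t ^ 2 + (√(1 - t ^ 2)) ^ 2 = 1 := by rw [e2]; ring
  rw [e4, e1, e3] at h1
  rw [e5] at h2
  simp only [one_pow, one_mul, zero_mul, add_zero, ne_eq, OfNat.ofNat_ne_zero,
    not_false_eq_true, zero_pow] at h1 h2
  rw [gaussExp, dualAct, gaussExp, h1, h2]
  congr 1
  ext p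
  ring_nf

lemma integrable_prod_of_polyBdd {F : ℝ × ℝ → ℝ} (hm : Measurable F) {C : ℝ} {N M : ℕ}
    (h : ∀ p, |F p| ≤ C * ((1 + |p.1|) ^ N * (1 + |p.2|) ^ M)) :
    Integrable F ((gaussianReal 0 1).prod (gaussianReal 0 1)) := by
  refine (((integrable_one_add_abs_pow N).mul_prod (integrable_one_add_abs_pow M)).const_mul
    C).mono hm.aestronglyMeasurable (ae_of_all _ fun p => ?_)
  exact (h p).trans (le_abs_self _)

/-- The bound separates the variables, which is the form in which integrability for the product
measure is checked. -/
lemma abs_comp_affine_le {f : ℝ → ℝ} {C : ℝ} {N : ℕ} (hC : 0 ≤ C)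
    (h : ∀ x, |f x| ≤ C * (1 + |x|) ^ N) {t s : ℝ} (ht : |t| ≤ 1) (hs : |s| ≤ 1) (x y : ℝ) :
    |f (t * x + s * y)| ≤ C * ((1 + |x|) ^ N * (1 + |y|) ^ N) := by
  refine (h _).trans ?_
  rw [← mul_pow]
  have h1 : |t * x + s * y| ≤ |x| + |y| := by
    refine (abs_add_le _ _).trans ?_
    rw [abs_mul, abs_mul]
    have := abs_nonneg x
    have := abs_nonneg y
    nlinarith
  have := mul_nonneg (abs_nonneg x) (abs_nonneg y)
  gcongr
  nlinarith

/-- **Mehler's formula**: the power series of the dual activation function. -/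
theorem hasPowerSeriesOnUnit_dualAct {f : ℝ → ℝ} (hf : PolyBdd f) (hm : Measurable f) :
    HasPowerSeriesOnUnit (dualAct f) fun n => hermiteCoeff f n ^ 2 := by
  intro t ht
  have h0 : 0 ≤ 1 - t ^ 2 := by nlinarith [ht.1, ht.2]
  obtain ⟨s, hs0, hs⟩ : ∃ s : ℝ, 0 ≤ s ∧ t ^ 2 + s ^ 2 = 1 :=
    ⟨√(1 - t ^ 2), Real.sqrt_nonneg _, by rw [Real.sq_sqrt h0]; ring⟩
  have ht1 : |t| ≤ 1 := abs_le.2 ht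
  have hs1 : |s| ≤ 1 := by rw [abs_of_nonneg hs0]; nlinarith [sq_nonneg t]
  -- `P` is the Ornstein–Uhlenbeck average of `f`. The dual activation at `t` is the `L²` pairing of
  -- `f` with `P`, so Parseval reduces the claim to the Hermite coefficients of `P`.
  set P : ℝ → ℝ := fun x => ∫ y, f (t * x + s * y) ∂(gaussianReal 0 1) with hP
  obtain ⟨C, N, hC, hb⟩ := hf.exists_nonneg
  have hPm : Measurable P := by
    have : StronglyMeasurable (Function.uncurry fun x y : ℝ => f (t * x + s * y)) :=
      (hm.comp (by fun_prop)).stronglyMeasurable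
    exact this.integral_prod_right.measurable
  have hPb : PolyBdd P := by
    refine ⟨C * ∫ y, (1 + |y|) ^ N ∂(gaussianReal 0 1), N, fun x => ?_⟩
    have hle := norm_integral_le_of_norm_le (μ := gaussianReal 0 1)
      (f := fun y => f (t * x + s * y))
      ((integrable_one_add_abs_pow N).const_mul (C * (1 + |x|) ^ N))
      (ae_of_all _ fun y => by
        have := abs_comp_affine_le hC hb ht1 hs1 x y
        rwa [← mul_assoc] at this)
    rw [integral_const_mul] at hle
    calc |P x| ≤ _ := hle
      _ = _ := by ring
  have hint : ∀ g : ℝ → ℝ, PolyBdd g → Measurable g →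
      ∫ p : ℝ × ℝ, g p.1 * f (t * p.1 + s * p.2) ∂((gaussianReal 0 1).prod (gaussianReal 0 1)) =
        ∫ x, g x * P x ∂(gaussianReal 0 1) := by
    intro g hg hgm
    obtain ⟨D, M, hD, hb'⟩ := hg.exists_nonneg
    rw [integral_prod]
    · simp_rw [integral_const_mul]
      rfl
    · refine integrable_prod_of_polyBdd (C := D * C) (N := M + N) (M := N)
        ((hgm.comp measurable_fst).mul (hm.comp (by fun_prop))) fun p => ?_
      rw [abs_mul]
      calc _ ≤ (D * (1 + |p.1|) ^ M) * (C * ((1 + |p.1|) ^ N * (1 + |p.2|) ^ N)) := by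
            gcongr
            · exact hb' _
            · exact abs_comp_affine_le hC hb ht1 hs1 _ _
        _ = _ := by ring
  have hlaw : ∀ g : ℝ → ℝ, Measurable g →
      ∫ z, g (z 0) * f (z 1) ∂(multivariateGaussian (0 : EuclideanSpace ℝ (Fin 2))
        !![1, t; t, 1]) = ∫ p : ℝ × ℝ, g p.1 * f (t * p.1 + s * p.2)
          ∂((gaussianReal 0 1).prod (gaussianReal 0 1)) := by
    intro g hg
    have := integral_bivariateGaussian hg hm 1 0 t s
    simpa [hs] using this
  -- The same Gaussian law with the coordinates in exchanged roles: integrating out the second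
  -- variable now averages `g` instead of `f`. This is the self-adjointness of the averaging, and
  -- for Hermite polynomials it produces the factor `t ^ n`.
  have hlaw' : ∀ g : ℝ → ℝ, Measurable g →
      ∫ z, g (z 0) * f (z 1) ∂(multivariateGaussian (0 : EuclideanSpace ℝ (Fin 2))
        !![1, t; t, 1]) = ∫ p : ℝ × ℝ, f p.1 * g (t * p.1 + s * p.2)
          ∂((gaussianReal 0 1).prod (gaussianReal 0 1)) := by
    intro g hg
    have := integral_bivariateGaussian hg hm t s 1 0
    simpa [hs, mul_comm (f _)] using this
  have hcoef : ∀ n, hermiteCoeff P n = t ^ n * hermiteCoeff f n := by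
    intro n
    have hn : Measurable (hermiteFun n) := measurable_hermiteFun n
    rw [hermiteCoeff_eq_div, hermiteCoeff_eq_div, ← mul_div_assoc]
    congr 1
    simp_rw [mul_comm (P _)]
    rw [← hint _ (polyBdd_hermiteFun n) hn, ← hlaw _ hn, hlaw' _ hn, integral_prod]
    · simp_rw [integral_const_mul, integral_hermiteFun_ornsteinUhlenbeck n hs]
      rw [← integral_const_mul]
      congr 1
      ext x
      ring
    · obtain ⟨D, M, hD, hb'⟩ := (polyBdd_hermiteFun n).exists_nonneg
      refine integrable_prod_of_polyBdd (C := C * D) (N := N + M) (M := M)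
        ((hm.comp measurable_fst).mul (hn.comp (by fun_prop))) fun p => ?_
      rw [abs_mul]
      calc _ ≤ (C * (1 + |p.1|) ^ N) * (D * ((1 + |p.1|) ^ M * (1 + |p.2|) ^ M)) := by
            gcongr
            · exact hb _
            · exact abs_comp_affine_le hD hb' ht1 hs1 _ _
        _ = _ := by ring
  have hfin := hasSum_hermiteCoeff_mul (hf.memLp hm) (hPb.memLp hPm)
  rw [← hint f hf hm, ← hlaw f hm] at hfin
  simp_rw [hcoef] at hfin
  rw [dualAct, gaussExp]
  convert hfin using 2
  ring

/-! ### Degrees of sets of natural numbers -/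

/-- The supremum of a set of natural numbers in `ℕ ∪ {-∞, ∞}`. -/
def setDeg (T : Set ℕ) : EReal := ⨆ n ∈ T, ((n : ℕ) : EReal)

/-- The elements of a set of natural numbers with a given residue modulo `2`. -/
def parityPart (T : Set ℕ) (r : ℕ) : Set ℕ := {n | n ∈ T ∧ n % 2 = r}

lemma mem_parityPart {T : Set ℕ} {r n : ℕ} : n ∈ parityPart T r ↔ n ∈ T ∧ n % 2 = r := Iff.rfl

lemma seqDegEven_eq (a : ℕ → ℝ) : seqDegEven a = setDeg (parityPart {n | a n ≠ 0} 0) := by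
  have h : ∀ n, a n + (-1) ^ n * a n ≠ 0 ↔ n ∈ parityPart {n | a n ≠ 0} 0 := by
    intro n
    rw [mem_parityPart, Set.mem_ofPred_eq]
    rcases Nat.even_or_odd n with hn | hn
    · simp [hn.neg_one_pow, Nat.even_iff.1 hn, ← two_mul]
    · simp [hn.neg_one_pow, Nat.odd_iff.1 hn]
  simp only [seqDegEven, seqDegree, setDeg, h]

lemma seqDegOdd_eq (a : ℕ → ℝ) : seqDegOdd a = setDeg (parityPart {n | a n ≠ 0} 1) := by
  have h : ∀ n, a n - (-1) ^ n * a n ≠ 0 ↔ n ∈ parityPart {n | a n ≠ 0} 1 := by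
    intro n
    rw [mem_parityPart, Set.mem_ofPred_eq]
    rcases Nat.even_or_odd n with hn | hn
    · simp [hn.neg_one_pow, Nat.even_iff.1 hn]
    · simp [hn.neg_one_pow, Nat.odd_iff.1 hn, ← two_mul]
  simp only [seqDegOdd, seqDegree, setDeg, h]

lemma setDeg_empty : setDeg ∅ = ⊥ := by simp [setDeg]

lemma natCast_le_setDeg {T : Set ℕ} {n : ℕ} :
    ((n : ℕ) : EReal) ≤ setDeg T ↔ ∃ m ∈ T, n ≤ m := by
  constructor
  · intro h
    by_contra! hc
    -- For `n = 0` the inequality still asserts that `T` is nonempty, since the supremum of the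
    -- empty set is `⊥`.
    rcases Nat.eq_zero_or_pos n with rfl | hn
    · have : T = ∅ := Set.eq_empty_of_forall_notMem fun m hm => by simpa using hc m hm
      rw [this, setDeg_empty] at h
      exact absurd h (by simp)
    · have h1 : setDeg T ≤ ((n - 1 : ℕ) : EReal) := by
        refine iSup₂_le fun m hm => ?_
        have := hc m hm
        exact_mod_cast (by omega : m ≤ n - 1)
      have h2 := h.trans h1
      norm_cast at h2
      omega
  · rintro ⟨m, hm, hnm⟩
    refine le_trans ?_ (le_iSup₂ (f := fun (m : ℕ) (_ : m ∈ T) => ((m : ℕ) : EReal)) m hm)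
    exact_mod_cast hnm

lemma setDeg_le_natCast {T : Set ℕ} {n : ℕ} : setDeg T ≤ ((n : ℕ) : EReal) ↔ ∀ m ∈ T, m ≤ n := by
  simp [setDeg, iSup_le_iff]

lemma setDeg_eq_bot_iff {T : Set ℕ} : setDeg T = ⊥ ↔ T = ∅ := by
  simp only [setDeg, iSup_eq_bot, Set.eq_empty_iff_forall_notMem]
  exact forall_congr' fun n => ⟨fun h hn => EReal.natCast_ne_bot n (h hn), fun h hn => absurd hn h⟩

lemma setDeg_eq_natCast_iff {T : Set ℕ} {n : ℕ} :
    setDeg T = ((n : ℕ) : EReal) ↔ IsGreatest T n := by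
  constructor
  · intro h
    obtain ⟨m, hm, hnm⟩ := natCast_le_setDeg.1 h.ge
    have hle := setDeg_le_natCast.1 h.le
    have : m = n := le_antisymm (hle m hm) hnm
    exact ⟨this ▸ hm, hle⟩
  · rintro ⟨h1, h2⟩
    exact le_antisymm (setDeg_le_natCast.2 h2) (natCast_le_setDeg.2 ⟨n, h1, le_rfl⟩)

lemma setDeg_eq_top_iff {T : Set ℕ} : setDeg T = ⊤ ↔ ∀ n, ∃ m ∈ T, n ≤ m := by
  constructor
  · intro h n
    exact natCast_le_setDeg.1 (h ▸ le_top)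
  · intro h
    rw [EReal.eq_top_iff_forall_lt]
    intro y
    obtain ⟨n, hn⟩ := exists_nat_gt y
    obtain ⟨m, hm, hnm⟩ := h n
    refine lt_of_lt_of_le ?_ (natCast_le_setDeg.2 ⟨m, hm, hnm⟩)
    exact_mod_cast hn

lemma setDeg_trichotomy (T : Set ℕ) : setDeg T = ⊥ ∨ (∃ n : ℕ, setDeg T = n) ∨ setDeg T = ⊤ := by
  by_cases h : ∀ n, ∃ m ∈ T, n ≤ m
  · exact Or.inr (Or.inr (setDeg_eq_top_iff.2 h))
  · push Not at h
    obtain ⟨N, hN⟩ := h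
    rcases T.eq_empty_or_nonempty with rfl | hne
    · exact Or.inl setDeg_empty
    · have hb : BddAbove T := ⟨N, fun m hm => (hN m hm).le⟩
      exact Or.inr (Or.inl ⟨sSup T, setDeg_eq_natCast_iff.2
        ⟨Nat.sSup_mem hne hb, fun m hm => le_csSup hb hm⟩⟩)

/-- Strict bounds detect the whole value of the degree: `N = 0` expresses emptiness and so
distinguishes `⊥` from 0. -/
lemma setDeg_le_setDeg {T U : Set ℕ} (h : ∀ N, (∀ n ∈ U, n < N) → ∀ n ∈ T, n < N) :
    setDeg T ≤ setDeg U := by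
  rcases setDeg_trichotomy U with hU | ⟨k, hU⟩ | hU
  · rw [setDeg_eq_bot_iff] at hU
    have : T = ∅ := Set.eq_empty_of_forall_notMem fun n hn => by
      have := h 0 (by simp [hU]) n hn
      omega
    rw [this, setDeg_empty]
    exact bot_le
  · rw [hU, setDeg_le_natCast]
    have := setDeg_le_natCast.1 hU.le
    intro m hm
    have := h (k + 1) (fun n hn => Nat.lt_succ_of_le (this n hn)) m hm
    omega
  · rw [hU]; exact le_top

/-! ### Scale invariance of the Hermite degrees -/

lemma integral_comp_neg_gaussianReal (F : ℝ → ℝ) :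
    ∫ x, F (-x) ∂(gaussianReal 0 1) = ∫ x, F x ∂(gaussianReal 0 1) := by
  have h : MeasurePreserving (fun x : ℝ => -x) (gaussianReal 0 1) (gaussianReal 0 1) :=
    ⟨measurable_neg, by rw [gaussianReal_map_neg, neg_zero]⟩
  exact h.integral_comp (Homeomorph.neg ℝ).measurableEmbedding F

lemma PolyBdd.comp_neg {f : ℝ → ℝ} (hf : PolyBdd f) : PolyBdd fun x => f (-x) := by
  simpa using hf.comp_mul (-1)

/-- Reflection invariance of the Gaussian and the parity of the Hermite polynomials. The factor is 2
if `n` and `r` have the same parity and 0 otherwise, so symmetrizing selects the coefficients of one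
parity. -/
lemma integral_symm_mul_hermiteFun {f : ℝ → ℝ} (hf : PolyBdd f) (hm : Measurable f) (r n : ℕ) :
    ∫ x, (f x + (-1) ^ r * f (-x)) * hermiteFun n x ∂(gaussianReal 0 1) =
      (1 + (-1) ^ r * (-1) ^ n) * ∫ x, f x * hermiteFun n x ∂(gaussianReal 0 1) := by
  have hb := polyBdd_hermiteFun n
  have hbm := measurable_hermiteFun n
  have i1 := (hf.mul hb).integrable (hm.mul hbm)
  have i2 := (hf.comp_neg.mul hb).integrable ((hm.comp measurable_neg).mul hbm)
  have e : ∀ x, (f x + (-1) ^ r * f (-x)) * hermiteFun n x =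
      f x * hermiteFun n x + (-1) ^ r * (f (-x) * hermiteFun n x) := fun x => by ring
  have e2 : ∫ x, f (-x) * hermiteFun n x ∂(gaussianReal 0 1) =
      (-1) ^ n * ∫ x, f x * hermiteFun n x ∂(gaussianReal 0 1) := by
    rw [← integral_comp_neg_gaussianReal, ← integral_const_mul]
    simp only [neg_neg, hermiteFun_neg]
    congr 1
    ext x
    ring
  simp_rw [e]
  rw [integral_add i1 (i2.const_mul _), integral_const_mul, e2]
  ring

lemma hermiteCoeff_eq_zero_iff (f : ℝ → ℝ) (n : ℕ) :
    hermiteCoeff f n = 0 ↔ ∫ x, f x * hermiteFun n x ∂(gaussianReal 0 1) = 0 := by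
  rw [hermiteCoeff_eq_div, div_eq_zero_iff]
  have : √(n.factorial : ℝ) ≠ 0 := by positivity
  simp [this]

lemma ae_gaussianReal_iff {p : ℝ → Prop} :
    (∀ᵐ x ∂(gaussianReal 0 1), p x) ↔ ∀ᵐ x ∂(volume : Measure ℝ), p x :=
  ⟨fun h => (gaussianReal_absolutelyContinuous' 0 one_ne_zero).ae_le h,
    fun h => (gaussianReal_absolutelyContinuous 0 one_ne_zero).ae_le h⟩

/-- The Hermite coefficients of parity `r` vanish from `N` on if and only if the part of parity `r`
of the function is almost everywhere a polynomial of degree less than `N`. -/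
lemma hermiteCoeff_vanish_iff {f : ℝ → ℝ} (hf : PolyBdd f) (hm : Measurable f) {r : ℕ} (hr : r < 2)
    (N : ℕ) :
    (∀ n, N ≤ n → n % 2 = r → hermiteCoeff f n = 0) ↔
      ∃ p : ℝ[X], p.degree < N ∧
        ∀ᵐ x ∂(volume : Measure ℝ), f x + (-1) ^ r * f (-x) = p.eval x := by
  have hgb : PolyBdd fun x => f x + (-1) ^ r * f (-x) :=
    hf.add ((PolyBdd.const _).mul hf.comp_neg)
  have hgm : Measurable fun x => f x + (-1) ^ r * f (-x) :=
    hm.add ((hm.comp measurable_neg).const_mul _)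
  have hpar : ∀ n, n % 2 ≠ r → (1 + (-1) ^ r * (-1) ^ n : ℝ) = 0 := by
    intro n hn
    rw [← pow_add, Odd.neg_one_pow (by rw [Nat.odd_iff]; omega)]
    ring
  have hpar' : ∀ n, n % 2 = r → (1 + (-1) ^ r * (-1) ^ n : ℝ) = 2 := by
    intro n hn
    rw [← pow_add, Even.neg_one_pow (by rw [Nat.even_iff]; omega)]
    ring
  constructor
  · intro h
    set I : ℕ → ℝ := fun n => ∫ x, (f x + (-1) ^ r * f (-x)) * hermiteFun n x ∂(gaussianReal 0 1)
      with hI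
    -- The truncated Hermite expansion of the symmetric part; the factorials normalize the monic
    -- Hermite polynomials. Completeness shows that the remainder vanishes almost everywhere.
    set q : ℝ[X] := ∑ n ∈ Finset.range N,
      C (I n / n.factorial) * (Polynomial.hermite n).map (Int.castRingHom ℝ) with hq
    have hqe : ∀ x, q.eval x = ∑ n ∈ Finset.range N, I n / n.factorial * hermiteFun n x := by
      intro x
      simp [hq, eval_finsetSum, hermiteFun_eq_eval]
    refine ⟨q, ?_, ?_⟩
    · refine lt_of_le_of_lt (degree_sum_le _ _) ?_
      rw [Finset.sup_lt_iff (by exact_mod_cast WithBot.bot_lt_coe N)]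
      intro n hn
      rw [← smul_eq_C_mul]
      refine lt_of_le_of_lt (degree_smul_le _ _) ?_
      rw [(hermite_monic n).degree_map, degree_hermite]
      exact_mod_cast Finset.mem_range.1 hn
    · have hqb := PolyBdd.polynomial q
      have hqm : Measurable fun x => q.eval x := q.continuous.measurable
      have key := ae_eq_zero_of_integral_mul_hermiteFun ((hgb.sub hqb).memLp (hgm.sub hqm)) ?_
      · rw [← ae_gaussianReal_iff]
        filter_upwards [key] with x hx
        exact sub_eq_zero.1 hx
      · intro n
        have hb := polyBdd_hermiteFun n
        have hbm := measurable_hermiteFun n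
        have e1 : ∫ x, q.eval x * hermiteFun n x ∂(gaussianReal 0 1) =
            if n < N then I n else 0 := by
          simp_rw [hqe, Finset.sum_mul, mul_assoc]
          rw [integral_finsetSum]
          · simp_rw [integral_const_mul, integral_hermiteFun_mul_hermiteFun]
            simp only [mul_ite, mul_zero, Finset.sum_ite_eq', Finset.mem_range]
            split_ifs
            · field_simp
            · rfl
          · intro k _
            exact (((polyBdd_hermiteFun k).mul hb).integrable
              ((measurable_hermiteFun k).mul hbm)).const_mul _
        simp_rw [sub_mul]
        rw [integral_sub ((hgb.mul hb).integrable (hgm.mul hbm))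
          ((hqb.mul hb).integrable (hqm.mul hbm)), e1]
        split_ifs with hn
        · exact sub_self _
        · rw [sub_zero, integral_symm_mul_hermiteFun hf hm]
          by_cases hnr : n % 2 = r
          · rw [(hermiteCoeff_eq_zero_iff f n).1 (h n (not_lt.1 hn) hnr), mul_zero]
          · rw [hpar n hnr, zero_mul]
  · rintro ⟨p, hp, hae⟩ n hn hnr
    have h1 := integral_symm_mul_hermiteFun hf hm r n
    rw [hpar' n hnr] at h1
    have h2 : ∫ x, (f x + (-1) ^ r * f (-x)) * hermiteFun n x ∂(gaussianReal 0 1) =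
        ∫ x, p.eval x * hermiteFun n x ∂(gaussianReal 0 1) := by
      refine integral_congr_ae ?_
      filter_upwards [ae_gaussianReal_iff.2 hae] with x hx
      rw [hx]
    rw [integral_polynomial_mul_hermiteFun_of_degree_lt n p
      (hp.trans_le (by exact_mod_cast hn))] at h2
    rw [hermiteCoeff_eq_zero_iff]
    linarith

/-- The support of the sequence of Hermite coefficients. -/
def hermiteSupport (f : ℝ → ℝ) : Set ℕ := {n | hermiteCoeff f n ≠ 0}

lemma hermiteDegEven_eq (f : ℝ → ℝ) :
    hermiteDegEven f = setDeg (parityPart (hermiteSupport f) 0) := seqDegEven_eq _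

lemma hermiteDegOdd_eq (f : ℝ → ℝ) :
    hermiteDegOdd f = setDeg (parityPart (hermiteSupport f) 1) := seqDegOdd_eq _

lemma forall_mem_parityPart_hermiteSupport_lt (f : ℝ → ℝ) (r N : ℕ) :
    (∀ n ∈ parityPart (hermiteSupport f) r, n < N) ↔
      ∀ n, N ≤ n → n % 2 = r → hermiteCoeff f n = 0 := by
  refine forall_congr' fun n => ?_
  simp only [mem_parityPart, hermiteSupport, Set.mem_ofPred_eq]
  constructor
  · intro h hN hr
    by_contra h0
    exact absurd (h ⟨h0, hr⟩) (by omega)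
  · rintro h ⟨h0, hr⟩
    by_contra hN
    exact h0 (h (by omega) hr)

/-- Agreeing almost everywhere with a polynomial of degree below `N` survives a dilation, whereas
the vanishing of an individual Hermite coefficient need not. The reverse inequality comes from the
inverse dilation. -/
lemma setDeg_hermiteSupport_comp_mul_le {f : ℝ → ℝ} (hf : PolyBdd f) (hm : Measurable f) {r : ℕ}
    (hr : r < 2) {c : ℝ} (hc : c ≠ 0) :
    setDeg (parityPart (hermiteSupport fun x => f (c * x)) r) ≤
      setDeg (parityPart (hermiteSupport f) r) := by
  refine setDeg_le_setDeg fun N hN => ?_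
  rw [forall_mem_parityPart_hermiteSupport_lt, hermiteCoeff_vanish_iff hf hm hr] at hN
  rw [forall_mem_parityPart_hermiteSupport_lt,
    hermiteCoeff_vanish_iff (hf.comp_mul c) (hm.comp (measurable_const_mul c)) hr]
  obtain ⟨p, hp, hae⟩ := hN
  refine ⟨p.comp (C c * X), ?_, ?_⟩
  · rw [degree_lt_iff_coeff_zero] at hp ⊢
    intro m hm
    rw [comp_C_mul_X_coeff, hp m hm, zero_mul]
  · have hq : Measure.QuasiMeasurePreserving (fun x : ℝ => c * x) volume volume := by
      refine ⟨measurable_const_mul c, ?_⟩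
      rw [Real.map_volume_mul_left hc]
      exact Measure.smul_absolutelyContinuous
    filter_upwards [hq.ae hae] with x hx
    simpa using hx

lemma setDeg_hermiteSupport_comp_mul {f : ℝ → ℝ} (hf : PolyBdd f) (hm : Measurable f) {r : ℕ}
    (hr : r < 2) {c : ℝ} (hc : c ≠ 0) :
    setDeg (parityPart (hermiteSupport fun x => f (c * x)) r) =
      setDeg (parityPart (hermiteSupport f) r) := by
  refine le_antisymm (setDeg_hermiteSupport_comp_mul_le hf hm hr hc) ?_
  have := setDeg_hermiteSupport_comp_mul_le (hf.comp_mul c) (hm.comp (measurable_const_mul c)) hr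
    (inv_ne_zero hc)
  simpa [← mul_assoc, hc] using this

/-! ### Activation functions -/

lemma polyBdd_of_rpow_bound {f : ℝ → ℝ} {a b q c d p : ℝ} (ha : 0 < a) (hb : 0 < b) (hq : 0 < q)
    (hc : 0 < c) (hd : 0 < d) (hp : 0 < p) (h1 : ∀ x, 0 < x → |f x| ≤ a * |x| ^ q + b)
    (h2 : ∀ x, x < 0 → |f x| ≤ c * |x| ^ p + d) : PolyBdd f := by
  have key : ∀ (a b q : ℝ), 0 < a → 0 < b → 0 < q →
      PolyBdd fun x => a * |x| ^ q + b := by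
    intro a b q ha hb hq
    have hpow : PolyBdd fun x : ℝ => |x| ^ q := by
      refine ⟨1, ⌈q⌉₊, fun x => ?_⟩
      rw [abs_of_nonneg (by positivity), one_mul, ← Real.rpow_natCast]
      calc |x| ^ q ≤ (1 + |x|) ^ q := Real.rpow_le_rpow (abs_nonneg x) (by linarith) hq.le
        _ ≤ (1 + |x|) ^ (⌈q⌉₊ : ℝ) :=
          Real.rpow_le_rpow_of_exponent_le (by simp) (Nat.le_ceil q)
    exact ((PolyBdd.const a).mul hpow).add (PolyBdd.const b)
  obtain ⟨C, N, h⟩ := ((key a b q ha hb hq).add (key c d p hc hd hp)).add (PolyBdd.const |f 0|)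
  refine ⟨C, N, fun x => le_trans ?_ (h x)⟩
  have e1 : 0 ≤ a * |x| ^ q := by positivity
  have e2 : 0 ≤ c * |x| ^ p := by positivity
  have e3 := abs_nonneg (f 0)
  refine le_trans ?_ (le_abs_self _)
  change |f x| ≤ a * |x| ^ q + b + (c * |x| ^ p + d) + |f 0|
  rcases lt_trichotomy x 0 with hx | hx | hx
  · linarith [h2 x hx]
  · subst hx; linarith
  · linarith [h1 x hx]

namespace IsActivation

variable {φ : ℝ → ℝ}

lemma polyBdd (hφ : IsActivation φ) : PolyBdd φ := by
  obtain ⟨a, b, q, ha, hb, hq, h1⟩ := hφ.right.2 0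
  obtain ⟨c, d, p, hc, hd, hp, h2⟩ := hφ.left.2 0
  simp only [iteratedDerivWithin_zero] at h1 h2
  exact polyBdd_of_rpow_bound ha hb hq hc hd hp h1 h2

lemma measurable (hφ : IsActivation φ) : Measurable φ := by
  refine measurable_of_continuousOn_compl_singleton 0 fun x hx => ?_
  rcases lt_or_gt_of_ne (show x ≠ 0 from hx) with h | h
  · exact (hφ.left.1.continuousOn.continuousAt (Iio_mem_nhds h)).continuousWithinAt
  · exact (hφ.right.1.continuousOn.continuousAt (Ioi_mem_nhds h)).continuousWithinAt

lemma polyBdd_deriv (hφ : IsActivation φ) : PolyBdd (deriv φ) := by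
  obtain ⟨a, b, q, ha, hb, hq, h1⟩ := hφ.right.2 1
  obtain ⟨c, d, p, hc, hd, hp, h2⟩ := hφ.left.2 1
  rw [iteratedDerivWithin_one] at h1 h2
  refine polyBdd_of_rpow_bound ha hb hq hc hd hp (fun x hx => ?_) (fun x hx => ?_)
  · rw [← derivWithin_of_isOpen isOpen_Ioi hx]
    exact h1 x hx
  · rw [← derivWithin_of_isOpen isOpen_Iio hx]
    exact h2 x hx

lemma hasDerivAt (hφ : IsActivation φ) {x : ℝ} (hx : x ≠ 0) : HasDerivAt φ (deriv φ x) x := by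
  rcases lt_or_gt_of_ne hx with h | h
  · exact ((hφ.left.1.contDiffAt (Iio_mem_nhds h)).differentiableAt (by simp)).hasDerivAt
  · exact ((hφ.right.1.contDiffAt (Ioi_mem_nhds h)).differentiableAt (by simp)).hasDerivAt

/-- Otherwise completeness gives `φ = 0` almost everywhere, continuity on the half-lines gives it
off 0, and the mean-value condition at 0 settles the last point. -/
lemma hermiteSupport_nonempty (hφ : IsActivation φ) : (hermiteSupport φ).Nonempty := by
  by_contra hne
  have hz : ∀ n, ∫ x, φ x * hermiteFun n x ∂(gaussianReal 0 1) = 0 := by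
    intro n
    rw [← hermiteCoeff_eq_zero_iff]
    by_contra h
    exact hne ⟨n, h⟩
  have hae : φ =ᵐ[volume] 0 := ae_gaussianReal_iff.1
    (ae_eq_zero_of_integral_mul_hermiteFun (hφ.polyBdd.memLp hφ.measurable) hz)
  have hr : Set.EqOn φ 0 (Set.Ioi 0) := Measure.eqOn_open_of_ae_eq (ae_restrict_of_ae hae)
    isOpen_Ioi hφ.right.1.continuousOn continuousOn_const
  have hl : Set.EqOn φ 0 (Set.Iio 0) := Measure.eqOn_open_of_ae_eq (ae_restrict_of_ae hae)
    isOpen_Iio hφ.left.1.continuousOn continuousOn_const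
  obtain ⟨lp, lm, h1, h2, h3⟩ := hφ.at_zero
  have e1 : lp = 0 := tendsto_nhds_unique h1
    (tendsto_const_nhds.congr' (eventually_nhdsWithin_of_forall fun x hx => (hr hx).symm))
  have e2 : lm = 0 := tendsto_nhds_unique h2
    (tendsto_const_nhds.congr' (eventually_nhdsWithin_of_forall fun x hx => (hl hx).symm))
  apply hφ.ne_zero
  ext x
  rcases lt_trichotomy x 0 with h | h | h
  · exact hl h
  · rw [h, h3, e1, e2]; simp
  · exact hr h

lemma setDeg_hermiteSupport (hφ : IsActivation φ) {r : ℕ} (hr : r < 2) {c : ℝ} (hc : 0 < c) :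
    setDeg (parityPart (hermiteSupport fun x => φ (c * x)) r) =
      setDeg (parityPart (hermiteSupport φ) r) :=
  setDeg_hermiteSupport_comp_mul hφ.polyBdd hφ.measurable hr hc.ne'

/-- The support itself may change with `c`, so nonemptiness is transferred through the degree of the
parity of a known element. -/
lemma hermiteSupport_comp_mul_nonempty (hφ : IsActivation φ) {c : ℝ} (hc : 0 < c) :
    (hermiteSupport fun x => φ (c * x)).Nonempty := by
  obtain ⟨n, hn⟩ := hφ.hermiteSupport_nonempty
  have h1 := hφ.setDeg_hermiteSupport (r := n % 2) (Nat.mod_lt _ two_pos) hc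
  have h2 : ((n : ℕ) : EReal) ≤ setDeg (parityPart (hermiteSupport φ) (n % 2)) :=
    natCast_le_setDeg.2 ⟨n, ⟨hn, rfl⟩, le_rfl⟩
  rw [← h1, natCast_le_setDeg] at h2
  obtain ⟨m, hm, -⟩ := h2
  exact ⟨m, hm.1⟩

/-- Differentiation shifts the Hermite support by one. -/
lemma mem_hermiteSupport_deriv (hφ : IsActivation φ) (hcont : Continuous φ) {c : ℝ} (hc : 0 < c)
    (n : ℕ) : n ∈ hermiteSupport (fun x => deriv φ (c * x)) ↔
      n + 1 ∈ hermiteSupport (fun x => φ (c * x)) := by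
  have h := integral_deriv_mul_hermiteFun (f := fun x => φ (c * x))
    (f' := fun x => c * deriv φ (c * x)) (hcont.comp (continuous_const_mul c))
    (fun x hx => ?_) (hφ.polyBdd.comp_mul c)
    ((PolyBdd.const c).mul (hφ.polyBdd_deriv.comp_mul c))
    (((measurable_deriv φ).comp (measurable_const_mul c)).const_mul c) n
  · simp only [mul_assoc] at h
    rw [integral_const_mul] at h
    simp only [hermiteSupport, Set.mem_ofPred_eq, ne_eq, hermiteCoeff_eq_zero_iff]
    rw [← h, mul_eq_zero, not_or]
    simp [hc.ne']
  · have h1 : HasDerivAt (fun x : ℝ => c * x) c x := by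
      simpa using (hasDerivAt_id x).const_mul c
    exact ((hφ.hasDerivAt (mul_ne_zero hc.ne' hx)).comp x h1).congr_deriv (mul_comm _ _)

end IsActivation

/-- The largest element of the Hermite support of a polynomial is its degree. -/
lemma isGreatest_hermiteSupport_polynomial {f : ℝ → ℝ} {p : ℝ[X]} (h : ∀ x, f x = p.eval x)
    (hp : p ≠ 0) : IsGreatest (hermiteSupport f) p.natDegree := by
  constructor
  · rw [hermiteSupport, Set.mem_ofPred_eq, ne_eq, hermiteCoeff_eq_zero_iff]
    simp_rw [h]
    rw [integral_polynomial_mul_hermiteFun_natDegree _ p rfl]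
    have := leadingCoeff_ne_zero.2 hp
    positivity
  · intro n hn
    by_contra hlt
    refine hn ((hermiteCoeff_eq_zero_iff f n).2 ?_)
    simp_rw [h]
    refine integral_polynomial_mul_hermiteFun_of_degree_lt n p ?_
    rw [degree_eq_natDegree hp]
    exact_mod_cast not_le.1 hlt

/-! ### Sumsets -/

/-- The `n`-fold sumset of `T`. -/
def iterSum (T : Set ℕ) : ℕ → Set ℕ
  | 0 => {0}
  | n + 1 => {k | ∃ i ∈ iterSum T n, ∃ j ∈ T, k = i + j}

/-- The union of the `n`-fold sumsets of `T` over all `n ∈ S`: the support of a composition of power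
series with nonnegative coefficients. -/
def compSet (S T : Set ℕ) : Set ℕ := {k | ∃ n ∈ S, k ∈ iterSum T n}

/-- The sumset of `T` and `U`. -/
def addSet (T U : Set ℕ) : Set ℕ := {k | ∃ i ∈ T, ∃ j ∈ U, k = i + j}

/-- The support of the constant power series with a coefficient that is nonzero if `s` holds. -/
def zeroSet (s : Prop) : Set ℕ := {n | n = 0 ∧ s}

/-! ### Power series with nonnegative coefficients -/

/-- On `[-1, 1]`, `F` is the sum of a power series with nonnegative coefficients and support `T`. -/
def HasNonnegSeries (F : ℝ → ℝ) (T : Set ℕ) : Prop :=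
  ∃ a : ℕ → ℝ, (∀ n, 0 ≤ a n) ∧ HasPowerSeriesOnUnit F a ∧ {n | a n ≠ 0} = T

lemma HasPowerSeriesOnUnit.summable {F : ℝ → ℝ} {a : ℕ → ℝ} (h : HasPowerSeriesOnUnit F a) :
    Summable a := by
  simpa using (h 1 (by simp)).summable

lemma HasPowerSeriesOnUnit.summable_norm {F : ℝ → ℝ} {a : ℕ → ℝ} (h : HasPowerSeriesOnUnit F a)
    (ha : ∀ n, 0 ≤ a n) {t : ℝ} (ht : t ∈ Set.Icc (-1 : ℝ) 1) : Summable fun n => ‖a n * t ^ n‖ := by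
  refine Summable.of_nonneg_of_le (fun _ => norm_nonneg _) (fun n => ?_) h.summable
  rw [norm_mul, norm_pow, Real.norm_of_nonneg (ha n)]
  exact mul_le_of_le_one_right (ha n) (pow_le_one₀ (norm_nonneg _) (abs_le.2 ht))

namespace HasNonnegSeries

lemma congr {F G : ℝ → ℝ} {T : Set ℕ} (h : HasNonnegSeries F T)
    (hFG : ∀ t ∈ Set.Icc (-1 : ℝ) 1, F t = G t) : HasNonnegSeries G T := by
  obtain ⟨a, ha, hs, hT⟩ := h
  exact ⟨a, ha, fun t ht => hFG t ht ▸ hs t ht, hT⟩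

lemma const {c : ℝ} (hc : 0 ≤ c) : HasNonnegSeries (fun _ => c) (zeroSet (c ≠ 0)) := by
  refine ⟨fun n => if n = 0 then c else 0, fun n => ?_, fun t _ => ?_, ?_⟩
  · dsimp only; split_ifs <;> simp [hc]
  · have := hasSum_ite_eq (0 : ℕ) c
    convert this using 2 with n
    split_ifs with h <;> simp [h]
  · ext n; simp [zeroSet]

lemma id : HasNonnegSeries (fun t => t) {1} := by
  refine ⟨fun n => if n = 1 then 1 else 0, fun n => ?_, fun t _ => ?_, ?_⟩
  · dsimp only; split_ifs <;> simp
  · have := hasSum_ite_eq (1 : ℕ) t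
    convert this using 2 with n
    split_ifs with h <;> simp [h]
  · ext n; simp

lemma add {F G : ℝ → ℝ} {T U : Set ℕ} (hF : HasNonnegSeries F T) (hG : HasNonnegSeries G U) :
    HasNonnegSeries (fun t => F t + G t) (T ∪ U) := by
  obtain ⟨a, ha, hs, rfl⟩ := hF
  obtain ⟨b, hb, hs', rfl⟩ := hG
  refine ⟨fun n => a n + b n, fun n => add_nonneg (ha n) (hb n), fun t ht => ?_, ?_⟩
  · simp only [add_mul]
    exact (hs t ht).add (hs' t ht)
  · ext n
    simp only [Set.mem_ofPred_eq, Set.mem_union, ne_eq, add_eq_zero_iff_of_nonneg (ha n) (hb n)]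
    tauto

lemma const_mul {F : ℝ → ℝ} {T : Set ℕ} (hF : HasNonnegSeries F T) {c : ℝ} (hc : 0 < c) :
    HasNonnegSeries (fun t => c * F t) T := by
  obtain ⟨a, ha, hs, rfl⟩ := hF
  refine ⟨fun n => c * a n, fun n => mul_nonneg hc.le (ha n), fun t ht => ?_, ?_⟩
  · simp only [mul_assoc]
    exact (hs t ht).mul_left c
  · ext n
    simp [hc.ne']

/-- The Cauchy product. Nonnegative terms cannot cancel, so the support is the full sumset. -/
lemma mul {F G : ℝ → ℝ} {T U : Set ℕ} (hF : HasNonnegSeries F T) (hG : HasNonnegSeries G U) :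
    HasNonnegSeries (fun t => F t * G t) (addSet T U) := by
  obtain ⟨a, ha, hs, rfl⟩ := hF
  obtain ⟨b, hb, hs', rfl⟩ := hG
  refine ⟨fun n => ∑ p ∈ Finset.HasAntidiagonal.antidiagonal n, a p.1 * b p.2,
    fun n => Finset.sum_nonneg fun p _ => mul_nonneg (ha _) (hb _), fun t ht => ?_, ?_⟩
  · have h1 := hs.summable_norm ha ht
    have h2 := hs'.summable_norm hb ht
    have h3 := (summable_norm_sum_mul_antidiagonal_of_summable_norm h1 h2).of_norm.hasSum
    rw [← tsum_mul_tsum_eq_tsum_sum_antidiagonal_of_summable_norm h1 h2, (hs t ht).tsum_eq,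
      (hs' t ht).tsum_eq] at h3
    refine (funext fun n => ?_ : (fun n => (∑ p ∈ Finset.HasAntidiagonal.antidiagonal n,
      a p.1 * b p.2) * t ^ n) = _) ▸ h3
    rw [Finset.sum_mul]
    refine Finset.sum_congr rfl fun p hp => ?_
    rw [← Finset.HasAntidiagonal.mem_antidiagonal.1 hp, pow_add]
    ring
  · ext n
    rw [Set.mem_ofPred_eq, ne_eq, Finset.sum_eq_zero_iff_of_nonneg
      fun p _ => mul_nonneg (ha _) (hb _)]
    push Not
    constructor
    · rintro ⟨p, hp, h0⟩
      exact ⟨p.1, left_ne_zero_of_mul h0, p.2, right_ne_zero_of_mul h0,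
        (Finset.HasAntidiagonal.mem_antidiagonal.1 hp).symm⟩
    · rintro ⟨i, hi, j, hj, rfl⟩
      exact ⟨(i, j), Finset.HasAntidiagonal.mem_antidiagonal.2 rfl, mul_ne_zero hi hj⟩

lemma pow {F : ℝ → ℝ} {T : Set ℕ} (hF : HasNonnegSeries F T) (n : ℕ) :
    HasNonnegSeries (fun t => F t ^ n) (iterSum T n) := by
  induction n with
  | zero =>
    have := const (c := 1) zero_le_one
    simpa [zeroSet, iterSum, Set.ext_iff] using this
  | succ n ih =>
    exact (ih.mul hF).congr fun t _ => (pow_succ _ _).symm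

/-- Substitution gives a double series with terms `a n * b n k * t ^ k`. Nonnegativity and `G 1 ∈
[-1, 1]` make it summable at `t = 1`, which dominates all other `t`, so the sums may be exchanged; a
coefficient vanishes only if all of its terms do. -/
lemma comp {F G : ℝ → ℝ} {S T : Set ℕ} (hF : HasNonnegSeries F S) (hG : HasNonnegSeries G T)
    (hmaps : ∀ t ∈ Set.Icc (-1 : ℝ) 1, G t ∈ Set.Icc (-1 : ℝ) 1) :
    HasNonnegSeries (fun t => F (G t)) (compSet S T) := by
  obtain ⟨a, ha, hs, rfl⟩ := hF
  choose b hb hbs hbT using fun n => hG.pow n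
  have h1 : (1 : ℝ) ∈ Set.Icc (-1 : ℝ) 1 := by simp
  have hab : ∀ n k, 0 ≤ a n * b n k := fun n k => mul_nonneg (ha n) (hb n k)
  have hrow : ∀ n, HasSum (fun k => a n * b n k) (a n * G 1 ^ n) := fun n => by
    simpa using (hbs n 1 h1).mul_left (a n)
  have hsum : Summable fun p : ℕ × ℕ => a p.1 * b p.1 p.2 := by
    rw [summable_prod_of_nonneg fun p => hab _ _]
    refine ⟨fun n => (hrow n).summable, ?_⟩
    simp_rw [fun n => (hrow n).tsum_eq]
    exact (hs _ (hmaps 1 h1)).summable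
  have hcol : ∀ k, Summable fun n => a n * b n k := fun k => hsum.prod_symm.prod_factor k
  refine ⟨fun k => ∑' n, a n * b n k, fun k => tsum_nonneg fun n => hab n k, fun t ht => ?_, ?_⟩
  · have hst : Summable fun p : ℕ × ℕ => a p.1 * b p.1 p.2 * t ^ p.2 := by
      refine Summable.of_norm_bounded hsum fun p => ?_
      rw [norm_mul, norm_pow, Real.norm_of_nonneg (hab _ _)]
      exact mul_le_of_le_one_right (hab _ _) (pow_le_one₀ (norm_nonneg _) (abs_le.2 ht))
    have e1 : ∑' p : ℕ × ℕ, a p.1 * b p.1 p.2 * t ^ p.2 = F (G t) := by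
      have := hst.hasSum.prod_fiberwise (g := fun n => a n * G t ^ n) fun n => by
        simpa only [mul_assoc] using (hbs n t ht).mul_left (a n)
      exact this.unique (hs _ (hmaps t ht))
    have h2 := (hst.prod_symm.hasSum).prod_fiberwise (g := fun k => (∑' n, a n * b n k) * t ^ k)
      fun k => (hcol k).hasSum.mul_right (t ^ k)
    have e2 : ∑' p : ℕ × ℕ, a p.swap.1 * b p.swap.1 p.swap.2 * t ^ p.swap.2 = F (G t) := by
      rw [← e1]
      exact (Equiv.prodComm ℕ ℕ).tsum_eq fun p : ℕ × ℕ => a p.1 * b p.1 p.2 * t ^ p.2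
    rwa [e2] at h2
  · ext k
    have hk : (∑' n, a n * b n k = 0) ↔ ∀ n, a n * b n k = 0 := by
      constructor
      · intro h0
        have := (hcol k).hasSum
        rw [h0, hasSum_zero_iff_of_nonneg fun n => hab n k] at this
        exact fun n => congrFun this n
      · intro h0
        simp [h0]
    simp only [Set.mem_ofPred_eq, ne_eq, hk, not_forall, mul_eq_zero, not_or, compSet, ← hbT]

end HasNonnegSeries

/-! ### Combinatorics of sumsets -/

lemma mul_mem_iterSum {A : Set ℕ} {a : ℕ} (ha : a ∈ A) (n : ℕ) : n * a ∈ iterSum A n := by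
  induction n with
  | zero => simp [iterSum]
  | succ n ih => exact ⟨_, ih, _, ha, by ring⟩

/-- One of the `n` slots is left free. Putting an exceptional `b` there is how an element of the
non-dominating parity is carried from layer to layer. -/
lemma mul_add_mem_compSet {S A : Set ℕ} {n a b : ℕ} (hn : n ∈ S) (h1 : 1 ≤ n) (ha : a ∈ A)
    (hb : b ∈ A) : (n - 1) * a + b ∈ compSet S A := by
  refine ⟨n, hn, ?_⟩
  obtain ⟨k, rfl⟩ : ∃ k, n = k + 1 := ⟨n - 1, by omega⟩
  exact ⟨_, mul_mem_iterSum ha k, b, hb, rfl⟩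

lemma le_of_mem_iterSum {A : Set ℕ} {D : ℕ} (hA : ∀ a ∈ A, a ≤ D) {n k : ℕ}
    (hk : k ∈ iterSum A n) : k ≤ n * D := by
  induction n generalizing k with
  | zero =>
    have : k = 0 := hk
    simp [this]
  | succ n ih =>
    obtain ⟨i, hi, j, hj, rfl⟩ := hk
    have := ih hi
    have := hA j hj
    linarith [add_mul n 1 D]

lemma isGreatest_compSet {S A : Set ℕ} {m D : ℕ} (hS : IsGreatest S m) (hA : IsGreatest A D) :
    IsGreatest (compSet S A) (m * D) := by
  refine ⟨⟨m, hS.1, mul_mem_iterSum hA.1 m⟩, ?_⟩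
  rintro k ⟨n, hn, hk⟩
  exact (le_of_mem_iterSum hA.2 hk).trans (Nat.mul_le_mul_right D (hS.2 hn))

lemma iterSum_singleton_one (n : ℕ) : iterSum {1} n = {n} := by
  induction n with
  | zero => rfl
  | succ n ih => ext k; simp [iterSum, ih]

lemma compSet_singleton_one (S : Set ℕ) : compSet S {1} = S := by
  ext k; simp [compSet, iterSum_singleton_one]

/-- A number `k` that is a sum of `n` numbers at most `D` of parity `p`, except that, in case `Q`
holds, some of the summands may be at most `D - δ` instead. -/
lemma parity_or_le_of_mem_iterSum {A : Set ℕ} {p δ D : ℕ} {Q : Prop}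
    (hA : ∀ a ∈ A, a % 2 = p ∨ Q ∧ a + δ ≤ D) (hD : Q → ∀ a ∈ A, a ≤ D) {n k : ℕ}
    (hk : k ∈ iterSum A n) : k % 2 = n * p % 2 ∨ Q ∧ k + δ ≤ n * D := by
  induction n generalizing k with
  | zero =>
    have : k = 0 := hk
    simp [this]
  | succ n ih =>
    obtain ⟨i, hi, j, hj, rfl⟩ := hk
    have e1 : (n + 1) * p = n * p + p := by ring
    have e2 : (n + 1) * D = n * D + D := by ring
    rw [e1, e2]
    rcases ih hi with h1 | ⟨hQ, h1⟩
    · rcases hA j hj with h2 | ⟨hQ, h2⟩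
      · left; omega
      · right
        have := le_of_mem_iterSum (hD hQ) hi
        exact ⟨hQ, by omega⟩
    · right
      have := hD hQ j hj
      exact ⟨hQ, by omega⟩

/-! ### The layer recursion for the supports, with index `l` for depth `l + 1` -/

/-- Supports of the layerwise power series of the two kernels: `S l` is the support of the `l`-th
activation, `A l` that of the NNGP and `B l` that of the NTK; `s` and `s'` are the biases. -/
structure LayerSupports (S A B : ℕ → Set ℕ) (s s' : Prop) : Prop where
  bias : s → s'
  A_zero : A 0 = {1} ∪ zeroSet s
  A_succ : ∀ l, A (l + 1) = zeroSet s ∪ compSet (S l) (A l)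
  B_zero : B 0 = {1} ∪ zeroSet s'
  B_succ : ∀ l, B (l + 1) = zeroSet s' ∪ compSet (S l) (A l) ∪
    addSet (compSet {n | n + 1 ∈ S l} (A l)) (B l)

namespace LayerSupports

variable {S A B : ℕ → Set ℕ} {s s' : Prop}

lemma A_subset_B (h : LayerSupports S A B s s') (l : ℕ) : A l ⊆ B l := by
  have hz : zeroSet s ⊆ zeroSet s' := fun n hn => ⟨hn.1, h.bias hn.2⟩
  cases l with
  | zero => rw [h.A_zero, h.B_zero]; exact Set.union_subset_union_right _ hz
  | succ l =>
    rw [h.A_succ, h.B_succ]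
    exact (Set.union_subset_union_left _ hz).trans Set.subset_union_left

lemma compSet_subset_A (h : LayerSupports S A B s s') (l : ℕ) :
    compSet (S l) (A l) ⊆ A (l + 1) := by
  rw [h.A_succ]; exact Set.subset_union_right

/-- The derivative supplies `n - 1` slots filled from `A l`; the slot it lost is filled by the
accompanying factor, that is, from `B l`. -/
lemma add_mem_B (h : LayerSupports S A B s s') {l n a b : ℕ} (hn : n ∈ S l) (h1 : 1 ≤ n)
    (ha : a ∈ A l) (hb : b ∈ B l) : (n - 1) * a + b ∈ B (l + 1) := by
  rw [h.B_succ]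
  refine Or.inr ⟨_, ⟨n - 1, ?_, mul_mem_iterSum ha _⟩, b, hb, rfl⟩
  rw [Set.mem_ofPred_eq, Nat.sub_add_cancel h1]
  exact hn

lemma isGreatest_A (h : LayerSupports S A B s s') {m : ℕ} (hS : ∀ l, IsGreatest (S l) m) (l : ℕ) :
    IsGreatest (A l) (m ^ l) := by
  induction l with
  | zero =>
    rw [h.A_zero]
    refine ⟨by simp, ?_⟩
    rintro n (hn | hn)
    · exact hn.le
    · simp [hn.1]
  | succ l ih =>
    have hc := isGreatest_compSet (hS l) ih
    rw [h.A_succ, pow_succ']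
    refine ⟨Or.inr hc.1, ?_⟩
    rintro n (hn | hn)
    · simp [hn.1]
    · exact hc.2 hn

/-- The degree lost by differentiating is restored by the factor from the previous NTK layer, so the
derivative term does not exceed the NNGP maximum. -/
lemma isGreatest_B (h : LayerSupports S A B s s') {m : ℕ} (hS : ∀ l, IsGreatest (S l) m) (l : ℕ) :
    IsGreatest (B l) (m ^ l) := by
  refine ⟨h.A_subset_B l (h.isGreatest_A hS l).1, ?_⟩
  induction l with
  | zero =>
    rw [h.B_zero]
    rintro n (hn | hn)
    · exact hn.le
    · simp [hn.1]
  | succ l ih =>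
    rw [h.B_succ, pow_succ']
    rintro k ((hk | hk) | ⟨i, ⟨n, hn, hi⟩, j, hj, rfl⟩)
    · simp [hk.1]
    · exact (isGreatest_compSet (hS l) (h.isGreatest_A hS l)).2 hk
    · have h1 := le_of_mem_iterSum (h.isGreatest_A hS l).2 hi
      have h2 := ih hj
      have h3 : n + 1 ≤ m := (hS l).2 hn
      calc i + j ≤ n * m ^ l + m ^ l := add_le_add h1 h2
        _ = (n + 1) * m ^ l := by ring
        _ ≤ m * m ^ l := Nat.mul_le_mul_right _ h3

lemma pred_aux {m D : ℕ} (hm : 1 ≤ m) (hD : 1 ≤ D) : (m - 1) * D + (D - 1) = m * D - 1 := by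
  obtain ⟨k, rfl⟩ : ∃ k, m = k + 1 := ⟨m - 1, by omega⟩
  have : (k + 1) * D = k * D + D := by ring
  rw [this, Nat.add_sub_cancel]
  omega

/-- The bias puts `0 = 1 - 1` into the input support. Using the maximum in all slots but one and the
defective element in the last keeps the deficit equal to 1. -/
lemma pred_mem_A (h : LayerSupports S A B s s') (hs : s) {m : ℕ} (hm : 1 ≤ m)
    (hS : ∀ l, IsGreatest (S l) m) (l : ℕ) : m ^ l - 1 ∈ A l := by
  induction l with
  | zero => rw [h.A_zero]; exact Or.inr ⟨by simp, hs⟩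
  | succ l ih =>
    have := h.compSet_subset_A l
      (mul_add_mem_compSet (hS l).1 hm (h.isGreatest_A hS l).1 ih)
    rwa [pred_aux hm (Nat.one_le_pow _ _ hm), ← pow_succ'] at this

/-- Here the deficit starts in `B 0` and stays in the NTK slot, so the NTK bias suffices even if the
NNGP has none. -/
lemma pred_mem_B (h : LayerSupports S A B s s') (hs : s') {m : ℕ} (hm : 1 ≤ m)
    (hS : ∀ l, IsGreatest (S l) m) (l : ℕ) : m ^ l - 1 ∈ B l := by
  induction l with
  | zero => rw [h.B_zero]; exact Or.inr ⟨by simp, hs⟩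
  | succ l ih =>
    have := h.add_mem_B (hS l).1 hm (h.isGreatest_A hS l).1 ih
    rwa [pred_aux hm (Nat.one_le_pow _ _ hm), ← pow_succ'] at this

/-- Without bias the input layer is linear, and composing with it changes no exponent. -/
lemma A_one_eq (h : LayerSupports S A B s s') (hs : ¬s) : A 1 = S 0 := by
  rw [h.A_succ 0, h.A_zero]
  simp [zeroSet, hs, compSet_singleton_one]

lemma B_one_eq (h : LayerSupports S A B s s') (hs : ¬s') : B 1 = S 0 := by
  have hs0 : ¬s := fun h0 => hs (h.bias h0)
  rw [h.B_succ 0, h.A_zero, h.B_zero]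
  ext k
  simp only [zeroSet, hs, hs0, addSet, and_false, Set.mem_union,
    Set.mem_ofPred_eq, false_or, or_false, Set.mem_singleton_iff]
  constructor
  · rintro (hk | ⟨i, hi, j, hj, rfl⟩)
    · simpa [compSet_singleton_one, Set.ofPred_false, Set.union_empty] using hk
    · simp [Set.ofPred_false, compSet_singleton_one] at hi hj
      simpa [hj] using hi
  · intro hk
    left
    simpa [Set.ofPred_false, compSet_singleton_one] using hk

/-- If neither the exponent `n` nor its summands are defective, `k` has parity `p * p`, which is
`p`. A defective summand costs at least `δ`, and a defective `n` costs `δ * D ≥ δ`. -/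
lemma parity_or_le_step {p δ m n k D : ℕ} {Q : Prop} (hp : p < 2)
    (hn : n % 2 = p ∨ Q ∧ n + δ ≤ m) (hnm : Q → n ≤ m) (hD : Q → 1 ≤ D)
    (hk : k % 2 = n * p % 2 ∨ Q ∧ k + δ ≤ n * D) (hle : Q → k ≤ n * D) :
    k % 2 = p ∨ Q ∧ k + δ ≤ m * D := by
  rcases hn with h1 | ⟨hq, h1⟩
  · rcases hk with h2 | ⟨hq, h2⟩
    · left
      rw [h2, Nat.mul_mod, h1]
      interval_cases p <;> rfl
    · exact Or.inr ⟨hq, h2.trans (Nat.mul_le_mul_right D (hnm hq))⟩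
  · refine Or.inr ⟨hq, ?_⟩
    have hD1 := hD hq
    have := hle hq
    calc k + δ ≤ n * D + δ * D := by nlinarith
      _ = (n + δ) * D := by ring
      _ ≤ m * D := Nat.mul_le_mul_right D h1

/-- Without bias, the elements of the supports have the parity `p` or are at most `m ^ l - δ`. -/
lemma parity_or_le_A (h : LayerSupports S A B s s') (hs : ¬s) {p δ m : ℕ} (hp : p < 2) {Q : Prop}
    (hQ : Q → 1 ≤ m ∧ ∀ l, IsGreatest (S l) m)
    (hS : ∀ l, ∀ n ∈ S l, n % 2 = p ∨ Q ∧ n + δ ≤ m) (j : ℕ) :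
    ∀ k ∈ A (j + 1), k % 2 = p ∨ Q ∧ k + δ ≤ m ^ (j + 1) := by
  induction j with
  | zero =>
    rw [h.A_one_eq hs, zero_add, pow_one]
    exact hS 0
  | succ j ih =>
    have hAD : Q → ∀ a ∈ A (j + 1), a ≤ m ^ (j + 1) := fun hq a ha =>
      (h.isGreatest_A (hQ hq).2 (j + 1)).2 ha
    intro k hk
    rw [h.A_succ] at hk
    rcases hk with hk | ⟨n, hn, hk⟩
    · exact absurd hk.2 hs
    · rw [pow_succ' m (j + 1)]
      exact parity_or_le_step hp (hS _ n hn) (fun hq => ((hQ hq).2 _).2 hn)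
        (fun hq => Nat.one_le_pow _ _ (hQ hq).1) (parity_or_le_of_mem_iterSum ih hAD hk)
        fun hq => le_of_mem_iterSum (hAD hq) hk

lemma parity_or_le_B (h : LayerSupports S A B s s') (hs : ¬s') {p δ m : ℕ} (hp : p < 2) {Q : Prop}
    (hQ : Q → 1 ≤ m ∧ ∀ l, IsGreatest (S l) m)
    (hS : ∀ l, ∀ n ∈ S l, n % 2 = p ∨ Q ∧ n + δ ≤ m) (j : ℕ) :
    ∀ k ∈ B (j + 1), k % 2 = p ∨ Q ∧ k + δ ≤ m ^ (j + 1) := by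
  have hs0 : ¬s := fun h0 => hs (h.bias h0)
  have hA := h.parity_or_le_A hs0 hp hQ hS
  induction j with
  | zero =>
    rw [h.B_one_eq hs, zero_add, pow_one]
    exact hS 0
  | succ j ih =>
    set D := m ^ (j + 1) with hD
    have hAD : Q → ∀ a ∈ A (j + 1), a ≤ D := fun hq a ha =>
      (h.isGreatest_A (hQ hq).2 (j + 1)).2 ha
    have hBD : Q → ∀ a ∈ B (j + 1), a ≤ D := fun hq a ha =>
      (h.isGreatest_B (hQ hq).2 (j + 1)).2 ha
    intro k hk
    rw [h.B_succ] at hk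
    rcases hk with (hk | hk) | ⟨i, ⟨n, hn, hi⟩, b, hb, rfl⟩
    · exact absurd hk.2 hs
    · exact hA (j + 1) k (by rw [h.A_succ]; exact Or.inr hk)
    · have e1 : (n + 1) * p = n * p + p := by ring
      have e2 : (n + 1) * D = n * D + D := by ring
      rw [pow_succ' m (j + 1), ← hD]
      refine parity_or_le_step hp (hS _ (n + 1) hn) (fun hq => ((hQ hq).2 _).2 hn)
        (fun hq => Nat.one_le_pow _ _ (hQ hq).1) ?_ ?_
      · rw [e1, e2]
        rcases parity_or_le_of_mem_iterSum (hA j) hAD hi with h1 | ⟨hq, h1⟩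
        · rcases ih b hb with h2 | ⟨hq, h2⟩
          · left; omega
          · right
            have := le_of_mem_iterSum (hAD hq) hi
            exact ⟨hq, by omega⟩
        · right
          have := hBD hq b hb
          change i + δ ≤ n * D at h1
          exact ⟨hq, by omega⟩
      · intro hq
        rw [e2]
        exact add_le_add (le_of_mem_iterSum (hAD hq) hi) (hBD hq b hb)

/-- This realizes the optimal deficit: `m - δ` is chosen once, in the first activation, and then
occupies a single slot of every later layer. Choosing it later would multiply the deficit. -/
lemma sub_mem_A (h : LayerSupports S A B s s') (hs : ¬s) {δ m : ℕ} (hδ : δ ≤ m) (hm : 1 ≤ m)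
    (hS : ∀ l, IsGreatest (S l) m) (hS0 : m - δ ∈ S 0) (j : ℕ) : m ^ (j + 1) - δ ∈ A (j + 1) := by
  induction j with
  | zero => rw [h.A_one_eq hs]; simpa using hS0
  | succ j ih =>
    have := h.compSet_subset_A _
      (mul_add_mem_compSet (hS (j + 1)).1 hm (h.isGreatest_A hS (j + 1)).1 ih)
    have hle : δ ≤ m ^ (j + 1) := hδ.trans (Nat.le_self_pow (by omega) m)
    convert this using 1
    obtain ⟨k, rfl⟩ : ∃ k, m = k + 1 := ⟨m - 1, by omega⟩
    have e : (k + 1) ^ (j + 1 + 1) = k * (k + 1) ^ (j + 1) + (k + 1) ^ (j + 1) := by ring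
    rw [e, Nat.add_sub_cancel]
    omega

end LayerSupports

/-! ### Supports that are unbounded in both parities -/

/-- Both the even and the odd elements of `T` are unbounded. -/
def BothUnbounded (T : Set ℕ) : Prop := ∀ r < 2, ∀ n, ∃ k ∈ T, k % 2 = r ∧ n ≤ k

lemma BothUnbounded.mono {T U : Set ℕ} (h : BothUnbounded T) (hTU : T ⊆ U) : BothUnbounded U :=
  fun r hr n => let ⟨k, hk, h'⟩ := h r hr n; ⟨k, hTU hk, h'⟩

/-- A translation either keeps or swaps the two parities, so it preserves the property; the free
slot of a layer provides such a translation. -/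
lemma BothUnbounded.of_add {T U : Set ℕ} (h : BothUnbounded T) {c : ℕ} (hc : ∀ b ∈ T, c + b ∈ U) :
    BothUnbounded U := by
  intro r hr n
  obtain ⟨k, hk, h1, h2⟩ := h ((r + c) % 2) (Nat.mod_lt _ two_pos) n
  exact ⟨c + k, hc k hk, by omega, by omega⟩

lemma BothUnbounded.setDeg_eq_top {T : Set ℕ} (h : BothUnbounded T) {r : ℕ} (hr : r < 2) :
    setDeg (parityPart T r) = ⊤ := by
  rw [setDeg_eq_top_iff]
  intro n
  obtain ⟨k, hk, h1, h2⟩ := h r hr n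
  exact ⟨k, ⟨hk, h1⟩, h2⟩

lemma bothUnbounded_of_pairs {T : Set ℕ} (h : ∀ N, ∃ n ∈ T, N ≤ n ∧ n - 1 ∈ T) :
    BothUnbounded T := by
  intro r hr N
  obtain ⟨n, hn, h1, h2⟩ := h (N + 1)
  by_cases hnr : n % 2 = r
  · exact ⟨n, hn, hnr, by omega⟩
  · exact ⟨n - 1, h2, by omega, by omega⟩

namespace LayerSupports

variable {S A B : ℕ → Set ℕ} {s s' : Prop}

lemma A_nonempty (h : LayerSupports S A B s s') (hS : ∀ l, ∀ N, ∃ n ∈ S l, N ≤ n) (l : ℕ) :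
    (A l).Nonempty := by
  induction l with
  | zero => rw [h.A_zero]; exact ⟨1, by simp⟩
  | succ l ih =>
    obtain ⟨a, ha⟩ := ih
    obtain ⟨n, hn, -⟩ := hS l 0
    exact ⟨_, h.compSet_subset_A l ⟨n, hn, mul_mem_iterSum ha n⟩⟩

lemma bothUnbounded_A_succ (h : LayerSupports S A B s s') (hS : ∀ l, ∀ N, ∃ n ∈ S l, N ≤ n) {l : ℕ}
    (hl : BothUnbounded (A l)) : BothUnbounded (A (l + 1)) := by
  obtain ⟨a, ha⟩ := h.A_nonempty hS l
  obtain ⟨n, hn, h1⟩ := hS l 1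
  exact hl.of_add fun b hb => h.compSet_subset_A l (mul_add_mem_compSet hn h1 ha hb)

lemma bothUnbounded_A_of_le (h : LayerSupports S A B s s') (hS : ∀ l, ∀ N, ∃ n ∈ S l, N ≤ n)
    {k l : ℕ} (hk : BothUnbounded (A k)) (hkl : k ≤ l) : BothUnbounded (A l) := by
  induction l, hkl using Nat.le_induction with
  | base => exact hk
  | succ l _ ih => exact h.bothUnbounded_A_succ hS ih

/-- With bias the input support is `{0, 1}`, so each large `n` in `S 0` yields both `n` and `n - 1`
at the next layer; later layers contain translates. -/
lemma bothUnbounded_A (h : LayerSupports S A B s s') (hs : s)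
    (hS : ∀ l, ∀ N, ∃ n ∈ S l, N ≤ n) {l : ℕ} (hl : 1 ≤ l) : BothUnbounded (A l) := by
  refine h.bothUnbounded_A_of_le hS (bothUnbounded_of_pairs fun N => ?_) hl
  obtain ⟨n, hn, h1⟩ := hS 0 (N + 1)
  have m1 : 1 ∈ A 0 := by rw [h.A_zero]; simp
  have m0 : 0 ∈ A 0 := by rw [h.A_zero]; exact Or.inr ⟨rfl, hs⟩
  have e1 := h.compSet_subset_A 0 (mul_add_mem_compSet hn (by omega) m1 m1)
  have e0 := h.compSet_subset_A 0 (mul_add_mem_compSet hn (by omega) m1 m0)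
  rw [mul_one] at e1 e0
  rw [Nat.sub_add_cancel (by omega)] at e1
  exact ⟨n, e1, by omega, e0⟩

/-- The bias may be present only in the NTK, so this cannot be inherited from `A`; the elements 0
and 1 of `B 0` are put into the free slot instead. -/
lemma bothUnbounded_B (h : LayerSupports S A B s s') (hs : s')
    (hS : ∀ l, ∀ N, ∃ n ∈ S l, N ≤ n) {l : ℕ} (hl : 1 ≤ l) : BothUnbounded (B l) := by
  induction l, hl using Nat.le_induction with
  | base =>
    refine bothUnbounded_of_pairs fun N => ?_
    obtain ⟨n, hn, h1⟩ := hS 0 (N + 1)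
    have a1 : 1 ∈ A 0 := by rw [h.A_zero]; simp
    have m0 : 0 ∈ B 0 := by rw [h.B_zero]; exact Or.inr ⟨rfl, hs⟩
    have e1 := h.add_mem_B hn (by omega) a1 (h.A_subset_B 0 a1)
    have e0 := h.add_mem_B hn (by omega) a1 m0
    rw [mul_one] at e1 e0
    rw [Nat.sub_add_cancel (by omega)] at e1
    exact ⟨n, e1, by omega, e0⟩
  | succ l _ ih =>
    obtain ⟨a, ha⟩ := h.A_nonempty hS l
    obtain ⟨n, hn, h1⟩ := hS l 1
    exact ih.of_add fun b hb => h.add_mem_B hn h1 ha hb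

/-- Without bias, unbounded elements of one parity and an element of the other parity give unbounded
elements of both parities from the third layer on. -/
lemma bothUnbounded_A_of_mem (h : LayerSupports S A B s s') (hs : ¬s) {p : ℕ} (hp : p < 2)
    (hS : ∀ l, ∀ N, ∃ n ∈ S l, n % 2 = p ∧ N ≤ n) {o : ℕ} (ho : o ∈ S 0) (hop : o % 2 ≠ p)
    {l : ℕ} (hl : 2 ≤ l) : BothUnbounded (A l) := by
  have hS' : ∀ l, ∀ N, ∃ n ∈ S l, N ≤ n := fun l N =>
    let ⟨n, hn, _, h2⟩ := hS l N; ⟨n, hn, h2⟩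
  refine h.bothUnbounded_A_of_le hS' (k := 2) (fun r hr N => ?_) hl
  obtain ⟨n, hn, hnp, h2⟩ := hS 1 2
  obtain ⟨a, ha, hap, hNa⟩ := hS 0 N
  rw [← h.A_one_eq hs] at ha ho
  have ea := h.compSet_subset_A 1 (mul_add_mem_compSet hn (by omega) ha ha)
  have eo := h.compSet_subset_A 1 (mul_add_mem_compSet hn (by omega) ha ho)
  have hle : N ≤ (n - 1) * a := hNa.trans (Nat.le_mul_of_pos_left a (by omega))
  -- For `p = 0` the factor `a` is even, for `p = 1` the factor `n - 1` is. The parity of the sum is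
  -- thus decided by the last summand, `a` or `o`.
  have hpar : (n - 1) * a % 2 = 0 := by
    rw [Nat.mul_mod, hap]
    have : (n - 1) % 2 = 1 - p := by omega
    rw [this]
    interval_cases p <;> rfl
  by_cases hrp : r = p
  · exact ⟨_, ea, by omega, by omega⟩
  · exact ⟨_, eo, by omega, by omega⟩

end LayerSupports

/-! ### The table of degrees -/

lemma EReal.natCast_pow' (m k : ℕ) : ((m ^ k : ℕ) : EReal) = ((m : ℕ) : EReal) ^ k := by
  induction k with
  | zero => simp
  | succ k ih => rw [pow_succ, EReal.natCast_mul, ih, pow_succ]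

lemma EReal.natCast_sub_one {m : ℕ} (h : 1 ≤ m) :
    ((m - 1 : ℕ) : EReal) = ((m : ℕ) : EReal) - 1 := by
  rw [← EReal.coe_coe_eq_natCast, ← EReal.coe_coe_eq_natCast, Nat.cast_sub h]
  norm_cast

lemma EReal.top_pow_succ (k : ℕ) : (⊤ : EReal) ^ (k + 1) = ⊤ := by
  induction k with
  | zero => simp
  | succ k ih => rw [pow_succ, ih, EReal.top_mul_top]

lemma EReal.one_sub_one : (1 : EReal) - 1 = 0 := by
  have := EReal.natCast_sub_one (m := 1) le_rfl
  simpa using this.symm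

lemma EReal.top_sub_one : (⊤ : EReal) - 1 = ⊤ := EReal.toENNReal_eq_top_iff.mp rfl

/-- The rows of the degree table: `x` and `y` are the degrees of the dominating parity and of the
other parity at depth `j + 2`, and `D₁ > D₂` are those of the activation function. -/
def DegreeRow (t : Prop) (D₁ D₂ : EReal) (j : ℕ) (x y : EReal) : Prop :=
  (t → x = D₁ ^ (j + 1) ∧ (D₁ ≠ 0 → y = D₁ ^ (j + 1) - 1) ∧ (D₁ = 0 → y = ⊥)) ∧
    (¬t → x = D₁ ^ (j + 1) ∧ y = D₁ * (D₁ ^ j - 1) + D₂)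

lemma pow_mod_two {m p : ℕ} (h : m % 2 = p) (hp : p < 2) (j : ℕ) : m ^ (j + 1) % 2 = p := by
  rw [Nat.pow_mod, h]
  interval_cases p <;> simp

lemma setDeg_parityPart_of_isGreatest {C : Set ℕ} {D p : ℕ} (hC : IsGreatest C D)
    (hD : D % 2 = p) : setDeg (parityPart C p) = ((D : ℕ) : EReal) :=
  setDeg_eq_natCast_iff.2 ⟨⟨hC.1, hD⟩, fun _ hn => hC.2 hn.1⟩

/-- The gap `δ` between the degrees is odd, so `m ^ (j + 1) - δ` has the non-dominating parity, as
does `m ^ (j + 1) - 1`. The row only needs membership of these numbers and the absence of larger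
ones. -/
lemma degreeRow_of_finite {C : Set ℕ} {t : Prop} {m p j : ℕ} (hp : p < 2) (hm : m % 2 = p)
    {D₂ : EReal} (hD₂ : D₂ = ⊥ ∨ ∃ δ, 1 ≤ δ ∧ δ ≤ m ∧ δ % 2 = 1 ∧ D₂ = ((m - δ : ℕ) : EReal))
    (hC : IsGreatest C (m ^ (j + 1))) (hpred : t → 1 ≤ m → m ^ (j + 1) - 1 ∈ C)
    (hbot : ¬t → D₂ = ⊥ → ∀ k ∈ C, k % 2 = p)
    (hfin : ¬t → ∀ δ, 1 ≤ δ → δ ≤ m → D₂ = ((m - δ : ℕ) : EReal) →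
      (∀ k ∈ C, k % 2 = p ∨ k + δ ≤ m ^ (j + 1)) ∧ m ^ (j + 1) - δ ∈ C) :
    DegreeRow t ((m : ℕ) : EReal) D₂ j (setDeg (parityPart C p))
      (setDeg (parityPart C (1 - p))) := by
  have hmp := pow_mod_two hm hp j
  have hx : setDeg (parityPart C p) = ((m : ℕ) : EReal) ^ (j + 1) := by
    rw [setDeg_parityPart_of_isGreatest hC hmp, EReal.natCast_pow']
  refine ⟨fun ht => ⟨hx, fun h0 => ?_, fun h0 => ?_⟩, fun ht => ⟨hx, ?_⟩⟩
  · have hm1 : 1 ≤ m := Nat.one_le_iff_ne_zero.2 fun h => h0 (by simp [h])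
    have hD1 : 1 ≤ m ^ (j + 1) := Nat.one_le_pow _ _ hm1
    rw [← EReal.natCast_pow', ← EReal.natCast_sub_one hD1]
    refine setDeg_eq_natCast_iff.2 ⟨⟨hpred ht hm1, by omega⟩, ?_⟩
    rintro k ⟨hk, hk2⟩
    have := hC.2 hk
    rcases this.eq_or_lt with h | h
    · omega
    · omega
  · have hm0 : m = 0 := by exact_mod_cast h0
    subst hm0
    rw [setDeg_eq_bot_iff]
    refine Set.eq_empty_of_forall_notMem fun k hk => ?_
    have h1 := hC.2 hk.1
    have h2 := hk.2
    simp at h1 hm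
    omega
  · rcases hD₂ with h | ⟨δ, h1, h2, h3, h4⟩
    · rw [h, EReal.add_bot, setDeg_eq_bot_iff]
      refine Set.eq_empty_of_forall_notMem fun k hk => ?_
      have h1 := hbot ht h k hk.1
      have h2 := hk.2
      omega
    · obtain ⟨h5, h6⟩ := hfin ht δ h1 h2 h4
      have hm1 : 1 ≤ m := h1.trans h2
      have hD1 : 1 ≤ m ^ j := Nat.one_le_pow _ _ hm1
      have hle : m ≤ m ^ (j + 1) := Nat.le_self_pow (by omega) m
      -- This converts the tabulated expression into the maximum less the gap.
      have e : m * (m ^ j - 1) + (m - δ) = m ^ (j + 1) - δ := by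
        rw [Nat.mul_sub, mul_one, ← pow_succ']
        omega
      rw [h4, ← EReal.natCast_pow', ← EReal.natCast_sub_one hD1, ← EReal.natCast_mul,
        ← Nat.cast_add, e]
      refine setDeg_eq_natCast_iff.2 ⟨⟨h6, by omega⟩, ?_⟩
      rintro k ⟨hk, hk2⟩
      have := h5 k hk
      omega

/-- Without bias the conventions encode a genuine distinction: for `j = 0` the product `⊤ * (1 - 1)`
vanishes and `D₂` itself remains; for `j ≥ 1` the value is `⊤`, unless `D₂ = ⊥`, when the other
parity never occurs. -/
lemma degreeRow_of_top {S₀ C : Set ℕ} {t : Prop} {p j : ℕ} (hp : p < 2) {D₂ : EReal}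
    (hS₀ : setDeg (parityPart S₀ p) = ⊤) (hS₀' : setDeg (parityPart S₀ (1 - p)) = D₂)
    (ht : t → BothUnbounded C) (h0 : ¬t → j = 0 → C = S₀)
    (hbot : ¬t → D₂ = ⊥ → ∀ k ∈ C, k % 2 = p)
    (hunb : ¬t → ∀ N, ∃ k ∈ C, N ≤ k)
    (hne : ¬t → D₂ ≠ ⊥ → 1 ≤ j → BothUnbounded C) :
    DegreeRow t ⊤ D₂ j (setDeg (parityPart C p)) (setDeg (parityPart C (1 - p))) := by
  have hq : 1 - p < 2 := by omega
  refine ⟨fun h => ⟨?_, fun _ => ?_, fun h => absurd h (by simp)⟩, fun h => ?_⟩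
  · rw [(ht h).setDeg_eq_top hp, EReal.top_pow_succ]
  · rw [(ht h).setDeg_eq_top hq, EReal.top_pow_succ, EReal.top_sub_one]
  · rw [EReal.top_pow_succ]
    cases j with
    | zero =>
      rw [h0 h rfl, hS₀, hS₀', pow_zero, EReal.one_sub_one, mul_zero, zero_add]
      exact ⟨rfl, rfl⟩
    | succ j =>
      rw [EReal.top_pow_succ, EReal.top_sub_one, EReal.top_mul_top]
      by_cases hD : D₂ = ⊥
      · rw [hD, EReal.add_bot, setDeg_eq_top_iff, setDeg_eq_bot_iff]
        refine ⟨fun n => ?_, Set.eq_empty_of_forall_notMem fun k hk => ?_⟩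
        · obtain ⟨k, hk, hnk⟩ := hunb h n
          exact ⟨k, ⟨hk, hbot h hD k hk⟩, hnk⟩
        · have h1 := hbot h hD k hk.1
          have h2 := hk.2
          omega
      · rw [EReal.top_add_of_ne_bot hD]
        have := hne h hD (by omega)
        exact ⟨this.setDeg_eq_top hp, this.setDeg_eq_top hq⟩

lemma isGreatest_of_setDeg {T : Set ℕ} {m p : ℕ} (hp : p < 2)
    (h1 : setDeg (parityPart T p) = ((m : ℕ) : EReal))
    (h2 : setDeg (parityPart T (1 - p)) < ((m : ℕ) : EReal)) : IsGreatest T m := by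
  rw [setDeg_eq_natCast_iff] at h1
  refine ⟨h1.1.1, fun n hn => ?_⟩
  by_cases hnp : n % 2 = p
  · exact h1.2 ⟨hn, hnp⟩
  · exact setDeg_le_natCast.1 h2.le n ⟨hn, by omega⟩

namespace LayerSupports

variable {S A B : ℕ → Set ℕ} {s s' : Prop}

lemma exists_unbounded_A (h : LayerSupports S A B s s') (hS : ∀ l, ∀ N, ∃ n ∈ S l, N ≤ n)
    (hs : ¬s) {l : ℕ} (hl : 1 ≤ l) : ∀ N, ∃ k ∈ A l, N ≤ k := by
  induction l, hl using Nat.le_induction with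
  | base => rw [h.A_one_eq hs]; exact hS 0
  | succ l _ ih =>
    intro N
    obtain ⟨k, hk, hN⟩ := ih N
    obtain ⟨n, hn, h1⟩ := hS l 1
    exact ⟨_, h.compSet_subset_A l ⟨n, hn, mul_mem_iterSum hk n⟩,
      hN.trans (Nat.le_mul_of_pos_left k (by omega))⟩

/-- The degrees of the NNGP and NTK series if one parity dominates in the activation function. -/
lemma degreeRows (h : LayerSupports S A B s s') {p : ℕ} (hp : p < 2) {D₁ D₂ : EReal}
    (h1 : ∀ l, setDeg (parityPart (S l) p) = D₁)
    (h2 : ∀ l, setDeg (parityPart (S l) (1 - p)) = D₂) (hlt : D₂ < D₁) (j : ℕ) :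
    DegreeRow s D₁ D₂ j (setDeg (parityPart (A (j + 1)) p))
        (setDeg (parityPart (A (j + 1)) (1 - p))) ∧
      DegreeRow s' D₁ D₂ j (setDeg (parityPart (B (j + 1)) p))
        (setDeg (parityPart (B (j + 1)) (1 - p))) := by
  have hs0 : ¬s' → ¬s := fun h' h0 => h' (h.bias h0)
  have hbot : D₂ = ⊥ → ∀ l, ∀ n ∈ S l, n % 2 = p := by
    intro hD l n hn
    by_contra hne
    have := setDeg_eq_bot_iff.1 ((h2 l).trans hD)
    exact Set.notMem_empty n (this ▸ ⟨hn, by omega⟩)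
  -- Taking `Q := False` excludes defects altogether and leaves a pure parity statement; `δ` and `m`
  -- are dummies.
  have hAbot : ¬s → D₂ = ⊥ → ∀ k ∈ A (j + 1), k % 2 = p := fun hs hD k hk => by
    simpa using h.parity_or_le_A hs hp (δ := 0) (m := 0) (Q := False) (by simp)
      (fun l n hn => Or.inl (hbot hD l n hn)) j k hk
  have hBbot : ¬s' → D₂ = ⊥ → ∀ k ∈ B (j + 1), k % 2 = p := fun hs hD k hk => by
    simpa using h.parity_or_le_B hs hp (δ := 0) (m := 0) (Q := False) (by simp)
      (fun l n hn => Or.inl (hbot hD l n hn)) j k hk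
  rcases setDeg_trichotomy (parityPart (S 0) p) with hD | ⟨m, hD⟩ | hD
  · rw [h1] at hD
    exact absurd hlt (by simp [hD])
  · rw [h1] at hD
    subst hD
    have hm : m % 2 = p := (setDeg_eq_natCast_iff.1 (h1 0)).1.2
    have hS : ∀ l, IsGreatest (S l) m := fun l =>
      isGreatest_of_setDeg hp (h1 l) (by rw [h2 l]; exact hlt)
    -- With `δ` the gap between the degrees, every exponent of the wrong parity falls short of `m`
    -- by at least `δ`; `Q := True` now allows such defects.
    have hcl : ∀ δ, 1 ≤ δ → δ ≤ m → D₂ = ((m - δ : ℕ) : EReal) →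
        (∀ l, ∀ n ∈ S l, n % 2 = p ∨ True ∧ n + δ ≤ m) ∧ m - δ ∈ S 0 := by
      intro δ hδ hδm hD
      refine ⟨fun l n hn => ?_, ?_⟩
      · by_cases hnp : n % 2 = p
        · exact Or.inl hnp
        · have := (setDeg_eq_natCast_iff.1 ((h2 l).trans hD)).2 ⟨hn, by omega⟩
          exact Or.inr ⟨trivial, by omega⟩
      · exact (setDeg_eq_natCast_iff.1 ((h2 0).trans hD)).1.1
    have hD₂ : D₂ = ⊥ ∨ ∃ δ, 1 ≤ δ ∧ δ ≤ m ∧ δ % 2 = 1 ∧ D₂ = ((m - δ : ℕ) : EReal) := by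
      rcases setDeg_trichotomy (parityPart (S 0) (1 - p)) with hE | ⟨o, hE⟩ | hE
      · exact Or.inl ((h2 0).symm.trans hE)
      · have ho := (setDeg_eq_natCast_iff.1 hE).1.2
        rw [h2] at hE
        rw [hE, EReal.natCast_lt_iff] at hlt
        refine Or.inr ⟨m - o, by omega, by omega, by omega, ?_⟩
        rw [hE, Nat.sub_sub_self hlt.le]
      · rw [h2] at hE
        exact absurd hlt (by simp [hE])
    constructor
    · refine degreeRow_of_finite hp hm hD₂ (h.isGreatest_A hS _)
        (fun hs hm1 => h.pred_mem_A hs hm1 hS _) hAbot fun hs δ hδ hδm hE => ⟨fun k hk => ?_, ?_⟩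
      · simpa using h.parity_or_le_A hs hp (Q := True) (fun _ => ⟨hδ.trans hδm, hS⟩)
          (hcl δ hδ hδm hE).1 j k hk
      · exact h.sub_mem_A hs hδm (hδ.trans hδm) hS (hcl δ hδ hδm hE).2 j
    · refine degreeRow_of_finite hp hm hD₂ (h.isGreatest_B hS _)
        (fun hs hm1 => h.pred_mem_B hs hm1 hS _) hBbot fun hs δ hδ hδm hE => ⟨fun k hk => ?_, ?_⟩
      · simpa using h.parity_or_le_B hs hp (Q := True) (fun _ => ⟨hδ.trans hδm, hS⟩)
          (hcl δ hδ hδm hE).1 j k hk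
      · exact h.A_subset_B _ (h.sub_mem_A (hs0 hs) hδm (hδ.trans hδm) hS (hcl δ hδ hδm hE).2 j)
  · rw [h1] at hD
    subst hD
    have hSp : ∀ l, ∀ N, ∃ n ∈ S l, n % 2 = p ∧ N ≤ n := fun l N =>
      let ⟨n, hn, hN⟩ := setDeg_eq_top_iff.1 (h1 l) N
      ⟨n, hn.1, hn.2, hN⟩
    have hS : ∀ l, ∀ N, ∃ n ∈ S l, N ≤ n := fun l N =>
      let ⟨n, hn, _, hN⟩ := hSp l N
      ⟨n, hn, hN⟩
    have hne : ¬s → D₂ ≠ ⊥ → 1 ≤ j → BothUnbounded (A (j + 1)) := by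
      intro hs hD hj
      have : (parityPart (S 0) (1 - p)).Nonempty := by
        rw [Set.nonempty_iff_ne_empty, ne_eq, ← setDeg_eq_bot_iff, h2]
        exact hD
      obtain ⟨o, ho, hop⟩ := this
      exact h.bothUnbounded_A_of_mem hs hp hSp ho (by omega) (by omega)
    constructor
    · exact degreeRow_of_top hp (h1 0) (h2 0) (fun hs => h.bothUnbounded_A hs hS (by omega))
        (fun hs hj => by subst hj; exact h.A_one_eq hs) hAbot
        (fun hs => h.exists_unbounded_A hS hs (by omega)) hne
    · refine degreeRow_of_top hp (h1 0) (h2 0) (fun hs => h.bothUnbounded_B hs hS (by omega))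
        (fun hs hj => by subst hj; exact h.B_one_eq hs) hBbot (fun hs N => ?_)
        fun hs hD hj => (hne (hs0 hs) hD hj).mono (h.A_subset_B _)
      obtain ⟨k, hk, hN⟩ := h.exists_unbounded_A hS (hs0 hs) (l := j + 1) (by omega) N
      exact ⟨k, h.A_subset_B _ hk, hN⟩

/-- Infinite degrees of both parities are preserved. -/
lemma bothUnbounded (h : LayerSupports S A B s s') (hS : ∀ l, BothUnbounded (S l)) (j : ℕ) :
    BothUnbounded (A (j + 1)) ∧ BothUnbounded (B (j + 1)) := by
  have hS' : ∀ l, ∀ N, ∃ n ∈ S l, N ≤ n := fun l N =>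
    let ⟨n, hn, _, hN⟩ := hS l 0 two_pos N
    ⟨n, hn, hN⟩
  have hA : BothUnbounded (A (j + 1)) := by
    by_cases hs : s
    · exact h.bothUnbounded_A hs hS' (by omega)
    · exact h.bothUnbounded_A_of_le hS' (k := 1) (h.A_one_eq hs ▸ hS 0) (by omega)
  exact ⟨hA, hA.mono (h.A_subset_B _)⟩

/-- The table of degrees. -/
theorem degreeTable (h : LayerSupports S A B s s') {σ σ' : ℝ} (hσ : 0 ≤ σ) (hσ' : 0 ≤ σ')
    (hs : s ↔ 0 < σ) (hs' : s' ↔ 0 < σ') {E O : EReal}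
    (hE : ∀ l, setDeg (parityPart (S l) 0) = E) (hO : ∀ l, setDeg (parityPart (S l) 1) = O)
    (hne : (S 0).Nonempty) (j : ℕ) :
    DegreeTable σ E O (j + 2) (setDeg (parityPart (A (j + 1)) 0))
        (setDeg (parityPart (A (j + 1)) 1)) ∧
      DegreeTable σ' E O (j + 2) (setDeg (parityPart (B (j + 1)) 0))
        (setDeg (parityPart (B (j + 1)) 1)) := by
  have hrow0 : O < E → _ := fun hlt => h.degreeRows (p := 0) two_pos hE hO hlt j
  have hrow1 : E < O → _ := fun hlt => h.degreeRows (p := 1) one_lt_two hO hE hlt j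
  have hO0 : E < O → O ≠ 0 := by
    intro _ h0
    have := (setDeg_eq_natCast_iff.1 ((hO 0).trans (h0.trans Nat.cast_zero.symm))).1.2
    omega
  have hEO : E = O → BothUnbounded (A (j + 1)) ∧ BothUnbounded (B (j + 1)) := by
    intro heq
    -- Equal degrees must be infinite: `⊥` contradicts nonemptiness, and a finite value would be
    -- both even and odd.
    have htop : E = ⊤ := by
      rcases setDeg_trichotomy (parityPart (S 0) 0) with hD | ⟨m, hD⟩ | hD
      · have hD' := (hO 0).trans (heq.symm.trans ((hE 0).symm.trans hD))
        rw [setDeg_eq_bot_iff] at hD hD'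
        obtain ⟨n, hn⟩ := hne
        rcases Nat.mod_two_eq_zero_or_one n with h0 | h0
        · exact absurd (hD.subset ⟨hn, h0⟩) (Set.notMem_empty n)
        · exact absurd (hD'.subset ⟨hn, h0⟩) (Set.notMem_empty n)
      · have hD' := (hO 0).trans (heq.symm.trans ((hE 0).symm.trans hD))
        have e1 := (setDeg_eq_natCast_iff.1 hD).1.2
        have e2 := (setDeg_eq_natCast_iff.1 hD').1.2
        omega
      · exact (hE 0).symm.trans hD
    refine h.bothUnbounded (fun l r hr N => ?_) j
    have : setDeg (parityPart (S l) r) = ⊤ := by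
      interval_cases r
      · exact (hE l).trans htop
      · exact (hO l).trans (heq ▸ htop)
    obtain ⟨n, hn, hN⟩ := setDeg_eq_top_iff.1 this N
    exact ⟨n, hn.1, hn.2, hN⟩
  -- The rows with dominating odd degree are the generic row with swapped entries; the case of
  -- degree 0 cannot occur there, because the degree is odd or infinite.
  have table : ∀ (t : Prop) (τ : ℝ) (x y : EReal), 0 ≤ τ → (t ↔ 0 < τ) →
      (O < E → DegreeRow t E O j x y) → (E < O → DegreeRow t O E j y x) →
      (E = O → x = ⊤ ∧ y = ⊤) → DegreeTable τ E O (j + 2) x y := by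
    intro t τ x y hτ ht r0 r1 r2
    have hz : τ = 0 → ¬t := fun h0 h1 => by simp [ht, h0] at h1
    exact ⟨fun h0 hlt => (r0 hlt).1 (ht.2 h0),
      fun h0 hlt => ⟨((r1 hlt).1 (ht.2 h0)).2.1 (hO0 hlt), ((r1 hlt).1 (ht.2 h0)).1⟩,
      fun h0 hlt => (r0 hlt).2 (hz h0),
      fun h0 hlt => ⟨((r1 hlt).2 (hz h0)).2, ((r1 hlt).2 (hz h0)).1⟩, r2⟩
  exact ⟨table s σ _ _ hσ hs (fun hlt => (hrow0 hlt).1) (fun hlt => (hrow1 hlt).1) fun heq =>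
      ⟨(hEO heq).1.setDeg_eq_top two_pos, (hEO heq).1.setDeg_eq_top one_lt_two⟩,
    table s' σ' _ _ hσ' hs' (fun hlt => (hrow0 hlt).2) (fun hlt => (hrow1 hlt).2) fun heq =>
      ⟨(hEO heq).2.setDeg_eq_top two_pos, (hEO heq).2.setDeg_eq_top one_lt_two⟩⟩

end LayerSupports

/-! ### The power series of the normalized kernels -/

/-- Together with the normalization `nngpG_one` this keeps the layer functions inside `[-1, 1]`, so
that their series can be composed. -/
lemma HasNonnegSeries.abs_le {F : ℝ → ℝ} {T : Set ℕ} (h : HasNonnegSeries F T) {t : ℝ}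
    (ht : t ∈ Set.Icc (-1 : ℝ) 1) : |F t| ≤ F 1 := by
  obtain ⟨a, ha, hs, -⟩ := h
  have h1 := hs 1 (by simp)
  simp only [one_pow, mul_one] at h1
  rw [← (hs t ht).tsum_eq, ← h1.tsum_eq]
  refine (norm_tsum_le_tsum_norm (hs.summable_norm ha ht)).trans
    ((hs.summable_norm ha ht).tsum_le_tsum (fun n => ?_) h1.summable)
  rw [norm_mul, norm_pow, Real.norm_of_nonneg (ha n)]
  exact mul_le_of_le_one_right (ha n) (pow_le_one₀ (norm_nonneg _) (_root_.abs_le.2 ht))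

lemma hasNonnegSeries_dualAct {f : ℝ → ℝ} (hf : PolyBdd f) (hm : Measurable f) :
    HasNonnegSeries (dualAct f) (hermiteSupport f) :=
  ⟨_, fun n => sq_nonneg (hermiteCoeff f n), hasPowerSeriesOnUnit_dualAct hf hm, by
    ext n; simp [hermiteSupport]⟩

lemma dualAct_one_pos {f : ℝ → ℝ} (hf : PolyBdd f) (hm : Measurable f)
    (hne : (hermiteSupport f).Nonempty) : 0 < dualAct f 1 := by
  obtain ⟨n, hn⟩ := hne
  have h1 := hasPowerSeriesOnUnit_dualAct hf hm 1 (by simp)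
  simp only [one_pow, mul_one] at h1
  rw [← h1.tsum_eq]
  exact h1.summable.tsum_pos (fun n => sq_nonneg _) n (by have : hermiteCoeff f n ≠ 0 := hn; positivity)

section Network

variable (φ : ℝ → ℝ) (σw σb σi : ℝ)

/-- The activation of layer `l + 1`, scaled by the standard deviation of its input. -/
def layerAct (l : ℕ) (x : ℝ) : ℝ := φ (√(layerVar φ σw σb σi (l + 1)) * x)

/-- The derivative of the activation at the scaled input of layer `l + 1`. -/
def layerActDeriv (l : ℕ) (x : ℝ) : ℝ := deriv φ (√(layerVar φ σw σb σi (l + 1)) * x)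

/-- The support of the power series of `nngpG` at depth `l + 1`. -/
def nngpSupport : ℕ → Set ℕ
  | 0 => {1} ∪ zeroSet (0 < σi ^ 2 * σb ^ 2)
  | l + 1 => zeroSet (0 < σi ^ 2 * σb ^ 2) ∪
      compSet (hermiteSupport (layerAct φ σw σb σi l)) (nngpSupport l)

/-- The support of the power series of `ntkH` at depth `l + 1`. -/
def ntkSupport : ℕ → Set ℕ
  | 0 => {1} ∪ zeroSet (0 < σb ^ 2)
  | l + 1 => zeroSet (0 < σb ^ 2) ∪
      compSet (hermiteSupport (layerAct φ σw σb σi l)) (nngpSupport φ σw σb σi l) ∪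
      addSet (compSet {n | n + 1 ∈ hermiteSupport (layerAct φ σw σb σi l)}
        (nngpSupport φ σw σb σi l)) (ntkSupport l)

lemma layerSupports : LayerSupports (fun l => hermiteSupport (layerAct φ σw σb σi l))
    (nngpSupport φ σw σb σi) (ntkSupport φ σw σb σi) (0 < σi ^ 2 * σb ^ 2) (0 < σb ^ 2) where
  bias h := by
    have h1 : σb ≠ 0 := by rintro rfl; simp at h
    positivity
  A_zero := rfl
  A_succ _ := rfl
  B_zero := rfl
  B_succ _ := rfl

variable {φ σw σb σi}

/-- The dual activation at 1 is the sum of the squared Hermite coefficients; a positive scale leaves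
the Hermite support nonempty, so the variance cannot collapse even without bias. -/
lemma layerVar_pos (hφ : IsActivation φ) (hσw : 0 < σw) (l : ℕ) :
    0 < layerVar φ σw σb σi (l + 1) := by
  induction l with
  | zero => simp only [layerVar]; positivity
  | succ l ih =>
    have h := dualAct_one_pos (hφ.polyBdd.comp_mul (√(layerVar φ σw σb σi (l + 1))))
      (hφ.measurable.comp (measurable_const_mul _))
      (hφ.hermiteSupport_comp_mul_nonempty (Real.sqrt_pos.2 ih))
    simp only [layerVar]
    positivity

lemma nngpG_one (hφ : IsActivation φ) (hσw : 0 < σw) (l : ℕ) : nngpG φ σw σb σi l 1 = 1 := by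
  induction l with
  | zero => rfl
  | succ l ih =>
    have h := (layerVar_pos (σb := σb) (σi := σi) hφ hσw l).ne'
    rw [nngpG, Function.comp_apply, ih]
    cases l with
    | zero =>
      have : (σb ^ 2 * σi ^ 2 + σw ^ 2 * 1) = layerVar φ σw σb σi (0 + 1) := by simp [layerVar]
      rw [zero_add] at h this
      rw [layerFun]
      beta_reduce
      rw [this, div_self h]
    | succ l => exact div_self h

lemma polyBdd_layerAct (hφ : IsActivation φ) (l : ℕ) : PolyBdd (layerAct φ σw σb σi l) :=
  hφ.polyBdd.comp_mul _

lemma measurable_layerAct (hφ : IsActivation φ) (l : ℕ) : Measurable (layerAct φ σw σb σi l) :=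
  hφ.measurable.comp (measurable_const_mul _)

lemma polyBdd_layerActDeriv (hφ : IsActivation φ) (l : ℕ) :
    PolyBdd (layerActDeriv φ σw σb σi l) :=
  hφ.polyBdd_deriv.comp_mul _

lemma measurable_layerActDeriv (l : ℕ) : Measurable (layerActDeriv φ σw σb σi l) :=
  (measurable_deriv φ).comp (measurable_const_mul _)

lemma zeroSet_bias : zeroSet (σb ^ 2 * σi ^ 2 ≠ 0) = zeroSet (0 < σi ^ 2 * σb ^ 2) := by
  have : σb ^ 2 * σi ^ 2 ≠ 0 ↔ 0 < σi ^ 2 * σb ^ 2 := by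
    rw [mul_comm]
    exact ⟨fun h => lt_of_le_of_ne (by positivity) h.symm, fun h => h.ne'⟩
  rw [propext this]

lemma layerVar_mul_nngpG (hφ : IsActivation φ) (hσw : 0 < σw) (l : ℕ) (t : ℝ) :
    layerVar φ σw σb σi (l + 2) * nngpG φ σw σb σi (l + 2) t = σb ^ 2 * σi ^ 2 +
      σw ^ 2 * dualAct (layerAct φ σw σb σi l) (nngpG φ σw σb σi (l + 1) t) :=
  mul_div_cancel₀ _ (layerVar_pos hφ hσw (l + 1)).ne'

/-- `nngpG` is given by a power series with nonnegative coefficients. -/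
lemma hasNonnegSeries_nngpG (hφ : IsActivation φ) (hσw : 0 < σw) (l : ℕ) :
    HasNonnegSeries (nngpG φ σw σb σi (l + 1)) (nngpSupport φ σw σb σi l) := by
  have hw : 0 < σw ^ 2 := by positivity
  have hb : 0 ≤ σb ^ 2 * σi ^ 2 := by positivity
  induction l with
  | zero =>
    have h := (((HasNonnegSeries.id.const_mul hw).add (HasNonnegSeries.const hb)).const_mul
      (inv_pos.2 (layerVar_pos (σb := σb) (σi := σi) hφ hσw 0)))
    rw [zeroSet_bias] at h
    refine h.congr fun t _ => ?_
    simp only [nngpG, layerFun, Function.comp_apply, _root_.id]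
    rw [inv_mul_eq_div, add_comm]
  | succ l ih =>
    have hmaps : ∀ t ∈ Set.Icc (-1 : ℝ) 1, nngpG φ σw σb σi (l + 1) t ∈ Set.Icc (-1 : ℝ) 1 :=
      fun t ht => abs_le.1 ((ih.abs_le ht).trans_eq (nngpG_one hφ hσw _))
    have hd := hasNonnegSeries_dualAct (polyBdd_layerAct (σw := σw) (σb := σb) (σi := σi) hφ l)
      (measurable_layerAct hφ l)
    have h := ((HasNonnegSeries.const hb).add ((hd.comp ih hmaps).const_mul hw)).const_mul
      (inv_pos.2 (layerVar_pos (σb := σb) (σi := σi) hφ hσw (l + 1)))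
    rw [zeroSet_bias] at h
    refine h.congr fun t _ => ?_
    rw [← layerVar_mul_nngpG hφ hσw, inv_mul_cancel_left₀ (layerVar_pos hφ hσw (l + 1)).ne']

lemma nngpG_mem_Icc (hφ : IsActivation φ) (hσw : 0 < σw) (l : ℕ) {t : ℝ}
    (ht : t ∈ Set.Icc (-1 : ℝ) 1) : nngpG φ σw σb σi (l + 1) t ∈ Set.Icc (-1 : ℝ) 1 :=
  abs_le.1 (((hasNonnegSeries_nngpG hφ hσw l).abs_le ht).trans_eq (nngpG_one hφ hσw _))

/-- `ntkH` is given by a power series with nonnegative coefficients. -/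
lemma hasNonnegSeries_ntkH (hφ : IsActivation φ) (hcont : Continuous φ) (hσw : 0 < σw) (l : ℕ) :
    HasNonnegSeries (ntkH φ σw σb σi (l + 1)) (ntkSupport φ σw σb σi l) := by
  have hw : 0 < σw ^ 2 := by positivity
  have hb : 0 ≤ σb ^ 2 := by positivity
  have hz : zeroSet (σb ^ 2 ≠ 0) = zeroSet (0 < σb ^ 2) := by
    rw [propext (show σb ^ 2 ≠ 0 ↔ 0 < σb ^ 2 from
      ⟨fun h => lt_of_le_of_ne hb h.symm, fun h => h.ne'⟩)]
  have hconst := HasNonnegSeries.const hb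
  rw [hz] at hconst
  induction l with
  | zero => exact ((HasNonnegSeries.id.const_mul hw).add hconst).congr fun t _ => add_comm _ _
  | succ l ih =>
    have hG := hasNonnegSeries_nngpG (σb := σb) (σi := σi) hφ hσw l
    have hmaps := fun t (ht : t ∈ Set.Icc (-1 : ℝ) 1) =>
      nngpG_mem_Icc (σb := σb) (σi := σi) hφ hσw l ht
    have hd := hasNonnegSeries_dualAct (polyBdd_layerAct (σw := σw) (σb := σb) (σi := σi) hφ l)
      (measurable_layerAct hφ l)
    have hd' := hasNonnegSeries_dualAct
      (polyBdd_layerActDeriv (σw := σw) (σb := σb) (σi := σi) hφ l) (measurable_layerActDeriv l)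
    have hsupp : hermiteSupport (layerActDeriv φ σw σb σi l) =
        {n | n + 1 ∈ hermiteSupport (layerAct φ σw σb σi l)} := Set.ext fun n =>
      hφ.mem_hermiteSupport_deriv hcont (Real.sqrt_pos.2 (layerVar_pos hφ hσw l)) n
    rw [hsupp] at hd'
    -- The term `σb ^ 2 * (1 - σi ^ 2)` may be negative, but the bias inside the NNGP term completes
    -- it to `σb ^ 2`. Hence nonnegativity, and hence the different bias parameters in the two
    -- tables.
    refine ((hconst.add ((hd.comp hG hmaps).const_mul hw)).add
      (((hd'.comp hG hmaps).mul ih).const_mul hw)).congr fun t _ => ?_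
    change _ = σb ^ 2 * (1 - σi ^ 2) +
      layerVar φ σw σb σi (l + 2) * nngpG φ σw σb σi (l + 2) t +
      σw ^ 2 * dualAct (layerActDeriv φ σw σb σi l) (nngpG φ σw σb σi (l + 1) t) *
        ntkH φ σw σb σi (l + 1) t
    rw [layerVar_mul_nngpG hφ hσw]
    ring

/-! ### The kernels on the unit sphere -/

section Kernels

variable {E : Type*} [NormedAddCommGroup E] [InnerProductSpace ℝ E]

lemma inner_mem_Icc_of_norm_eq_one {x y : E} (hx : ‖x‖ = 1) (hy : ‖y‖ = 1) :
    inner ℝ x y ∈ Set.Icc (-1 : ℝ) 1 := by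
  have := abs_real_inner_le_norm x y
  rw [hx, hy, one_mul] at this
  exact abs_le.1 this

/-- For unit vectors the two variances both equal `layerVar`, so the covariance is a multiple of a
correlation matrix and `gaussExp_scale` applies. -/
lemma nngpKernel_eq (hφ : IsActivation φ) (hσw : 0 < σw) (l : ℕ) {x y : E} (hx : ‖x‖ = 1)
    (hy : ‖y‖ = 1) : nngpKernel φ σw σb σi (l + 1) x y =
      layerVar φ σw σb σi (l + 1) * nngpG φ σw σb σi (l + 1) (inner ℝ x y) := by
  induction l generalizing x y with
  | zero =>
    have h := (layerVar_pos (σb := σb) (σi := σi) hφ hσw 0).ne'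
    simp only [nngpKernel, nngpG, layerFun, Function.comp_apply, _root_.id]
    rw [zero_add] at h ⊢
    rw [mul_div_cancel₀ _ h]
  | succ l ih =>
    rw [layerVar_mul_nngpG hφ hσw, nngpKernel]
    beta_reduce
    rw [ih hx hx, ih hx hy, ih hy hx, ih hy hy,
      real_inner_self_eq_norm_sq, real_inner_self_eq_norm_sq, real_inner_comm x y, hx, hy, one_pow,
      nngpG_one hφ hσw, mul_one, gaussExp_scale hφ.measurable (layerVar_pos hφ hσw l).le
        (nngpG_mem_Icc hφ hσw l (inner_mem_Icc_of_norm_eq_one hx hy))]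
    rfl

lemma ntkKernel_eq (hφ : IsActivation φ) (hσw : 0 < σw) (l : ℕ) {x y : E} (hx : ‖x‖ = 1)
    (hy : ‖y‖ = 1) :
    ntkKernel φ σw σb σi (l + 1) x y = ntkH φ σw σb σi (l + 1) (inner ℝ x y) := by
  induction l with
  | zero =>
    simp only [ntkKernel, nngpKernel, ntkH]
    ring
  | succ l ih =>
    rw [ntkKernel, ntkH]
    beta_reduce
    rw [ih, nngpKernel_eq hφ hσw (l + 1) hx hy, nngpKernel_eq hφ hσw l hx hx,
      nngpKernel_eq hφ hσw l hx hy, nngpKernel_eq hφ hσw l hy hx, nngpKernel_eq hφ hσw l hy hy,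
      real_inner_self_eq_norm_sq, real_inner_self_eq_norm_sq, real_inner_comm x y, hx, hy, one_pow,
      nngpG_one hφ hσw, mul_one, gaussExp_scale (measurable_deriv φ) (layerVar_pos hφ hσw l).le
        (nngpG_mem_Icc hφ hσw l (inner_mem_Icc_of_norm_eq_one hx hy))]

end Kernels

end Network

/-! ### Gaussian integrals of polynomials in several variables -/

section GaussianIntegral

variable {d : ℕ}

/-- Evaluation of a polynomial at a point of `ℝᵈ⁺¹`. -/
def evalAt (p : MvPolynomial (Fin (d + 1)) ℝ) (y : EuclideanSpace ℝ (Fin (d + 1))) : ℝ :=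
  MvPolynomial.eval (fun i => y i) p

lemma restrictToSphere_apply (p : MvPolynomial (Fin (d + 1)) ℝ) (x : UnitSphere d) :
    restrictToSphere d p x = evalAt p (x : EuclideanSpace ℝ (Fin (d + 1))) := rfl

lemma continuous_evalAt (p : MvPolynomial (Fin (d + 1)) ℝ) : Continuous (evalAt p) :=
  (MvPolynomial.continuous_eval p).comp (by fun_prop)

lemma evalAt_smul_of_isHomogeneous {p : MvPolynomial (Fin (d + 1)) ℝ} {m : ℕ}
    (hp : p.IsHomogeneous m) (r : ℝ) (y : EuclideanSpace ℝ (Fin (d + 1))) :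
    evalAt p (r • y) = r ^ m * evalAt p y := by
  rw [evalAt, evalAt, MvPolynomial.eval_eq', MvPolynomial.eval_eq', Finset.mul_sum]
  refine Finset.sum_congr rfl fun s hs => ?_
  have hs' : ∑ i, s i = m := by
    rw [hp.degree_eq_sum_deg_support hs]
    exact (Finset.sum_subset (Finset.subset_univ _) fun i _ hi => by simpa using hi).symm
  simp only [PiLp.smul_apply, smul_eq_mul, mul_pow, Finset.prod_mul_distrib,
    Finset.prod_pow_eq_pow_sum, hs']
  ring

lemma abs_evalAt_monomial_le (s : Fin (d + 1) →₀ ℕ) (a : ℝ)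
    (y : EuclideanSpace ℝ (Fin (d + 1))) :
    |evalAt (MvPolynomial.monomial s a) y| ≤ |a| * ‖y‖ ^ (∑ i, s i) := by
  rw [evalAt, MvPolynomial.eval_monomial, abs_mul, Finsupp.prod_fintype _ _ (by simp),
    Finset.abs_prod, ← Finset.prod_pow_eq_pow_sum]
  gcongr with i _
  rw [abs_pow]
  gcongr
  exact PiLp.norm_apply_le y i

/-- In polar coordinates this is a one-dimensional Gaussian moment of order `d + k`. -/
lemma integrable_norm_pow_mul_exp (k : ℕ) :
    Integrable fun y : EuclideanSpace ℝ (Fin (d + 1)) => ‖y‖ ^ k * Real.exp (-‖y‖ ^ 2 / 2) := by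
  have h := (integrable_fun_norm_addHaar (volume : Measure (EuclideanSpace ℝ (Fin (d + 1))))
    (f := fun r : ℝ => r ^ k * Real.exp (-r ^ 2 / 2))).2
  apply h
  have h2 := integrableOn_rpow_mul_exp_neg_mul_sq (b := 1 / 2) (by norm_num)
    (s := ((d + k : ℕ) : ℝ)) (lt_of_lt_of_le (by norm_num) (Nat.cast_nonneg _))
  refine h2.congr_fun (fun y _ => ?_) measurableSet_Ioi
  simp only [Real.rpow_natCast, finrank_euclideanSpace, Fintype.card_fin, Nat.add_sub_cancel,
    smul_eq_mul]
  rw [pow_add, mul_assoc]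
  congr 3
  ring

lemma integrable_evalAt_mul_exp (p : MvPolynomial (Fin (d + 1)) ℝ) :
    Integrable fun y => evalAt p y * Real.exp (-‖y‖ ^ 2 / 2) := by
  induction p using MvPolynomial.induction_on' with
  | monomial s a =>
    refine ((integrable_norm_pow_mul_exp (∑ i, s i)).const_mul |a|).mono'
      ((continuous_evalAt _).mul (by fun_prop)).aestronglyMeasurable
      (Eventually.of_forall fun y => ?_)
    rw [Real.norm_eq_abs, abs_mul, Real.abs_exp, ← mul_assoc]
    gcongr
    exact abs_evalAt_monomial_le s a y
  | add p q hp hq =>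
    refine (hp.add hq).congr (Eventually.of_forall fun y => ?_)
    simp [evalAt, add_mul]

/-- The integral of a polynomial against the weight `exp (-‖y‖² / 2)`. -/
def gaussInt (p : MvPolynomial (Fin (d + 1)) ℝ) : ℝ :=
  ∫ y, evalAt p y * Real.exp (-‖y‖ ^ 2 / 2)

lemma gaussInt_add (p q : MvPolynomial (Fin (d + 1)) ℝ) :
    gaussInt (p + q) = gaussInt p + gaussInt q := by
  rw [gaussInt, gaussInt, gaussInt,
    ← integral_add (integrable_evalAt_mul_exp p) (integrable_evalAt_mul_exp q)]
  simp [evalAt, add_mul]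

lemma gaussInt_C_mul (c : ℝ) (p : MvPolynomial (Fin (d + 1)) ℝ) :
    gaussInt (MvPolynomial.C c * p) = c * gaussInt p := by
  rw [gaussInt, gaussInt, ← integral_const_mul]
  simp [evalAt, mul_assoc]

lemma gaussInt_sum {ι : Type*} (s : Finset ι) (f : ι → MvPolynomial (Fin (d + 1)) ℝ) :
    gaussInt (∑ i ∈ s, f i) = ∑ i ∈ s, gaussInt (f i) := by
  classical
  induction s using Finset.induction_on with
  | empty => simp [gaussInt, evalAt]
  | insert i s hi ih => rw [Finset.sum_insert hi, Finset.sum_insert hi, gaussInt_add, ih]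

lemma gaussInt_one_pos : 0 < gaussInt (1 : MvPolynomial (Fin (d + 1)) ℝ) := by
  have h := integrable_evalAt_mul_exp (1 : MvPolynomial (Fin (d + 1)) ℝ)
  simp only [gaussInt, evalAt, map_one, one_mul] at h ⊢
  exact integral_exp_pos h

lemma hasLineDerivAt_evalAt (p : MvPolynomial (Fin (d + 1)) ℝ) (i : Fin (d + 1))
    (y : EuclideanSpace ℝ (Fin (d + 1))) :
    HasLineDerivAt ℝ (evalAt p) (evalAt (MvPolynomial.pderiv i p) y) y
      (EuclideanSpace.single i 1) := by
  unfold HasLineDerivAt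
  induction p using MvPolynomial.induction_on with
  | C a => simpa [evalAt] using hasDerivAt_const (0 : ℝ) a
  | add p q hp hq =>
    refine (hp.add hq).congr_deriv ?_ |>.congr_of_eventuallyEq ?_
    · simp [evalAt]
    · exact Eventually.of_forall fun t => by simp [evalAt]
  | mul_X p j hp =>
    have hX : HasDerivAt (fun t : ℝ => (y + t • EuclideanSpace.single i (1 : ℝ)) j)
        (if j = i then 1 else 0) 0 := by
      by_cases h : j = i
      · subst h
        simpa using (hasDerivAt_id (0 : ℝ)).const_add (y j)
      · simp only [PiLp.add_apply, PiLp.smul_apply, PiLp.single_apply, h, if_false,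
          smul_zero, add_zero]
        exact hasDerivAt_const _ _
    refine (hp.mul hX).congr_deriv ?_ |>.congr_of_eventuallyEq ?_
    · simp [evalAt, MvPolynomial.pderiv_X, Pi.single_apply]
      split_ifs <;> simp [mul_comm, add_comm]
    · exact Eventually.of_forall fun t => by simp [evalAt]

lemma hasLineDerivAt_exp_norm_sq (i : Fin (d + 1)) (y : EuclideanSpace ℝ (Fin (d + 1))) :
    HasLineDerivAt ℝ (fun y : EuclideanSpace ℝ (Fin (d + 1)) => Real.exp (-‖y‖ ^ 2 / 2))
      (-y i * Real.exp (-‖y‖ ^ 2 / 2)) y (EuclideanSpace.single i 1) := by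
  unfold HasLineDerivAt
  have hl : HasDerivAt (fun t : ℝ => y + t • EuclideanSpace.single i (1 : ℝ))
      (EuclideanSpace.single i (1 : ℝ)) 0 := by
    simpa using ((hasDerivAt_id (0 : ℝ)).smul_const (EuclideanSpace.single i (1 : ℝ))).const_add y
  refine (hl.norm_sq.fun_neg.div_const 2).exp.congr_deriv ?_
  simp [EuclideanSpace.inner_single_right]
  ring

/-- Gaussian integration by parts. -/
lemma gaussInt_X_mul (i : Fin (d + 1)) (p : MvPolynomial (Fin (d + 1)) ℝ) :
    gaussInt (MvPolynomial.X i * p) = gaussInt (MvPolynomial.pderiv i p) := by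
  have hX : ∀ y, evalAt p y * (-y i * Real.exp (-‖y‖ ^ 2 / 2)) =
      -(evalAt (MvPolynomial.X i * p) y * Real.exp (-‖y‖ ^ 2 / 2)) := fun y => by
    simp [evalAt]; ring
  have key := integral_bilinear_hasLineDerivAt_right_eq_neg_left_of_integrable
    (μ := (volume : Measure (EuclideanSpace ℝ (Fin (d + 1)))))
    (f := evalAt p) (f' := evalAt (MvPolynomial.pderiv i p))
    (g := fun y => Real.exp (-‖y‖ ^ 2 / 2)) (g' := fun y => -y i * Real.exp (-‖y‖ ^ 2 / 2))
    (v := EuclideanSpace.single i 1) (B := ContinuousLinearMap.mul ℝ ℝ)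
    (integrable_evalAt_mul_exp _) ?_ (integrable_evalAt_mul_exp _)
    (fun y _ => hasLineDerivAt_evalAt p i y) (fun y _ => hasLineDerivAt_exp_norm_sq i y)
  · simp only [ContinuousLinearMap.mul_apply', hX] at key
    rw [integral_neg, neg_inj] at key
    exact key
  · simp only [ContinuousLinearMap.mul_apply', hX]
    exact (integrable_evalAt_mul_exp _).neg

/-- The radial factor of the integral of a homogeneous polynomial of degree `m`. -/
def radialInt (d m : ℕ) : ℝ := ∫ r in Set.Ioi (0 : ℝ), r ^ d * (r ^ m * Real.exp (-r ^ 2 / 2))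

lemma radialInt_pos (d m : ℕ) : 0 < radialInt d m := by
  have h := integral_rpow_mul_exp_neg_mul_rpow (p := 2) (q := ((d + m : ℕ) : ℝ)) (b := 1 / 2)
    (by norm_num) (lt_of_lt_of_le (by norm_num) (Nat.cast_nonneg _)) (by norm_num)
  have h2 : radialInt d m = ∫ x in Set.Ioi (0 : ℝ),
      x ^ ((d + m : ℕ) : ℝ) * Real.exp (-(1 / 2) * x ^ (2 : ℝ)) := by
    refine setIntegral_congr_fun measurableSet_Ioi fun x _ => ?_
    simp only [Real.rpow_natCast, Real.rpow_two]
    rw [pow_add, mul_assoc]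
    congr 3
    ring
  rw [h2, h]
  have := Real.Gamma_pos_of_pos (s := (((d + m : ℕ) : ℝ) + 1) / 2) (by positivity)
  positivity

/-- The Gaussian integral of a homogeneous polynomial in polar coordinates. -/
lemma gaussInt_eq_radialInt_mul {p : MvPolynomial (Fin (d + 1)) ℝ} {m : ℕ}
    (hp : p.IsHomogeneous m) :
    gaussInt p = radialInt d m * ∫ x, restrictToSphere d p x ∂surfaceMeasure d := by
  set E := EuclideanSpace ℝ (Fin (d + 1))
  set μ : Measure E := volume
  have hdim : Module.finrank ℝ E - 1 = d := by simp [E]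
  calc
    gaussInt p = ∫ x : ({(0)}ᶜ : Set E), evalAt p x.1 * Real.exp (-‖x.1‖ ^ 2 / 2) ∂(μ.comap (↑)) := by
      rw [integral_subtype_comap (measurableSet_singleton _).compl
        fun x : E => evalAt p x * Real.exp (-‖x‖ ^ 2 / 2), restrict_compl_singleton]
      rfl
    _ = ∫ z : UnitSphere d × Set.Ioi (0 : ℝ), restrictToSphere d p z.1 *
          ((z.2 : ℝ) ^ m * Real.exp (-(z.2 : ℝ) ^ 2 / 2)) ∂μ.toSphere.prod (.volumeIoiPow d) := by
      -- Away from the origin, Lebesgue measure is the product of the surface measure and `r ^ d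
      -- dr`.
      have := μ.measurePreserving_homeomorphUnitSphereProd
      rw [hdim] at this
      rw [← this.integral_comp (Homeomorph.measurableEmbedding _)]
      refine integral_congr_ae (Eventually.of_forall fun x => ?_)
      have hx : ‖x.1‖ ≠ 0 := norm_ne_zero_iff.2 x.2
      simp only [restrictToSphere_apply, homeomorphUnitSphereProd_apply_fst_coe,
        homeomorphUnitSphereProd_apply_snd_coe, evalAt_smul_of_isHomogeneous hp]
      rw [inv_pow]
      field_simp
    _ = (∫ x, restrictToSphere d p x ∂μ.toSphere) * ∫ r : Set.Ioi (0 : ℝ),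
          ((r : ℝ) ^ m * Real.exp (-(r : ℝ) ^ 2 / 2)) ∂.volumeIoiPow d :=
      integral_prod_mul (restrictToSphere d p)
        fun r : Set.Ioi (0 : ℝ) => (r : ℝ) ^ m * Real.exp (-(r : ℝ) ^ 2 / 2)
    _ = _ := by
      rw [mul_comm]
      congr 1
      simp only [Measure.volumeIoiPow, ENNReal.ofReal]
      rw [integral_withDensity_eq_integral_smul,
        integral_subtype_comap measurableSet_Ioi
          fun a : ℝ => Real.toNNReal (a ^ d) • (a ^ m * Real.exp (-a ^ 2 / 2)), radialInt]
      · refine setIntegral_congr_fun measurableSet_Ioi fun x hx => ?_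
        rw [NNReal.smul_def, Real.coe_toNNReal _ (pow_nonneg hx.out.le _), smul_eq_mul]
      · exact (measurable_subtype_coe.pow_const _).real_toNNReal

end GaussianIntegral

/-! ### The Funk–Hecke formula for powers -/

section FunkHecke

variable {d : ℕ}

/-- The commutator is again a derivation and vanishes on the variables. -/
lemma pderiv_pderiv_comm {σ : Type*} (i j : σ) (p : MvPolynomial σ ℝ) :
    MvPolynomial.pderiv i (MvPolynomial.pderiv j p) =
      MvPolynomial.pderiv j (MvPolynomial.pderiv i p) := by
  classical
  let D : σ → Derivation ℝ (MvPolynomial σ ℝ) (MvPolynomial σ ℝ) := MvPolynomial.pderiv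
  have h : ⁅D i, D j⁆ = 0 := by
    refine MvPolynomial.derivation_ext fun k => ?_
    rw [Derivation.commutator_apply]
    simp only [D, MvPolynomial.pderiv_X, Pi.single_apply]
    split_ifs <;> simp
  have h2 := congrArg (fun D => D p) h
  rw [Derivation.commutator_apply] at h2
  exact sub_eq_zero.1 h2

lemma polyLaplacian_apply (p : MvPolynomial (Fin (d + 1)) ℝ) :
    polyLaplacian d p = ∑ i, MvPolynomial.pderiv i (MvPolynomial.pderiv i p) := by
  simp [polyLaplacian]

lemma polyLaplacian_pderiv (i : Fin (d + 1)) (p : MvPolynomial (Fin (d + 1)) ℝ) :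
    polyLaplacian d (MvPolynomial.pderiv i p) = MvPolynomial.pderiv i (polyLaplacian d p) := by
  simp only [polyLaplacian_apply, map_sum]
  refine Finset.sum_congr rfl fun j _ => ?_
  rw [pderiv_pderiv_comm j i p, pderiv_pderiv_comm j i]

/-- The linear form `y ↦ ⟨x, y⟩`. -/
def linForm (x : EuclideanSpace ℝ (Fin (d + 1))) : MvPolynomial (Fin (d + 1)) ℝ :=
  ∑ i, MvPolynomial.C (x i) * MvPolynomial.X i

lemma evalAt_linForm (x y : EuclideanSpace ℝ (Fin (d + 1))) :
    evalAt (linForm x) y = inner ℝ x y := by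
  simp [evalAt, linForm, PiLp.inner_apply, mul_comm]

lemma isHomogeneous_linForm (x : EuclideanSpace ℝ (Fin (d + 1))) :
    (linForm x).IsHomogeneous 1 :=
  MvPolynomial.IsHomogeneous.sum _ _ _ fun i _ => by
    simpa using (MvPolynomial.isHomogeneous_C _ (x i)).mul (MvPolynomial.isHomogeneous_X ℝ i)

lemma pderiv_linForm (x : EuclideanSpace ℝ (Fin (d + 1))) (i : Fin (d + 1)) :
    MvPolynomial.pderiv i (linForm x) = MvPolynomial.C (x i) := by
  classical
  simp only [linForm, map_sum, MvPolynomial.pderiv_C_mul, MvPolynomial.pderiv_X, Pi.single_apply,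
    mul_ite, mul_one, mul_zero]
  simp

lemma sum_sq_eq_one {x : EuclideanSpace ℝ (Fin (d + 1))} (hx : ‖x‖ = 1) : ∑ i, x i * x i = 1 := by
  have := EuclideanSpace.norm_sq_eq x
  simp only [hx, Real.norm_eq_abs, sq_abs] at this
  simp only [← sq, ← this, one_pow]

/-- The multiplier of `p ↦ ∫ ⟨x, y⟩ ^ n p(y) exp (-‖y‖² / 2) dy` on the harmonic homogeneous
polynomials of degree `l`. -/
def gaussMultiplier (d : ℕ) : ℕ → ℕ → ℝ
  | 0, 0 => gaussInt (1 : MvPolynomial (Fin (d + 1)) ℝ)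
  | 1, 0 => 0
  | n + 2, 0 => (n + 1) * gaussMultiplier d n 0
  | 0, _ + 1 => 0
  | n + 1, l + 1 => (n + 1) * gaussMultiplier d n l

/-- The recursion lowers `(n, l)` by `(2, 0)` or `(1, 1)`, which preserves the stated condition;
among the terminal values only the one at `(0, 0)` is nonzero. -/
lemma gaussMultiplier_nonneg_and_pos_iff (d n l : ℕ) :
    0 ≤ gaussMultiplier d n l ∧ (0 < gaussMultiplier d n l ↔ l ≤ n ∧ n % 2 = l % 2) := by
  induction n, l using gaussMultiplier.induct with
  | case1 => simp [gaussMultiplier, gaussInt_one_pos, gaussInt_one_pos.le]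
  | case2 => simp [gaussMultiplier]
  | case3 n ih =>
    rw [gaussMultiplier]
    refine ⟨mul_nonneg (by positivity) ih.1, ?_⟩
    rw [mul_pos_iff_of_pos_left (by positivity), ih.2]
    omega
  | case4 l => simp [gaussMultiplier]
  | case5 n l ih =>
    rw [gaussMultiplier]
    refine ⟨mul_nonneg (by positivity) ih.1, ?_⟩
    rw [mul_pos_iff_of_pos_left (by positivity), ih.2]
    omega

lemma gaussInt_linForm_pow_succ_mul (x : EuclideanSpace ℝ (Fin (d + 1))) (n : ℕ) :
    gaussInt (linForm x ^ (n + 1)) =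
      ∑ i, x i * gaussInt (MvPolynomial.pderiv i (linForm x ^ n)) := by
  rw [pow_succ', linForm, Finset.sum_mul, gaussInt_sum]
  refine Finset.sum_congr rfl fun i _ => ?_
  rw [mul_assoc, gaussInt_C_mul, gaussInt_X_mul]

lemma gaussInt_linForm_pow {x : EuclideanSpace ℝ (Fin (d + 1))} (hx : ‖x‖ = 1) (n : ℕ) :
    gaussInt (linForm x ^ n) = gaussMultiplier d n 0 := by
  induction n using Nat.twoStepInduction with
  | zero => simp [gaussMultiplier]
  | one =>
    rw [gaussInt_linForm_pow_succ_mul x 0]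
    simp [gaussMultiplier, gaussInt, evalAt]
  | more n ih _ =>
    rw [gaussInt_linForm_pow_succ_mul, gaussMultiplier, ← ih]
    have : ∀ i, x i * gaussInt (MvPolynomial.pderiv i (linForm x ^ (n + 1))) =
        x i * x i * ((n + 1) * gaussInt (linForm x ^ n)) := fun i => by
      rw [MvPolynomial.pderiv_pow, pderiv_linForm, Nat.add_sub_cancel]
      have h2 : ((n + 1 : ℕ) : MvPolynomial (Fin (d + 1)) ℝ) * linForm x ^ n *
          MvPolynomial.C (x i) = MvPolynomial.C ((n + 1) * x i) * linForm x ^ n := by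
        simp; ring
      rw [h2, gaussInt_C_mul]
      ring
    rw [Finset.sum_congr rfl fun i _ => this i, ← Finset.sum_mul, sum_sq_eq_one hx, one_mul]

/-- Euler's identity writes `(l + 1) p` as `∑ X i * ∂ᵢ p`, and integrating by parts removes each `X
i`. Derivatives falling on `∂ᵢ p` add up to the Laplacian and drop out; those falling on the power
lower `n`. The polynomials `∂ᵢ p` are again harmonic, of degree `l`, and Euler's identity at `x`
reassembles `p`. -/
theorem gaussInt_linForm_pow_mul {x : EuclideanSpace ℝ (Fin (d + 1))} (hx : ‖x‖ = 1) (n l : ℕ)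
    {p : MvPolynomial (Fin (d + 1)) ℝ} (hp : p.IsHomogeneous l) (hΔ : polyLaplacian d p = 0) :
    gaussInt (linForm x ^ n * p) = gaussMultiplier d n l * evalAt p x := by
  induction l generalizing n p with
  | zero =>
    obtain ⟨c, rfl⟩ : ∃ c, p = MvPolynomial.C c :=
      ⟨_, MvPolynomial.totalDegree_eq_zero_iff_eq_C.1 (Nat.le_zero.1 hp.totalDegree_le)⟩
    rw [mul_comm, gaussInt_C_mul, gaussInt_linForm_pow hx]
    simp [evalAt, mul_comm]
  | succ l ih =>
    have hpi : ∀ i, (MvPolynomial.pderiv i p).IsHomogeneous l := fun i => hp.pderiv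
    have hΔi : ∀ i, polyLaplacian d (MvPolynomial.pderiv i p) = 0 := fun i => by
      rw [polyLaplacian_pderiv, hΔ, map_zero]
    have hE := hp.sum_X_mul_pderiv
    have hEv : ∑ i, x i * evalAt (MvPolynomial.pderiv i p) x = (l + 1) * evalAt p x := by
      have := congrArg (fun q => evalAt q x) hE
      simpa [evalAt] using this
    have hE' : MvPolynomial.C ((l : ℝ) + 1) * (linForm x ^ n * p) =
        ∑ i, MvPolynomial.X i * (linForm x ^ n * MvPolynomial.pderiv i p) := by
      have h2 : MvPolynomial.C ((l : ℝ) + 1) * (linForm x ^ n * p) =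
          linForm x ^ n * ((l + 1) • p) := by
        simp; ring
      rw [h2, ← hE, Finset.mul_sum]
      exact Finset.sum_congr rfl fun i _ => by ring
    have h1 : ((l : ℝ) + 1) * gaussInt (linForm x ^ n * p) =
        ∑ i, (gaussInt (MvPolynomial.pderiv i (linForm x ^ n) * MvPolynomial.pderiv i p) +
          gaussInt (linForm x ^ n * MvPolynomial.pderiv i (MvPolynomial.pderiv i p))) := by
      rw [← gaussInt_C_mul, hE', gaussInt_sum]
      refine Finset.sum_congr rfl fun i _ => ?_
      rw [gaussInt_X_mul, MvPolynomial.pderiv_mul, gaussInt_add]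
    have h3 : ∑ i, gaussInt (linForm x ^ n * MvPolynomial.pderiv i (MvPolynomial.pderiv i p)) = 0 := by
      rw [← gaussInt_sum, ← Finset.mul_sum, ← polyLaplacian_apply, hΔ, mul_zero]
      simp [gaussInt, evalAt]
    rw [Finset.sum_add_distrib, h3, add_zero] at h1
    have hl : (0 : ℝ) < l + 1 := by positivity
    cases n with
    | zero =>
      simp only [pow_zero, MvPolynomial.pderiv_one, zero_mul] at h1 ⊢
      have h0 : gaussInt (0 : MvPolynomial (Fin (d + 1)) ℝ) = 0 := by simp [gaussInt, evalAt]
      simp only [h0, Finset.sum_const_zero, mul_eq_zero, hl.ne', false_or] at h1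
      rw [h1, gaussMultiplier, zero_mul]
    | succ n =>
      have h4 : ∀ i, gaussInt (MvPolynomial.pderiv i (linForm x ^ (n + 1)) *
          MvPolynomial.pderiv i p) = (n + 1) * gaussMultiplier d n l *
            (x i * evalAt (MvPolynomial.pderiv i p) x) := fun i => by
        have h5 : MvPolynomial.pderiv i (linForm x ^ (n + 1)) * MvPolynomial.pderiv i p =
            MvPolynomial.C ((n + 1) * x i) * (linForm x ^ n * MvPolynomial.pderiv i p) := by
          rw [MvPolynomial.pderiv_pow, pderiv_linForm, Nat.add_sub_cancel]
          simp; ring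
        rw [h5, gaussInt_C_mul, ih n (hpi i) (hΔi i)]
        ring
      rw [Finset.sum_congr rfl fun i _ => h4 i, ← Finset.mul_sum, hEv] at h1
      rw [gaussMultiplier]
      apply mul_left_cancel₀ hl.ne'
      rw [h1]
      ring

/-- The eigenvalue of the kernel `⟨x, y⟩ ^ n` on the spherical harmonics of degree `l`. -/
def powEigenvalue (d n l : ℕ) : ℝ := gaussMultiplier d n l / radialInt d (n + l)

lemma powEigenvalue_nonneg (d n l : ℕ) : 0 ≤ powEigenvalue d n l :=
  div_nonneg (gaussMultiplier_nonneg_and_pos_iff d n l).1 (radialInt_pos d _).le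

lemma powEigenvalue_pos_iff (d n l : ℕ) : 0 < powEigenvalue d n l ↔ l ≤ n ∧ n % 2 = l % 2 := by
  rw [powEigenvalue, div_pos_iff_of_pos_right (radialInt_pos d _),
    (gaussMultiplier_nonneg_and_pos_iff d n l).2]

/-- The integrand extends to a homogeneous polynomial of degree `n + l`, so its surface integral is
the Gaussian one divided by the radial factor. -/
theorem integral_inner_pow_mul_sphericalHarmonic (n l : ℕ) {Y : UnitSphere d → ℝ}
    (hY : Y ∈ sphericalHarmonics d l) (x : UnitSphere d) :
    ∫ y, inner ℝ (x : EuclideanSpace ℝ (Fin (d + 1))) (y : EuclideanSpace ℝ (Fin (d + 1))) ^ n * Y y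
      ∂surfaceMeasure d = powEigenvalue d n l * Y x := by
  obtain ⟨p, ⟨hp, hΔ⟩, rfl⟩ := hY
  have hp' : p.IsHomogeneous l := hp
  have hx : ‖(x : EuclideanSpace ℝ (Fin (d + 1)))‖ = 1 := by simp
  have h := gaussInt_linForm_pow_mul hx n l hp' hΔ
  rw [gaussInt_eq_radialInt_mul (m := n + l)
    (by simpa using ((isHomogeneous_linForm (x : EuclideanSpace ℝ (Fin (d + 1)))).pow n).mul hp')]
    at h
  have hint : ∀ y : UnitSphere d, restrictToSphere d (linForm x.1 ^ n * p) y =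
      inner ℝ x.1 y.1 ^ n * restrictToSphere d p y := fun y => by
    rw [restrictToSphere_apply, restrictToSphere_apply, ← evalAt_linForm]
    simp [evalAt]
  simp only [hint] at h
  rw [powEigenvalue, div_mul_eq_mul_div, eq_div_iff (radialInt_pos d _).ne', mul_comm, h,
    restrictToSphere_apply]

end FunkHecke

/-! ### Eigenvalues of zonal kernels -/

section Zonal

variable {d : ℕ}

instance : IsFiniteMeasure (surfaceMeasure d) := by
  unfold surfaceMeasure; infer_instance

/-- The inner product of two points of the sphere. -/
abbrev sphereInner (x y : UnitSphere d) : ℝ :=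
  inner ℝ (x : EuclideanSpace ℝ (Fin (d + 1))) (y : EuclideanSpace ℝ (Fin (d + 1)))

lemma sphereInner_mem_Icc (x y : UnitSphere d) : sphereInner x y ∈ Set.Icc (-1 : ℝ) 1 := by
  have := abs_real_inner_le_norm x.1 y.1
  simp only [norm_eq_of_mem_sphere, mul_one] at this
  exact abs_le.1 this

lemma continuous_of_mem_sphericalHarmonics {l : ℕ} {Y : UnitSphere d → ℝ}
    (hY : Y ∈ sphericalHarmonics d l) : Continuous Y := by
  obtain ⟨p, -, rfl⟩ := hY
  exact (continuous_evalAt p).comp continuous_subtype_val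

/-- These are the real and imaginary parts of `(X 0 + i X 1) ^ l`; the derivative conditions are the
Cauchy–Riemann equations and independence of the other variables. At least two variables are needed.
-/
lemma exists_harmonic_pair (hd : 1 ≤ d) (l : ℕ) :
    ∃ p q : MvPolynomial (Fin (d + 1)) ℝ, p.IsHomogeneous l ∧ q.IsHomogeneous l ∧
      (∀ i, MvPolynomial.pderiv i p =
        if i = 0 then MvPolynomial.pderiv 1 q else if i = 1 then -MvPolynomial.pderiv 0 q else 0) ∧
      (∀ i, i ≠ 0 → i ≠ 1 → MvPolynomial.pderiv i q = 0) ∧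
      evalAt p (EuclideanSpace.single 0 1) = 1 ∧ evalAt q (EuclideanSpace.single 0 1) = 0 := by
  have h01 : (0 : Fin (d + 1)) ≠ 1 := by
    obtain ⟨d, rfl⟩ := Nat.exists_eq_succ_of_ne_zero (Nat.one_le_iff_ne_zero.1 hd)
    exact Fin.zero_ne_one
  induction l with
  | zero =>
    refine ⟨1, 0, MvPolynomial.isHomogeneous_one _ _, MvPolynomial.isHomogeneous_zero _ _ _, ?_⟩
    simp [evalAt]
  | succ l ih =>
    obtain ⟨p, q, hp, hq, h1, h2, h3, h4⟩ := ih
    have hX := fun i : Fin (d + 1) => MvPolynomial.isHomogeneous_X ℝ i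
    refine ⟨MvPolynomial.X 0 * p - MvPolynomial.X 1 * q, MvPolynomial.X 0 * q + MvPolynomial.X 1 * p,
      ?_, ?_, fun i => ?_, fun i hi0 hi1 => ?_, ?_, ?_⟩
    · rw [add_comm l]; exact ((hX 0).mul hp).sub ((hX 1).mul hq)
    · rw [add_comm l]; exact ((hX 0).mul hq).add ((hX 1).mul hp)
    · have e0 := h1 0
      have e1 := h1 1
      simp only [if_true, h01.symm, if_false] at e0 e1
      by_cases hi0 : i = 0
      · subst hi0
        simp [MvPolynomial.pderiv_X_of_ne h01,
          MvPolynomial.pderiv_X_of_ne h01.symm, e0, e1]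
        ring
      · by_cases hi1 : i = 1
        · subst hi1
          simp [MvPolynomial.pderiv_X_of_ne h01,
            MvPolynomial.pderiv_X_of_ne h01.symm, e0, e1, h01.symm]
          ring
        · simp [MvPolynomial.pderiv_X_of_ne (Ne.symm hi0),
            MvPolynomial.pderiv_X_of_ne (Ne.symm hi1), h1 i, h2 i hi0 hi1, hi0, hi1]
    · simp [MvPolynomial.pderiv_X_of_ne (Ne.symm hi0),
        MvPolynomial.pderiv_X_of_ne (Ne.symm hi1), h1 i, h2 i hi0 hi1, hi0, hi1]
    · simp only [evalAt, map_sub, map_mul, MvPolynomial.eval_X] at h3 h4 ⊢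
      rw [h3, h4]
      simp
    · simp only [evalAt, map_add, map_mul, MvPolynomial.eval_X] at h3 h4 ⊢
      rw [h3, h4, PiLp.single_apply, PiLp.single_apply, if_neg h01.symm]
      simp

/-- A nonzero harmonic in every degree makes the eigenvalues unique and allows them to be bounded by
testing against it. -/
lemma exists_sphericalHarmonic_eq_one (hd : 1 ≤ d) (l : ℕ) :
    ∃ Y ∈ sphericalHarmonics d l, ∃ x : UnitSphere d, Y x = 1 := by
  obtain ⟨p, q, hp, -, h1, h2, h3, -⟩ := exists_harmonic_pair hd l
  have h01 : (1 : Fin (d + 1)) ≠ 0 := by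
    obtain ⟨d, rfl⟩ := Nat.exists_eq_succ_of_ne_zero (Nat.one_le_iff_ne_zero.1 hd)
    exact Fin.zero_ne_one.symm
  refine ⟨_, ⟨p, ⟨hp, ?_⟩, rfl⟩, ⟨EuclideanSpace.single 0 1, by simp⟩, h3⟩
  rw [SetLike.mem_coe, LinearMap.mem_ker, polyLaplacian_apply]
  -- By the Cauchy–Riemann equations the second derivatives in directions 0 and 1 are opposite mixed
  -- derivatives of `q`.
  have : ∀ i, MvPolynomial.pderiv i (MvPolynomial.pderiv i p) =
      (if i = 0 then MvPolynomial.pderiv 0 (MvPolynomial.pderiv 1 q) else 0) -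
      (if i = 1 then MvPolynomial.pderiv 0 (MvPolynomial.pderiv 1 q) else 0) := fun i => by
    rw [h1]
    by_cases hi0 : i = 0
    · subst hi0; simp [h01.symm]
    · by_cases hi1 : i = 1
      · subst hi1
        simp only [h01, if_true, if_false, map_neg, zero_sub]
        rw [pderiv_pderiv_comm 1 0]
      · simp [hi0, hi1]
  rw [Finset.sum_congr rfl fun i _ => this i]
  simp

lemma IsEigenvalueSeq.unique (hd : 1 ≤ d) {k : UnitSphere d → UnitSphere d → ℝ} {μ ν : ℕ → ℝ}
    (hμ : IsEigenvalueSeq d k μ) (hν : IsEigenvalueSeq d k ν) : μ = ν := by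
  funext l
  obtain ⟨Y, hY, x, hx⟩ := exists_sphericalHarmonic_eq_one hd l
  have := (hμ l Y hY x).symm.trans (hν l Y hY x)
  simpa [hx] using this

/-- The eigenvalue on the spherical harmonics of degree `l` of the zonal kernel with power series
coefficients `a`. -/
def zonalEigenvalue (d : ℕ) (a : ℕ → ℝ) (l : ℕ) : ℝ := ∑' n, a n * powEigenvalue d n l

/-- Since `|⟨x, y⟩ ^ n| ≤ 1`, testing on one fixed harmonic gives a bound uniform in `n`. -/
lemma abs_powEigenvalue_le (hd : 1 ≤ d) (l : ℕ) : ∃ C, ∀ n, |powEigenvalue d n l| ≤ C := by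
  obtain ⟨Y, hY, x, hx⟩ := exists_sphericalHarmonic_eq_one hd l
  obtain ⟨C, hC⟩ := (isCompact_range (continuous_of_mem_sphericalHarmonics hY)).isBounded.exists_norm_le
  refine ⟨C * (surfaceMeasure d).real Set.univ, fun n => ?_⟩
  have h := integral_inner_pow_mul_sphericalHarmonic n l hY x
  rw [hx, mul_one] at h
  rw [← h, ← Real.norm_eq_abs]
  refine norm_integral_le_of_norm_le_const (Eventually.of_forall fun y => ?_)
  rw [norm_mul, norm_pow]
  have h1 : ‖sphereInner x y‖ ≤ 1 := abs_le.2 (sphereInner_mem_Icc x y)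
  calc _ ≤ 1 * ‖Y y‖ := by gcongr; exact pow_le_one₀ (norm_nonneg _) h1
    _ ≤ C := by rw [one_mul]; exact hC _ ⟨y, rfl⟩

lemma summable_mul_powEigenvalue (hd : 1 ≤ d) {a : ℕ → ℝ} (ha : Summable fun n => ‖a n‖) (l : ℕ) :
    Summable fun n => a n * powEigenvalue d n l := by
  obtain ⟨C, hC⟩ := abs_powEigenvalue_le hd l
  refine Summable.of_norm_bounded (ha.mul_right C) fun n => ?_
  rw [norm_mul]
  gcongr
  exact hC n

theorem isEigenvalueSeq_zonalEigenvalue {a : ℕ → ℝ} (ha : Summable fun n => ‖a n‖)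
    {k : UnitSphere d → UnitSphere d → ℝ}
    (hk : ∀ x y, HasSum (fun n => a n * sphereInner x y ^ n) (k x y)) :
    IsEigenvalueSeq d k (zonalEigenvalue d a) := by
  intro l Y hY x
  have hYc := continuous_of_mem_sphericalHarmonics hY
  obtain ⟨C, hC⟩ := (isCompact_range hYc).isBounded.exists_norm_le
  have h := hasSum_integral_of_dominated_convergence (μ := surfaceMeasure d)
    (F := fun n y => a n * sphereInner x y ^ n * Y y) (f := fun y => k x y * Y y)
    (fun n _ => ‖a n‖ * C)
    (fun n => by
      have : Continuous fun y : UnitSphere d => a n * sphereInner x y ^ n * Y y := by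
        unfold sphereInner; fun_prop
      exact this.aestronglyMeasurable)
    (fun n => Eventually.of_forall fun y => by
      have h1 : ‖sphereInner x y‖ ≤ 1 := abs_le.2 (sphereInner_mem_Icc x y)
      rw [norm_mul, norm_mul, norm_pow]
      gcongr
      · exact mul_le_of_le_one_right (norm_nonneg _) (pow_le_one₀ (norm_nonneg _) h1)
      · exact hC _ ⟨y, rfl⟩)
    (Eventually.of_forall fun y => ha.mul_right C)
    (integrable_const _)
    (Eventually.of_forall fun y => (hk x y).mul_right (Y y))
  have h2 : ∀ n, ∫ y, a n * sphereInner x y ^ n * Y y ∂surfaceMeasure d =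
      a n * powEigenvalue d n l * Y x := fun n => by
    simp only [mul_assoc]
    rw [integral_const_mul, integral_inner_pow_mul_sphericalHarmonic n l hY x]
  simp only [h2] at h
  rw [← h.tsum_eq, tsum_mul_right, zonalEigenvalue]

lemma zonalEigenvalue_pos_iff (hd : 1 ≤ d) {a : ℕ → ℝ} (ha : Summable fun n => ‖a n‖)
    (ha0 : ∀ n, 0 ≤ a n) (l : ℕ) :
    0 < zonalEigenvalue d a l ↔ ∃ n ∈ parityPart {n | a n ≠ 0} (l % 2), l ≤ n := by
  have hs := summable_mul_powEigenvalue hd ha l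
  have h0 : ∀ n, 0 ≤ a n * powEigenvalue d n l :=
    fun n => mul_nonneg (ha0 n) (powEigenvalue_nonneg d n l)
  simp only [mem_parityPart, Set.mem_ofPred_eq]
  constructor
  · intro h
    obtain ⟨n, hn⟩ : ∃ n, a n * powEigenvalue d n l ≠ 0 := by
      by_contra! hc
      simp [zonalEigenvalue, hc] at h
    have h1 := left_ne_zero_of_mul hn
    have h2 := (powEigenvalue_pos_iff d n l).1
      ((powEigenvalue_nonneg d n l).lt_of_ne' (right_ne_zero_of_mul hn))
    exact ⟨n, ⟨h1, h2.2⟩, h2.1⟩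
  · rintro ⟨n, ⟨h1, h2⟩, h3⟩
    exact hs.tsum_pos h0 n (mul_pos ((ha0 n).lt_of_ne' h1) ((powEigenvalue_pos_iff d n l).2 ⟨h3, h2⟩))

theorem positiveUpTo_of_hasSum (hd : 1 ≤ d) {a : ℕ → ℝ} (ha : Summable fun n => ‖a n‖)
    (ha0 : ∀ n, 0 ≤ a n) {k : UnitSphere d → UnitSphere d → ℝ}
    (hk : ∀ x y, HasSum (fun n => a n * sphereInner x y ^ n) (k x y)) :
    PositiveUpTo d k (seqDegEven a) (seqDegOdd a) := by
  have h := isEigenvalueSeq_zonalEigenvalue ha hk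
  refine ⟨⟨_, h, fun μ hμ => hμ.unique hd h⟩, fun μ hμ j => ?_⟩
  rw [hμ.unique hd h, zonalEigenvalue_pos_iff hd ha ha0, zonalEigenvalue_pos_iff hd ha ha0,
    seqDegEven_eq, seqDegOdd_eq, natCast_le_setDeg, natCast_le_setDeg,
    show 2 * j % 2 = 0 by omega, show (2 * j + 1) % 2 = 1 by omega]
  exact ⟨Iff.rfl, Iff.rfl⟩

end Zonal

/-! ### Reproducing kernel Hilbert spaces with finitely many features -/

section FiniteFeatures

variable {X ι : Type} [Fintype ι]

/-- The kernel functions lie in the finite-dimensional span of the features. Elements are determined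
by their functions, so the span of the kernel functions in `H` is finite-dimensional, hence closed;
being dense, it is all of `H`. -/
lemma mem_span_of_mem_rkhsFunctions (Φ : ι → X → ℝ) {k : X → X → ℝ}
    (hk : ∀ x y, k x y = ∑ s, Φ s x * Φ s y) {f : X → ℝ} (hf : f ∈ rkhsFunctions k) :
    f ∈ Submodule.span ℝ (Set.range Φ) := by
  obtain ⟨H, _, _, _, _, hH, h, rfl⟩ := hf
  set V := Submodule.span ℝ (Set.range Φ)
  have : FiniteDimensional ℝ V := FiniteDimensional.span_of_finite ℝ (Set.finite_range Φ)
  set T : H →ₗ[ℝ] X → ℝ := (RKHS.coeCLM ℝ : H →L[ℝ] X → ℝ).toLinearMap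
  have hT : Function.Injective T := RKHS.coeCLM_injective
  set W := Submodule.span ℝ {RKHS.kerFun H x v | (x : X) (v : ℝ)}
  have hW : W ≤ V.comap T := by
    refine Submodule.span_le.2 ?_
    rintro _ ⟨y, v, rfl⟩
    have : T (RKHS.kerFun H y v) = ∑ s, (v * Φ s y) • Φ s := by
      funext x
      have h1 : T (RKHS.kerFun H y v) x = RKHS.kernel H x y v := RKHS.kerFun_apply H y v x
      have h2 : RKHS.kernel H x y v = v * RKHS.kernel H x y 1 := by
        rw [← smul_eq_mul v, ← map_smul, smul_eq_mul, mul_one]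
      rw [h1, h2, hH, hk, Finset.mul_sum, Finset.sum_apply]
      exact Finset.sum_congr rfl fun s _ => by simp; ring
    change T (RKHS.kerFun H y v) ∈ V
    rw [this]
    exact Submodule.sum_mem _ fun s _ => Submodule.smul_mem _ _ (Submodule.subset_span ⟨s, rfl⟩)
  have : FiniteDimensional ℝ W := by
    refine FiniteDimensional.of_injective ((T.restrict hW : W →ₗ[ℝ] V)) fun a b hab => ?_
    exact Subtype.ext (hT (congrArg Subtype.val hab))
  have htop : W = ⊤ := by
    rw [← RKHS.kerFun_dense (𝕜 := ℝ) H]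
    exact (W.closed_of_finiteDimensional.submodule_topologicalClosure_eq).symm
  exact hW (htop ▸ Submodule.mem_top : h ∈ W)

/-- The features may be linearly dependent, so the space is realized on the orthogonal complement of
the coefficient vectors representing 0. The feature vector at `y` lies in it and is the kernel
function at `y`. -/
lemma mem_rkhsFunctions_of_mem_span (Φ : ι → X → ℝ) {k : X → X → ℝ}
    (hk : ∀ x y, k x y = ∑ s, Φ s x * Φ s y) {f : X → ℝ}
    (hf : f ∈ Submodule.span ℝ (Set.range Φ)) : f ∈ rkhsFunctions k := by
  set T : EuclideanSpace ℝ ι →ₗ[ℝ] X → ℝ :=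
    (Fintype.linearCombination ℝ Φ).comp (WithLp.linearEquiv 2 ℝ (ι → ℝ)).toLinearMap
  have hT : ∀ c x, T c x = ∑ s, c s * Φ s x := fun c x => by
    simp [T, Fintype.linearCombination_apply]
  set N := LinearMap.ker T
  let TH : Nᗮ →L[ℝ] X → ℝ := ContinuousLinearMap.pi fun x =>
    LinearMap.toContinuousLinearMap (LinearMap.proj x ∘ₗ T ∘ₗ Nᗮ.subtype)
  have hTH : ∀ c, TH c = T c := fun c => rfl
  let inst : RKHS ℝ Nᗮ X ℝ :=
    { coeCLM := TH
      coeCLM_injective := by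
        refine (injective_iff_map_eq_zero TH).2 fun c hc => ?_
        have h1 : (c : EuclideanSpace ℝ ι) ∈ N := hc
        exact Subtype.ext (inner_self_eq_zero.1 (c.2 _ h1)) }
  have hcoe : ∀ c : Nᗮ, (⇑c : X → ℝ) = T c := fun c => rfl
  let feat : X → Nᗮ := fun y => ⟨WithLp.toLp 2 fun s => Φ s y, fun c hc => by
    have := congrFun (show T c = 0 from hc) y
    rw [hT] at this
    simpa [PiLp.inner_apply, mul_comm] using this⟩
  have hker : ∀ y, RKHS.kerFun Nᗮ y 1 = feat y := fun y => by
    refine ext_inner_right ℝ fun c => ?_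
    rw [RKHS.kerFun_inner, hcoe, hT]
    simp [feat, PiLp.inner_apply, mul_comm]
  refine ⟨Nᗮ, inferInstance, inferInstance, inferInstance, inst, fun x y => ?_, ?_⟩
  · rw [← RKHS.kerFun_apply, hker, hcoe, hT, hk]
    exact Finset.sum_congr rfl fun s _ => mul_comm _ _
  · rw [← Fintype.range_linearCombination] at hf
    obtain ⟨c, rfl⟩ := hf
    -- Projecting changes the coefficients only by an element of `N`, hence not the represented
    -- function.
    refine ⟨Nᗮ.orthogonalProjectionOnto (WithLp.toLp 2 c), ?_⟩
    rw [hcoe, ← sub_eq_zero]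
    have h1 := Nᗮ.sub_starProjection_mem_orthogonal (WithLp.toLp 2 c)
    rw [Submodule.orthogonal_orthogonal] at h1
    have h2 : T (WithLp.toLp 2 c) = Fintype.linearCombination ℝ Φ c := rfl
    rw [← h2, ← map_sub, ← neg_sub, map_neg, neg_eq_zero]
    exact h1

/-- The RKHS of a kernel with finitely many features is spanned by the features. -/
theorem rkhsFunctions_eq_span (Φ : ι → X → ℝ) {k : X → X → ℝ}
    (hk : ∀ x y, k x y = ∑ s, Φ s x * Φ s y) :
    rkhsFunctions k = (Submodule.span ℝ (Set.range Φ) : Set (X → ℝ)) :=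
  Set.Subset.antisymm (fun _ => mem_span_of_mem_rkhsFunctions Φ hk)
    fun _ => mem_rkhsFunctions_of_mem_span Φ hk

end FiniteFeatures

/-! ### Decomposition of polynomials on the sphere into spherical harmonics -/

section Decomposition

variable {d : ℕ}

/-- The polynomial `‖x‖²`. -/
def normSqPoly (d : ℕ) : MvPolynomial (Fin (d + 1)) ℝ := ∑ i, MvPolynomial.X i ^ 2

lemma isHomogeneous_normSqPoly : (normSqPoly d).IsHomogeneous 2 :=
  MvPolynomial.IsHomogeneous.sum _ _ _ fun i _ => by
    simpa using (MvPolynomial.isHomogeneous_X ℝ i).pow 2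

lemma pderiv_normSqPoly (i : Fin (d + 1)) :
    MvPolynomial.pderiv i (normSqPoly d) = 2 * MvPolynomial.X i := by
  classical
  simp only [normSqPoly, map_sum, MvPolynomial.pderiv_pow, MvPolynomial.pderiv_X, Pi.single_apply]
  simp

lemma restrictToSphere_normSqPoly_mul (q : MvPolynomial (Fin (d + 1)) ℝ) :
    restrictToSphere d (normSqPoly d * q) = restrictToSphere d q := by
  funext x
  have hx := sum_sq_eq_one (x := x.1) (by simp)
  simp only [restrictToSphere_apply, evalAt, normSqPoly, map_mul, map_sum,
    MvPolynomial.eval_X, sq, hx, one_mul]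

lemma polyLaplacian_normSqPoly_mul {q : MvPolynomial (Fin (d + 1)) ℝ} {m : ℕ}
    (hq : q.IsHomogeneous m) :
    polyLaplacian d (normSqPoly d * q) =
      MvPolynomial.C (2 * (d + 1) + 4 * m : ℝ) * q + normSqPoly d * polyLaplacian d q := by
  have h : ∀ i, MvPolynomial.pderiv i (MvPolynomial.pderiv i (normSqPoly d * q)) =
      2 * q + 4 * (MvPolynomial.X i * MvPolynomial.pderiv i q) +
        normSqPoly d * MvPolynomial.pderiv i (MvPolynomial.pderiv i q) := fun i => by
    have h2 : MvPolynomial.pderiv i (2 : MvPolynomial (Fin (d + 1)) ℝ) = 0 :=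
      MvPolynomial.pderiv_C (a := (2 : ℝ))
    simp only [MvPolynomial.pderiv_mul, pderiv_normSqPoly, map_add, MvPolynomial.pderiv_X_self, h2]
    ring
  rw [polyLaplacian_apply, Finset.sum_congr rfl fun i _ => h i, Finset.sum_add_distrib,
    Finset.sum_add_distrib, ← Finset.mul_sum, ← Finset.mul_sum, ← Finset.mul_sum,
    hq.sum_X_mul_pderiv, ← polyLaplacian_apply]
  have h2 : (MvPolynomial.C 2 : MvPolynomial (Fin (d + 1)) ℝ) = 2 := map_ofNat MvPolynomial.C 2
  have h4 : (MvPolynomial.C 4 : MvPolynomial (Fin (d + 1)) ℝ) = 4 := map_ofNat MvPolynomial.C 4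
  simp [h2, h4]
  ring

lemma isHomogeneous_polyLaplacian {p : MvPolynomial (Fin (d + 1)) ℝ} {m : ℕ}
    (hp : p.IsHomogeneous (m + 2)) : (polyLaplacian d p).IsHomogeneous m := by
  rw [polyLaplacian_apply]
  exact MvPolynomial.IsHomogeneous.sum _ _ _ fun i _ => hp.pderiv.pderiv

lemma polyLaplacian_eq_zero_of_isHomogeneous {p : MvPolynomial (Fin (d + 1)) ℝ} {m : ℕ}
    (hp : p.IsHomogeneous m) (hm : m < 2) : polyLaplacian d p = 0 := by
  rw [polyLaplacian_apply]
  refine Finset.sum_eq_zero fun i _ => ?_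
  have h : (MvPolynomial.pderiv i p).IsHomogeneous 0 := by
    have := hp.pderiv (i := i)
    rwa [show m - 1 = 0 by omega] at this
  rw [MvPolynomial.totalDegree_eq_zero_iff_eq_C.1 (Nat.le_zero.1 h.totalDegree_le),
    MvPolynomial.pderiv_C]

/-- Applying the Laplacian to the equation gives one of the same kind for `r = Δq`, two degrees
lower and with the larger constant from `polyLaplacian_normSqPoly_mul`. Solving that first gives `q
= c⁻¹ (p - ‖x‖² r)`. -/
lemma exists_C_mul_add_normSqPoly_mul_eq (m : ℕ) {c : ℝ} (hc : 0 < c)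
    {p : MvPolynomial (Fin (d + 1)) ℝ} (hp : p.IsHomogeneous m) :
    ∃ q : MvPolynomial (Fin (d + 1)) ℝ, q.IsHomogeneous m ∧
      MvPolynomial.C c * q + normSqPoly d * polyLaplacian d q = p := by
  induction m using Nat.twoStepInduction generalizing c p with
  | zero | one =>
    have hq := hp.C_mul c⁻¹
    refine ⟨_, hq, ?_⟩
    rw [polyLaplacian_eq_zero_of_isHomogeneous hq (by norm_num), mul_zero, add_zero, ← mul_assoc,
      ← MvPolynomial.C_mul, mul_inv_cancel₀ hc.ne', MvPolynomial.C_1, one_mul]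
  | more m ih _ =>
    obtain ⟨r, hr, hr2⟩ := ih (c := c + (2 * (d + 1) + 4 * m)) (by positivity)
      (isHomogeneous_polyLaplacian hp)
    have hS : (normSqPoly d * r).IsHomogeneous (m + 2) := by
      rw [add_comm m]; exact isHomogeneous_normSqPoly.mul hr
    have hq := (hp.sub hS).C_mul c⁻¹
    have hcc : (MvPolynomial.C c : MvPolynomial (Fin (d + 1)) ℝ) * MvPolynomial.C c⁻¹ = 1 := by
      rw [← MvPolynomial.C_mul, mul_inv_cancel₀ hc.ne', MvPolynomial.C_1]
    have hΔ : polyLaplacian d (MvPolynomial.C c⁻¹ * (p - normSqPoly d * r)) = r := by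
      rw [← MvPolynomial.smul_eq_C_mul, map_smul, map_sub, polyLaplacian_normSqPoly_mul hr, ← hr2,
        MvPolynomial.smul_eq_C_mul, MvPolynomial.C_add]
      linear_combination r * hcc
    refine ⟨_, hq, ?_⟩
    rw [hΔ]
    linear_combination (p - normSqPoly d * r) * hcc

/-- The restrictions to the sphere of the homogeneous polynomials of degree `n`. -/
def sphereHomogeneous (d n : ℕ) : Submodule ℝ (UnitSphere d → ℝ) :=
  (MvPolynomial.homogeneousSubmodule (Fin (d + 1)) ℝ n).map (restrictToSphere d)

lemma sphericalHarmonics_le_sphereHomogeneous (d n : ℕ) :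
    sphericalHarmonics d n ≤ sphereHomogeneous d n :=
  Submodule.map_mono inf_le_left

lemma sphereHomogeneous_eq_sphericalHarmonics {n : ℕ} (hn : n < 2) :
    sphereHomogeneous d n = sphericalHarmonics d n := by
  refine le_antisymm ?_ (sphericalHarmonics_le_sphereHomogeneous d n)
  rintro _ ⟨p, hp, rfl⟩
  exact ⟨p, ⟨hp, polyLaplacian_eq_zero_of_isHomogeneous hp hn⟩, rfl⟩

/-- Choose `q` with `Δ(‖x‖² q) = Δp`; then `p - ‖x‖² q` is harmonic, and `‖x‖² q` restricts to `q`
on the sphere. -/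
lemma sphereHomogeneous_add_two (n : ℕ) :
    sphereHomogeneous d (n + 2) = sphericalHarmonics d (n + 2) ⊔ sphereHomogeneous d n := by
  apply le_antisymm
  · rintro _ ⟨p, hp, rfl⟩
    have hp : p.IsHomogeneous (n + 2) := hp
    obtain ⟨q, hq, hq2⟩ := exists_C_mul_add_normSqPoly_mul_eq n
      (c := 2 * (d + 1) + 4 * n) (by positivity) (isHomogeneous_polyLaplacian hp)
    have hS : (normSqPoly d * q).IsHomogeneous (n + 2) := by
      rw [add_comm n]; exact isHomogeneous_normSqPoly.mul hq
    refine Submodule.mem_sup.2 ⟨restrictToSphere d (p - normSqPoly d * q),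
      ⟨_, ⟨hp.sub hS, ?_⟩, rfl⟩, restrictToSphere d q, ⟨q, hq, rfl⟩, ?_⟩
    · rw [SetLike.mem_coe, LinearMap.mem_ker, map_sub, polyLaplacian_normSqPoly_mul hq, hq2, sub_self]
    · rw [map_sub, restrictToSphere_normSqPoly_mul, sub_add_cancel]
  · refine sup_le (sphericalHarmonics_le_sphereHomogeneous d _) ?_
    rintro _ ⟨q, hq, rfl⟩
    refine ⟨normSqPoly d * q, ?_, restrictToSphere_normSqPoly_mul q⟩
    have hq : q.IsHomogeneous n := hq
    have := isHomogeneous_normSqPoly.mul hq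
    rwa [add_comm 2] at this

/-- Homogeneous polynomials on the sphere are sums of spherical harmonics. -/
theorem sphereHomogeneous_eq_iSup (n : ℕ) :
    sphereHomogeneous d n = ⨆ l ∈ {l | l ≤ n ∧ n % 2 = l % 2}, sphericalHarmonics d l := by
  induction n using Nat.strong_induction_on with
  | _ n ih =>
  obtain hn | ⟨n, rfl⟩ : n < 2 ∨ ∃ m, n = m + 2 := by
    by_cases h : n < 2
    · exact .inl h
    · exact .inr ⟨n - 2, by omega⟩
  · rw [sphereHomogeneous_eq_sphericalHarmonics hn]
    apply le_antisymm
    · exact le_iSup₂_of_le n ⟨le_rfl, rfl⟩ le_rfl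
    · refine iSup₂_le fun l hl => ?_
      simp only [Set.mem_ofPred_eq] at hl
      obtain rfl : l = n := by omega
      rfl
  · rw [sphereHomogeneous_add_two, ih n (by omega)]
    apply le_antisymm
    · refine sup_le (le_iSup₂_of_le (n + 2) ⟨le_rfl, rfl⟩ le_rfl) (iSup₂_le fun l hl => ?_)
      simp only [Set.mem_ofPred_eq] at hl
      exact le_iSup₂_of_le l ⟨by omega, by omega⟩ le_rfl
    · refine iSup₂_le fun l hl => ?_
      simp only [Set.mem_ofPred_eq] at hl
      by_cases h : l = n + 2
      · subst h; exact le_sup_left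
      · exact le_sup_of_le_right (le_iSup₂_of_le l ⟨by omega, by omega⟩ le_rfl)

/-- Products are indexed by ordered tuples rather than exponents, so that powers of the inner
product expand without multinomial coefficients. That they span follows by induction from Euler's
identity. -/
lemma span_prod_X_eq_homogeneousSubmodule (n : ℕ) :
    Submodule.span ℝ (Set.range fun s : Fin n → Fin (d + 1) =>
      ∏ j, (MvPolynomial.X (s j) : MvPolynomial (Fin (d + 1)) ℝ)) =
      MvPolynomial.homogeneousSubmodule (Fin (d + 1)) ℝ n := by
  apply le_antisymm
  · refine Submodule.span_le.2 ?_
    rintro _ ⟨s, rfl⟩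
    have := MvPolynomial.IsHomogeneous.prod Finset.univ
      (fun j => (MvPolynomial.X (s j) : MvPolynomial (Fin (d + 1)) ℝ)) (fun _ => 1)
      fun j _ => MvPolynomial.isHomogeneous_X ℝ (s j)
    simpa using this
  · intro p hp
    have hp : p.IsHomogeneous n := hp
    induction n generalizing p with
    | zero =>
      rw [MvPolynomial.totalDegree_eq_zero_iff_eq_C.1 (Nat.le_zero.1 hp.totalDegree_le),
        ← mul_one (MvPolynomial.C _), ← MvPolynomial.smul_eq_C_mul]
      exact Submodule.smul_mem _ _ (Submodule.subset_span ⟨Fin.elim0, by simp⟩)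
    | succ n ih =>
      have h1 : p = ((n : ℝ) + 1)⁻¹ • ∑ i, MvPolynomial.X i * MvPolynomial.pderiv i p := by
        rw [hp.sum_X_mul_pderiv, ← Nat.cast_smul_eq_nsmul ℝ, smul_smul, Nat.cast_add_one,
          inv_mul_cancel₀ (by positivity), one_smul]
      rw [h1]
      refine Submodule.smul_mem _ _ (Submodule.sum_mem _ fun i _ => ?_)
      have h2 := ih (hp.pderiv (i := i)) (hp.pderiv (i := i))
      have h3 : Submodule.span ℝ (Set.range fun s : Fin n → Fin (d + 1) =>
          ∏ j, (MvPolynomial.X (s j) : MvPolynomial (Fin (d + 1)) ℝ)) ≤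
          (Submodule.span ℝ (Set.range fun s : Fin (n + 1) → Fin (d + 1) =>
            ∏ j, (MvPolynomial.X (s j) : MvPolynomial (Fin (d + 1)) ℝ))).comap
              (LinearMap.mulLeft ℝ (MvPolynomial.X i)) := by
        refine Submodule.span_le.2 ?_
        rintro _ ⟨s, rfl⟩
        exact Submodule.subset_span ⟨Fin.cons i s, by simp [Fin.prod_univ_succ]⟩
      exact h3 h2

lemma inner_pow_eq_sum (x y : EuclideanSpace ℝ (Fin (d + 1))) (n : ℕ) :
    (inner ℝ x y : ℝ) ^ n =
      ∑ s : Fin n → Fin (d + 1), (∏ j, x (s j)) * ∏ j, y (s j) := by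
  simp only [PiLp.inner_apply, ← Finset.prod_mul_distrib]
  rw [← Fin.prod_const, Finset.prod_univ_sum]
  simp [mul_comm]

/-- The RKHS of a polynomial zonal kernel. -/
theorem rkhsFunctions_zonal {a : ℕ → ℝ} (ha0 : ∀ n, 0 ≤ a n) {T : Finset ℕ}
    (hT : ∀ n, n ∈ T ↔ a n ≠ 0) {k : UnitSphere d → UnitSphere d → ℝ}
    (hk : ∀ x y, k x y = ∑ n ∈ T, a n * sphereInner x y ^ n) :
    rkhsFunctions k = ((⨆ n ∈ T, sphereHomogeneous d n : Submodule ℝ (UnitSphere d → ℝ)) :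
      Set (UnitSphere d → ℝ)) := by
  let Φ : (Σ n : T, Fin n → Fin (d + 1)) → UnitSphere d → ℝ :=
    fun s x => √(a s.1) * ∏ j, x.1 (s.2 j)
  rw [rkhsFunctions_eq_span Φ]
  · congr 1
    have hΦ : Set.range Φ = ⋃ n : T, Set.range fun s : Fin n → Fin (d + 1) => Φ ⟨n, s⟩ := by
      ext f; simp [Sigma.exists]
    rw [hΦ, Submodule.span_iUnion, iSup_subtype']
    refine iSup_congr fun n => ?_
    have h1 : (Set.range fun s : Fin n → Fin (d + 1) => Φ ⟨n, s⟩) = (√(a n) • restrictToSphere d) ''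
        Set.range fun s : Fin n → Fin (d + 1) =>
          ∏ j, (MvPolynomial.X (s j) : MvPolynomial (Fin (d + 1)) ℝ) := by
      rw [← Set.range_comp]
      congr 1
      funext s x
      simp [Φ, restrictToSphere_apply, evalAt]
    have h2 : √(a n) ≠ 0 := (Real.sqrt_pos.2 ((ha0 n).lt_of_ne' ((hT n).1 n.2))).ne'
    rw [h1, ← Submodule.map_span, span_prod_X_eq_homogeneousSubmodule, Submodule.map_smul _ _ _ h2,
      sphereHomogeneous]
  · intro x y
    rw [hk, Fintype.sum_sigma, ← Finset.sum_coe_sort]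
    refine Finset.sum_congr rfl fun n _ => ?_
    rw [sphereInner, inner_pow_eq_sum, Finset.mul_sum]
    refine Finset.sum_congr rfl fun s _ => ?_
    have := Real.mul_self_sqrt (ha0 n)
    simp only [Φ]
    linear_combination -((∏ j, x.1 (s j)) * ∏ j, y.1 (s j)) * this

end Decomposition

/-! ### Zonal kernels with nonnegative power series -/

section ZonalSeries

variable {d : ℕ} {F : ℝ → ℝ} {T : Set ℕ} {k : UnitSphere d → UnitSphere d → ℝ} {c : ℝ}

lemma HasNonnegSeries.exists_zonal (hF : HasNonnegSeries F T) (hc : 0 < c)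
    (hk : ∀ x y, k x y = c * F (sphereInner x y)) :
    ∃ b : ℕ → ℝ, (∀ n, 0 ≤ b n) ∧ (Summable fun n => ‖b n‖) ∧ {n | b n ≠ 0} = T ∧
      ∀ x y, HasSum (fun n => b n * sphereInner x y ^ n) (k x y) := by
  obtain ⟨a, ha0, ha, rfl⟩ := hF
  refine ⟨fun n => c * a n, fun n => mul_nonneg hc.le (ha0 n), (ha.summable.mul_left c).norm, ?_,
    fun x y => ?_⟩
  · ext n; simp [hc.ne']
  · rw [hk]
    simpa only [mul_assoc] using (ha _ (sphereInner_mem_Icc x y)).mul_left c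

theorem HasNonnegSeries.exists_positiveUpTo (hd : 1 ≤ d) (hF : HasNonnegSeries F T) (hc : 0 < c)
    (hk : ∀ x y, k x y = c * F (sphereInner x y)) :
    ∃ a : ℕ → ℝ, HasPowerSeriesOnUnit F a ∧ PositiveUpTo d k (seqDegEven a) (seqDegOdd a) ∧
      seqDegEven a = setDeg (parityPart T 0) ∧ seqDegOdd a = setDeg (parityPart T 1) := by
  obtain ⟨b, hb0, hb, hbT, hkb⟩ := hF.exists_zonal hc hk
  have h := positiveUpTo_of_hasSum hd hb hb0 hkb
  obtain ⟨a, -, ha, haT⟩ := hF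
  rw [seqDegEven_eq, seqDegOdd_eq, hbT] at h
  refine ⟨a, ha, ?_, ?_, ?_⟩
  · rwa [seqDegEven_eq, seqDegOdd_eq, haT]
  · rw [seqDegEven_eq, haT]
  · rw [seqDegOdd_eq, haT]

theorem HasNonnegSeries.polynomialRKHS (hd : 1 ≤ d) (hF : HasNonnegSeries F T) (hc : 0 < c)
    (hk : ∀ x y, k x y = c * F (sphereInner x y)) {N : ℕ} (hN : IsGreatest T N) :
    PolynomialRKHS d k N := by
  obtain ⟨b, hb0, hb, rfl, hkb⟩ := hF.exists_zonal hc hk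
  intro μ hμ
  obtain rfl := hμ.unique hd (isEigenvalueSeq_zonalEigenvalue hb hkb)
  have hpos := zonalEigenvalue_pos_iff hd hb hb0
  simp only [mem_parityPart, Set.mem_ofPred_eq] at hpos
  have hfin : {n | b n ≠ 0}.Finite := (Set.finite_Iic N).subset fun n hn => hN.2 hn
  refine ⟨?_, ?_, fun l hl => ?_⟩
  · rw [rkhsFunctions_zonal hb0 (T := hfin.toFinset) (fun n => by simp) fun x y => ?_]
    · congr 1
      -- Both directions rest on one description: a degree occurs in the restriction of some
      -- exponent `n` of the series, and has a positive eigenvalue, exactly when it is at most such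
      -- an `n` and of its parity.
      apply le_antisymm
      · refine iSup₂_le fun n hn => ?_
        rw [sphereHomogeneous_eq_iSup]
        refine iSup₂_le fun l hl => le_iSup₂_of_le l ?_ le_rfl
        exact (hpos l).2 ⟨n, ⟨by simpa using hn, hl.2⟩, hl.1⟩
      · refine iSup₂_le fun l hl => ?_
        obtain ⟨n, ⟨hn, hnl⟩, hln⟩ := (hpos l).1 hl
        refine le_iSup₂_of_le n (by simpa using hn) ?_
        rw [sphereHomogeneous_eq_iSup]
        exact le_iSup₂_of_le l ⟨hln, hnl⟩ le_rfl
    · rw [← (hkb x y).tsum_eq]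
      exact tsum_eq_sum fun n hn => by
        have : b n = 0 := by simpa using hn
        rw [this, zero_mul]
  · exact (hpos N).2 ⟨N, ⟨hN.1, rfl⟩, le_rfl⟩
  · obtain ⟨n, ⟨hn, -⟩, hln⟩ := (hpos l).1 hl
    exact hln.trans (hN.2 hn)

end ZonalSeries

/-! ### Polynomial activations and the conclusion -/

lemma isGreatest_hermiteSupport_layerAct {φ : ℝ → ℝ} {σw σb σi : ℝ} (hφ : IsActivation φ)
    (hσw : 0 < σw) {p : ℝ[X]} (hp : ∀ x, φ x = p.eval x) (l : ℕ) :
    IsGreatest (hermiteSupport (layerAct φ σw σb σi l)) p.natDegree := by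
  have hc : √(layerVar φ σw σb σi (l + 1)) ≠ 0 :=
    (Real.sqrt_pos.2 (layerVar_pos hφ hσw l)).ne'
  set c := √(layerVar φ σw σb σi (l + 1)) with hcdef
  have hp0 : p ≠ 0 := by
    rintro rfl
    exact hφ.ne_zero (funext fun x => by simpa using hp x)
  have hdeg : (p.comp (C c * X)).natDegree = p.natDegree := by
    rw [natDegree_comp, natDegree_C_mul_X _ hc, mul_one]
  have hq0 : p.comp (C c * X) ≠ 0 := by
    intro h
    have h0 : p.natDegree = 0 := by rw [← hdeg, h, natDegree_zero]
    rw [eq_C_of_natDegree_eq_zero h0, C_comp] at h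
    exact hp0 (by rw [eq_C_of_natDegree_eq_zero h0, h])
  rw [← hdeg]
  exact isGreatest_hermiteSupport_polynomial (fun x => by simp [layerAct, hp, ← hcdef]) hq0

end

theorem mainTheorem5 (d : ℕ) (hd : 1 ≤ d) (L : ℕ) (hL : 2 ≤ L) (σw σb σi : ℝ)
    (hσw : 0 < σw) (hσb : 0 ≤ σb) (hσi : 0 ≤ σi) (φ : ℝ → ℝ) (hφ : IsActivation φ) :
    (∃ a : ℕ → ℝ, HasPowerSeriesOnUnit (nngpG φ σw σb σi L) a ∧
      PositiveUpTo d (nngpSphere d φ σw σb σi L) (seqDegEven a) (seqDegOdd a) ∧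
      DegreeTable (σi ^ 2 * σb ^ 2) (hermiteDegEven φ) (hermiteDegOdd φ) L
        (seqDegEven a) (seqDegOdd a)) ∧
    (Continuous φ →
      ∃ a : ℕ → ℝ, HasPowerSeriesOnUnit (ntkH φ σw σb σi L) a ∧
        PositiveUpTo d (ntkSphere d φ σw σb σi L) (seqDegEven a) (seqDegOdd a) ∧
        DegreeTable (σb ^ 2) (hermiteDegEven φ) (hermiteDegOdd φ) L
          (seqDegEven a) (seqDegOdd a)) ∧
    (∀ p : Polynomial ℝ, (∀ x, φ x = p.eval x) →
      PolynomialRKHS d (nngpSphere d φ σw σb σi L) (p.natDegree ^ (L - 1)) ∧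
      PolynomialRKHS d (ntkSphere d φ σw σb σi L) (p.natDegree ^ (L - 1))) := by
  -- The supports are indexed from 0 at depth 1, so depth `L` is index `j + 1 = L - 1`, the exponent
  -- in the degree formulas.
  obtain ⟨j, rfl⟩ : ∃ j, L = j + 2 := ⟨L - 2, by omega⟩
  have hc : ∀ l, 0 < √(layerVar φ σw σb σi (l + 1)) :=
    fun l => Real.sqrt_pos.2 (layerVar_pos hφ hσw l)
  have hS := layerSupports (φ := φ) (σw := σw) (σb := σb) (σi := σi)
  have htable := hS.degreeTable (σ := σi ^ 2 * σb ^ 2) (σ' := σb ^ 2) (by positivity)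
    (by positivity) Iff.rfl Iff.rfl (E := hermiteDegEven φ) (O := hermiteDegOdd φ)
    (fun l => by rw [hermiteDegEven_eq]; exact hφ.setDeg_hermiteSupport two_pos (hc l))
    (fun l => by rw [hermiteDegOdd_eq]; exact hφ.setDeg_hermiteSupport one_lt_two (hc l))
    (hφ.hermiteSupport_comp_mul_nonempty (hc 0)) j
  have hG := hasNonnegSeries_nngpG (σb := σb) (σi := σi) hφ hσw (j + 1)
  have hV := layerVar_pos (σb := σb) (σi := σi) hφ hσw (j + 1)
  have hkG : ∀ x y : UnitSphere d, nngpSphere d φ σw σb σi (j + 2) x y =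
      layerVar φ σw σb σi (j + 2) * nngpG φ σw σb σi (j + 2) (sphereInner x y) :=
    fun x y => nngpKernel_eq hφ hσw (j + 1) (by simp) (by simp)
  have hkH : ∀ x y : UnitSphere d, ntkSphere d φ σw σb σi (j + 2) x y =
      1 * ntkH φ σw σb σi (j + 2) (sphereInner x y) :=
    fun x y => by rw [one_mul]; exact ntkKernel_eq hφ hσw (j + 1) (by simp) (by simp)
  refine ⟨?_, fun hcont => ?_, fun p hp => ?_⟩
  · obtain ⟨a, ha, hpos, hE, hO⟩ := hG.exists_positiveUpTo hd hV hkG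
    exact ⟨a, ha, hpos, by rw [hE, hO]; exact htable.1⟩
  · obtain ⟨a, ha, hpos, hE, hO⟩ :=
      (hasNonnegSeries_ntkH hφ hcont hσw (j + 1)).exists_positiveUpTo hd one_pos hkH
    exact ⟨a, ha, hpos, by rw [hE, hO]; exact htable.2⟩
  · have hcont : Continuous φ := by
      rw [funext hp]
      exact p.continuous
    have hm := isGreatest_hermiteSupport_layerAct (σb := σb) (σi := σi) hφ hσw hp
    exact ⟨hG.polynomialRKHS hd hV hkG (hS.isGreatest_A hm (j + 1)),
      (hasNonnegSeries_ntkH hφ hcont hσw (j + 1)).polynomialRKHS hd one_pos hkH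
        (hS.isGreatest_B hm (j + 1))⟩
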